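/- Let $\Bbbk=\mathbb R$ or $\mathbb C$, and let $\mathsf G$ be a proper étale Lie groupoid with Hausdorff, second countable finite-dimensional smooth manifolds $\mathsf G_0$ of objects and $\mathsf G_1$ of arrows, source and target maps $s,t$ (local diffeomorphisms, with $(s,t):\mathsf G_1\to\mathsf G_0\times\mathsf G_0$ proper), orbit space $X=\mathsf G_0/\mathsf G$ and projection $\pi:\mathsf G_0\to X$; $g_1g_2$ is defined if $s(g_1)=t(g_2)$. Functions are $\Bbbk$-valued. *Bornologies.* A convex bornology on a $\Bbbk$-vector space $V$ is a covering family of ("bounded") subsets which is stable under subsets, finite unions, scalar multiples and absolutely convex hulls. For an absolutely convex $T\subset V$ let $V_T$ be its linear span with the gauge seminorm $\|\cdot\|_T$; $T$ is completant if $(V_T,\|\cdot\|_T)$ is a Banach space. (For an arbitrary subset $S$, $V_S$ denotes its linear span; on vectors outside $V_T$ the gauge is $\infty$.) The bornology is complete if every bounded set is contained in a bounded completant absolutely convex set. A linear map is bounded if it maps bounded sets to bounded sets. A bornological algebra is an associative $\Bbbk$-algebra $A$ with a complete convex bornology and bounded multiplication; a left (right) $A$-module is a complete convex bornological vector space with a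 bounded left (right) action of $A$, in which the unit of $A$, if $A$ has one, acts as the identity. $A$ has an approximate identity if there are, for every bounded $S\subset A$, a bounded sequence $(u_{S,k})_{k\in\mathbb N}$ and a bounded completant absolutely convex $T_S\subset A$ such that (1) $u_{S,k}a,\ a u_{S,k}\in A_{T_S}$ for $a\in A_S$; (2) $\|u_{S,k}a-a\|_{T_S}\to0$ and $\|au_{S,k}-a\|_{T_S}\to0$ uniformly in $a\in S$; (3) if $S_1\subset S_2$, then $\|u_{S_2,k}a-a\|_{T_{S_2}}\le\|u_{S_1,k}a-a\|_{T_{S_2}}$ for all $a\in A_{T_{S_1}}$ and all $k$. $A$ is quasi-unital if it has an approximate identity and is projective as a left and as a right module over itself, i.e. bounded module maps from $A$ lift along every bounded module map which has a bounded linear section. *The algebras.* $\mathcal A\rtimes\mathsf G$ is $\mathcal C^\infty_{\mathrm{cpt}}(\mathsf G_1)$ with the product $(a_1*a_2)(g)=\sum_{g_1g_2=g}a_1(g_1)a_2(g_2)$; $S\subset\mathcal A\rtimes\mathsf G$ is bounded if there is a compact $K\subset \mathsf G_1$ with $\operatorname{supp}a\subset K$ for all $a\in S$ and $\sup_{a\in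 S}\sup_K|Da|<\infty$ for every differential operator $D$ on $\mathsf G_1$. For $U\subset X$ open, $\widetilde{\mathcal A}_{\mathrm{fc}}(U)$ is the space of $a\in\mathcal C^\infty((\pi s)^{-1}(U))$ such that $\operatorname{supp}a\cap(\pi s)^{-1}(K)$ is compact for every compact $K\subset U$, with the same product; $S\subset\widetilde{\mathcal A}_{\mathrm{fc}}(U)$ is bounded if for every compact $K\subset U$ the sets $\operatorname{supp}a\cap(\pi s)^{-1}(K)$, $a\in S$, lie in a common compact set, and $\sup_{a\in S}\sup_L|Da|<\infty$ for every differential operator $D$ on $\mathsf G_1$ and every compact $L\subset(\pi s)^{-1}(U)$. If moreover $\omega$ is a $\mathsf G$-invariant symplectic form on $\mathsf G_0$ (that is, $s^*\omega=t^*\omega$) and $f\star h=\sum_k\hbar^kC_k(f,h)$ is a $\mathsf G$-invariant local star product on $\mathcal C^\infty_{\mathsf G_0}[[\hbar]]$ (associative, with unit $1$, $C_k$ bidifferential, $C_0(f,h)=fh$, $C_1(f,h)-C_1(h,f)$ a fixed nonzero multiple of the Poisson bracket, and compatible with the right action of arrows on germs by $[f]g=[f\circ t\circ (s|_{\text{near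 }g})^{-1}]_{s(g)}$), then $\mathcal A^\hbar\rtimes\mathsf G$ is the space of formal power series $a=\sum_l a_l\hbar^l$ of smooth functions on $\mathsf G_1$ whose support $\operatorname{supp}a=\overline{\bigcup_l\operatorname{supp}a_l}$ is compact, with the product $[a_1\star_c a_2]_g=\sum_{g_1g_2=g}([a_1]_{g_1}g_2)\star[a_2]_{g_2}$, where $[a]_g$ is the germ of $a$ at $g$, regarded via $s$ as a germ at $s(g)$; $\widetilde{\mathcal A}{}^\hbar_{\mathrm{fc}}(U)$ is the space of formal power series of smooth functions on $(\pi s)^{-1}(U)$ with fibrewise compact support in the above sense, with the same product. Bounded sets are defined as before, with the bounds required for the coefficients $a_l$, for each $l$. **Theorem O.** With these products and bounded sets, $\mathcal A\rtimes\mathsf G$ is a quasi-unital bornological algebra, and so is $\mathcal A^\hbar\rtimes\mathsf G$ for every $\omega$ and $\star$ as above. Likewise $\widetilde{\mathcal A}_{\mathrm{fc}}$ and $\widetilde{\mathcal A}{}^\hbar_{\mathrm{fc}}$ are sheaves of quasi-unital bornological algebras on $X$: the algebra of sections over every open $U\subset X$ is a quasi-unital bornological algebra, restriction maps are bounded homomorphisms,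 compatible local sections glue uniquely, and a set of sections over a union of open sets is bounded if its restrictions to the members of the cover are bounded. Moreover, the natural inclusions $\mathcal A\rtimes\mathsf G\hookrightarrow\widetilde{\mathcal A}_{\mathrm{fc}}(X)$ and $\mathcal A^\hbar\rtimes\mathsf G\hookrightarrow\widetilde{\mathcal A}{}^\hbar_{\mathrm{fc}}(X)$ are bounded homomorphisms of algebras. -/

import Mathlib

open Set Filter Topology TopologicalSpace Function
open scoped Manifold ContDiff ENNReal Pointwise

universe w

noncomputable section

/-! ### Bornological vector spaces -/

section Bornological

variable (𝕜 : Type*) [RCLike 𝕜]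

/-- Absolutely convex (nonempty) subsets of a vector space. -/
structure IsDisk {V : Type*} [AddCommGroup V] [Module 𝕜 V] (T : Set V) : Prop where
  zero_mem : (0 : V) ∈ T
  add_mem : ∀ v₁ ∈ T, ∀ v₂ ∈ T, ∀ c₁ c₂ : 𝕜, ‖c₁‖ + ‖c₂‖ ≤ 1 → c₁ • v₁ + c₂ • v₂ ∈ T

/-- The absolutely convex hull. -/
def diskHull {V : Type*} [AddCommGroup V] [Module 𝕜 V] (S : Set V) : Set V :=
  ⋂₀ {T | S ⊆ T ∧ IsDisk 𝕜 T}

/-- A disk `T` is completant if its linear span `V_T`, normed by the gauge of `T`, is a Banach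
space. The gauge is `egauge 𝕜 T`, which is finite exactly on `V_T`. -/
structure IsCompletant {V : Type*} [AddCommGroup V] [Module 𝕜 V] (T : Set V) : Prop where
  isDisk : IsDisk 𝕜 T
  norming : ∀ x, egauge 𝕜 T x = 0 → x = 0
  complete : ∀ x : ℕ → V, (∀ n, x n ∈ Submodule.span 𝕜 T) →
    Tendsto (fun p : ℕ × ℕ => egauge 𝕜 T (x p.1 - x p.2)) atTop (𝓝 0) →
    ∃ y ∈ Submodule.span 𝕜 T, Tendsto (fun n => egauge 𝕜 T (x n - y)) atTop (𝓝 0)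

/-- A convex linear bornology on a vector space. Mathlib's `Bornology` says that the bounded sets
are closed under subsets and finite unions and cover the space. -/
structure ConvexBornology (V : Type*) [AddCommGroup V] [Module 𝕜 V] where
  toBornology : Bornology V
  bdd_smul : ∀ (c : 𝕜) (S : Set V), toBornology.IsBounded S → toBornology.IsBounded (c • S)
  bdd_diskHull : ∀ S : Set V, toBornology.IsBounded S → toBornology.IsBounded (diskHull 𝕜 S)

variable {𝕜}

namespace ConvexBornology

variable {V : Type*} [AddCommGroup V] [Module 𝕜 V] (B : ConvexBornology 𝕜 V)

/-- The bounded sets of a convex bornology. -/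
def Bdd (S : Set V) : Prop := B.toBornology.IsBounded S

/-- Completeness: every bounded set is contained in a bounded completant disk. -/
def IsComplete : Prop := ∀ S, B.Bdd S → ∃ T, S ⊆ T ∧ B.Bdd T ∧ IsCompletant 𝕜 T

end ConvexBornology

/-- Bounded linear maps between bornological vector spaces. -/
def IsBddMap {V W : Type*} [AddCommGroup V] [Module 𝕜 V] [AddCommGroup W] [Module 𝕜 W]
    (B : ConvexBornology 𝕜 V) (D : ConvexBornology 𝕜 W) (f : V →ₗ[𝕜] W) : Prop :=
  ∀ S, B.Bdd S → D.Bdd (f '' S)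

variable (𝕜)

/-- The structure of a (not necessarily unital) bornological algebra on a vector space. -/
structure BornAlg (A : Type*) [AddCommGroup A] [Module 𝕜 A] where
  born : ConvexBornology 𝕜 A
  complete : born.IsComplete
  mul : A →ₗ[𝕜] A →ₗ[𝕜] A
  mul_assoc : ∀ a b c, mul (mul a b) c = mul a (mul b c)
  mul_bdd : ∀ S T, born.Bdd S → born.Bdd T → born.Bdd (image2 (fun a b => mul a b) S T)

variable {𝕜}

/-- The structure of a left module over a bornological algebra `B` on a vector space `M`: a complete
bornology and a bounded action of the algebra, which extends to the smallest unital algebra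
containing it. If the algebra has no unit, the adjoined unit acts as the identity, so nothing is to
be required; if it has a unit, the unit has to act as the identity. -/
structure BornModule {A : Type*} [AddCommGroup A] [Module 𝕜 A] (B : BornAlg 𝕜 A)
    (M : Type*) [AddCommGroup M] [Module 𝕜 M] where
  born : ConvexBornology 𝕜 M
  complete : born.IsComplete
  act : A →ₗ[𝕜] M →ₗ[𝕜] M
  mul_act : ∀ a b x, act (B.mul a b) x = act a (act b x)
  one_act : ∀ e : A, (∀ a, B.mul e a = a ∧ B.mul a e = a) → ∀ x, act e x = x
  act_bdd : ∀ S T, B.born.Bdd S → born.Bdd T → born.Bdd (image2 (fun a x => act a x) S T)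

namespace BornModule

variable {A : Type*} [AddCommGroup A] [Module 𝕜 A] {B : BornAlg 𝕜 A}

/-- Bounded module homomorphisms. -/
def IsHom {M N : Type*} [AddCommGroup M] [Module 𝕜 M] [AddCommGroup N] [Module 𝕜 N]
    (BM : BornModule B M) (BN : BornModule B N) (f : M →ₗ[𝕜] N) : Prop :=
  IsBddMap BM.born BN.born f ∧ ∀ a x, f (BM.act a x) = BN.act a (f x)

/-- A module `P` is (relatively) projective if `Hom (P, -)` is exact on linearly split short exact
sequences of modules; as `Hom (P, -)` is always left exact, this means that homomorphisms from `P`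
lift along the module homomorphisms `p` that have a bounded linear section `σ`. -/
def IsProjective {P : Type*} [AddCommGroup P] [Module 𝕜 P] (BP : BornModule B P) : Prop :=
  ∀ (M N : Type w) [AddCommGroup M] [Module 𝕜 M] [AddCommGroup N] [Module 𝕜 N]
    (BM : BornModule B M) (BN : BornModule B N) (p : M →ₗ[𝕜] N) (σ : N →ₗ[𝕜] M),
    BM.IsHom BN p → IsBddMap BN.born BM.born σ → (∀ y, p (σ y) = y) →
    ∀ f : P →ₗ[𝕜] N, BP.IsHom BN f → ∃ F : P →ₗ[𝕜] M, BP.IsHom BM F ∧ ∀ x, p (F x) = f x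

end BornModule

namespace BornAlg

variable {A : Type*} [AddCommGroup A] [Module 𝕜 A] (B : BornAlg 𝕜 A)

/-- The algebra as a left module over itself. -/
def self : BornModule B A where
  born := B.born
  complete := B.complete
  act := B.mul
  mul_act := B.mul_assoc
  one_act _ he x := (he x).1
  act_bdd := B.mul_bdd

/-- The opposite algebra. Its left modules are the right modules of the algebra. -/
def op : BornAlg 𝕜 A where
  born := B.born
  complete := B.complete
  mul := B.mul.flip
  mul_assoc a b c := (B.mul_assoc c b a).symm
  mul_bdd S T hS hT := by
    have h := B.mul_bdd T S hT hS
    rw [image2_swap] at h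
    exact h

/-- Existence of an approximate identity. -/
def HasApproximateIdentity : Prop :=
  ∃ (u : Set A → ℕ → A) (T : Set A → Set A),
    (∀ S, B.born.Bdd S →
      B.born.Bdd (range (u S)) ∧ B.born.Bdd (T S) ∧ IsCompletant 𝕜 (T S) ∧
      (∀ a ∈ Submodule.span 𝕜 S, ∀ k, B.mul (u S k) a ∈ Submodule.span 𝕜 (T S) ∧
        B.mul a (u S k) ∈ Submodule.span 𝕜 (T S)) ∧
      (∀ ε : ℝ≥0∞, 0 < ε → ∃ k₀ : ℕ, ∀ k ≥ k₀, ∀ a ∈ S,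
        egauge 𝕜 (T S) (B.mul (u S k) a - a) ≤ ε ∧
        egauge 𝕜 (T S) (B.mul a (u S k) - a) ≤ ε)) ∧
    ∀ S₁ S₂, B.born.Bdd S₁ → B.born.Bdd S₂ → S₁ ⊆ S₂ →
      ∀ a ∈ Submodule.span 𝕜 (T S₁), ∀ k,
        egauge 𝕜 (T S₂) (B.mul (u S₂ k) a - a) ≤ egauge 𝕜 (T S₂) (B.mul (u S₁ k) a - a)

/-- Quasi-unital algebras: there is an approximate identity, and the algebra is projective as a left
and as a right module over itself. -/
structure QuasiUnital : Prop where
  approx : B.HasApproximateIdentity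
  projective_left : BornModule.IsProjective.{w} B.self
  projective_right : BornModule.IsProjective.{w} B.op.self

end BornAlg

/-- Bounded homomorphisms of bornological algebras. -/
def IsBddAlgHom {A A' : Type*} [AddCommGroup A] [Module 𝕜 A] [AddCommGroup A'] [Module 𝕜 A']
    (B : BornAlg 𝕜 A) (B' : BornAlg 𝕜 A') (f : A →ₗ[𝕜] A') : Prop :=
  IsBddMap B.born B'.born f ∧ ∀ a b, f (B.mul a b) = B'.mul (f a) (f b)

/-- Sheaves of bornological algebras: the restriction maps are bounded homomorphisms, compatible
local sections glue uniquely, and a set of sections over a union is bounded as soon as its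
restrictions to the members of the cover are bounded. -/
structure IsBornAlgSheaf {X : Type*} [TopologicalSpace X] {A : Opens X → Type*}
    [∀ U, AddCommGroup (A U)] [∀ U, Module 𝕜 (A U)] (B : ∀ U, BornAlg 𝕜 (A U))
    (res : ∀ U V : Opens X, V ≤ U → A U →ₗ[𝕜] A V) : Prop where
  res_self : ∀ U f, res U U le_rfl f = f
  res_res : ∀ U V W (hV : V ≤ U) (hW : W ≤ V) f,
    res V W hW (res U V hV f) = res U W (hW.trans hV) f
  res_hom : ∀ U V hV, IsBddAlgHom (B U) (B V) (res U V hV)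
  glue : ∀ (c : Set (Opens X)) (f : ∀ U : c, A U),
    (∀ U V : c, res U (U ⊓ V) inf_le_left (f U) = res V (U ⊓ V) inf_le_right (f V)) →
    ∃! F : A (sSup c), ∀ U : c, res (sSup c) U (le_sSup U.2) F = f U
  bdd_of_cover : ∀ (c : Set (Opens X)) (S : Set (A (sSup c))),
    (∀ U : c, (B U).born.Bdd (res (sSup c) U (le_sSup U.2) '' S)) → (B (sSup c)).born.Bdd S

end Bornological

/-! ### Smooth functions and differential operators on manifolds -/

section Manifold

variable {𝕜 : Type*} [RCLike 𝕜]
  (E : Type*) [NormedAddCommGroup E] [NormedSpace ℝ E]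
  {M : Type*} [TopologicalSpace M] [ChartedSpace E M]

/-- `f` is smooth on a neighbourhood of `x`, i.e. represents a germ of smooth functions at `x`. -/
def SmoothNear (f : M → 𝕜) (x : M) : Prop :=
  ∃ W ∈ 𝓝 x, ContMDiffOn 𝓘(ℝ, E) 𝓘(ℝ, 𝕜) ∞ f W

/-- Linear differential operators on a manifold: the algebra of operators generated by the smooth
functions and the smooth vector fields. (They act on all functions, but only their values on smooth
functions matter.) -/
inductive IsDiffOp [IsManifold 𝓘(ℝ, E) ∞ M] : ((M → 𝕜) → M → 𝕜) → Prop
  | mul (h : M → 𝕜) (hh : ContMDiff 𝓘(ℝ, E) 𝓘(ℝ, 𝕜) ∞ h) : IsDiffOp fun f x => h x * f x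
  | deriv (X : ∀ x : M, TangentSpace 𝓘(ℝ, E) x)
      (hX : ContMDiff 𝓘(ℝ, E) 𝓘(ℝ, E).tangent ∞
        fun x => (⟨x, X x⟩ : TangentBundle 𝓘(ℝ, E) M)) :
      IsDiffOp fun f x => (mfderiv 𝓘(ℝ, E) 𝓘(ℝ, 𝕜) f x (X x) : 𝕜)
  | add (D D' : (M → 𝕜) → M → 𝕜) : IsDiffOp D → IsDiffOp D' → IsDiffOp fun f x => D f x + D' f x
  | comp (D D' : (M → 𝕜) → M → 𝕜) : IsDiffOp D → IsDiffOp D' → IsDiffOp fun f => D (D' f)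

/-- Bidifferential operators: locally finite sums of products of differential operators. -/
def IsBidiffOp [IsManifold 𝓘(ℝ, E) ∞ M] (C : (M → 𝕜) → (M → 𝕜) → M → 𝕜) : Prop :=
  ∀ x₀ : M, ∃ W ∈ 𝓝 x₀, ∃ (n : ℕ) (D D' : Fin n → (M → 𝕜) → M → 𝕜),
    (∀ i, IsDiffOp E (D i)) ∧ (∀ i, IsDiffOp E (D' i)) ∧
    ∀ x ∈ W, ∀ f h, SmoothNear E f x → SmoothNear E h x →
      C f h x = ∑ i, D i f x * D' i h x

variable (M)

/-- The representation `(φ⁻¹)^* η` of a 2-form `η` in the chart `φ` at `x₀`. -/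
def formInChart {M : Type*} [TopologicalSpace M] [ChartedSpace E M]
    (η : ∀ x : M, TangentSpace 𝓘(ℝ, E) x [⋀^Fin 2]→L[ℝ] ℝ) (x₀ : M) :
    E → E [⋀^Fin 2]→L[ℝ] ℝ := fun y =>
  (η ((extChartAt 𝓘(ℝ, E) x₀).symm y)).compContinuousLinearMap
    (mfderiv 𝓘(ℝ, E) 𝓘(ℝ, E) (extChartAt 𝓘(ℝ, E) x₀).symm y)

/-- A symplectic form: a smooth, closed, nondegenerate 2-form. -/
structure SymplecticForm where
  form : ∀ x : M, TangentSpace 𝓘(ℝ, E) x [⋀^Fin 2]→L[ℝ] ℝ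
  smooth : ∀ x₀, ContDiffOn ℝ ∞ (formInChart E form x₀) (extChartAt 𝓘(ℝ, E) x₀).target
  closed : ∀ x₀, ∀ y ∈ (extChartAt 𝓘(ℝ, E) x₀).target, extDeriv (formInChart E form x₀) y = 0
  nondegenerate : ∀ x v, (∀ v', form x ![v, v'] = 0) → v = 0

end Manifold

/-! ### Proper étale Lie groupoids -/

/-- A proper étale Lie groupoid with manifold of objects `G₀` and manifold of arrows `G₁`. The
product `mul g h` is meaningful only if `src g = tgt h`; an étale groupoid is one whose source and
target maps are local diffeomorphisms (in particular submersions). -/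
structure ProperEtaleLieGroupoid (E : Type*) [NormedAddCommGroup E] [NormedSpace ℝ E]
    (G₀ G₁ : Type*) [TopologicalSpace G₀] [ChartedSpace E G₀]
    [TopologicalSpace G₁] [ChartedSpace E G₁] where
  src : G₁ → G₀
  tgt : G₁ → G₀
  mul : G₁ → G₁ → G₁
  inv : G₁ → G₁
  one : G₀ → G₁
  src_mul : ∀ g h, src g = tgt h → src (mul g h) = src h
  tgt_mul : ∀ g h, src g = tgt h → tgt (mul g h) = tgt g
  mul_assoc : ∀ g h k, src g = tgt h → src h = tgt k → mul (mul g h) k = mul g (mul h k)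
  src_one : ∀ x, src (one x) = x
  tgt_one : ∀ x, tgt (one x) = x
  one_mul : ∀ g, mul (one (tgt g)) g = g
  mul_one : ∀ g, mul g (one (src g)) = g
  src_inv : ∀ g, src (inv g) = tgt g
  tgt_inv : ∀ g, tgt (inv g) = src g
  inv_mul : ∀ g, mul (inv g) g = one (src g)
  mul_inv : ∀ g, mul g (inv g) = one (tgt g)
  etale_src : IsLocalDiffeomorph 𝓘(ℝ, E) 𝓘(ℝ, E) ∞ src
  etale_tgt : IsLocalDiffeomorph 𝓘(ℝ, E) 𝓘(ℝ, E) ∞ tgt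
  smooth_mul : ContMDiffOn (𝓘(ℝ, E).prod 𝓘(ℝ, E)) 𝓘(ℝ, E) ∞
    (fun p : G₁ × G₁ => mul p.1 p.2) {p | src p.1 = tgt p.2}
  smooth_inv : ContMDiff 𝓘(ℝ, E) 𝓘(ℝ, E) ∞ inv
  smooth_one : ContMDiff 𝓘(ℝ, E) 𝓘(ℝ, E) ∞ one
  proper : IsProperMap fun g => (src g, tgt g)

namespace ProperEtaleLieGroupoid

variable {E : Type*} [NormedAddCommGroup E] [NormedSpace ℝ E]
  {G₀ G₁ : Type*} [TopologicalSpace G₀] [ChartedSpace E G₀]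
  [TopologicalSpace G₁] [ChartedSpace E G₁]
  (G : ProperEtaleLieGroupoid E G₀ G₁)

/-- Two objects are equivalent if there is an arrow between them. -/
def orbitSetoid : Setoid G₀ where
  r x y := ∃ g, G.src g = x ∧ G.tgt g = y
  iseqv :=
    { refl := fun x => ⟨G.one x, G.src_one x, G.tgt_one x⟩
      symm := by
        rintro _ _ ⟨g, rfl, rfl⟩
        exact ⟨G.inv g, G.src_inv g, G.tgt_inv g⟩
      trans := by
        rintro _ _ _ ⟨g, rfl, rfl⟩ ⟨h, hh, rfl⟩
        exact ⟨G.mul h g, G.src_mul h g hh, G.tgt_mul h g hh⟩ }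

/-- The orbit space `X`, with the quotient topology. -/
abbrev Orbit : Type _ := Quotient G.orbitSetoid

/-- The map from the space of arrows to the orbit space. -/
def proj (g : G₁) : G.Orbit := Quotient.mk G.orbitSetoid (G.src g)

/-- The set of arrows over a set of orbits. -/
def arrowsOver (U : Set G.Orbit) : Set G₁ := G.proj ⁻¹' U

/-- The factorizations `g = g₁ · g₂` of an arrow. -/
def Factor (g : G₁) : Type _ := {p : G₁ × G₁ // G.src p.1 = G.tgt p.2 ∧ G.mul p.1 p.2 = g}

/-- The germ `[a]_g` of a function on arrows, as a germ of functions on objects at `src g`: the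
composition of `a` with the local inverse of the source map that sends `src g` to `g`. -/
def germ {R : Type*} (a : G₁ → R) (g : G₁) : G₀ → R := a ∘ (G.etale_src g).localInverse

/-- The right action `[f] g` of an arrow `g` on germs: it takes germs at `tgt g` to germs
at `src g`. -/
def act {R : Type*} (f : G₀ → R) (g : G₁) : G₀ → R := G.germ (f ∘ G.tgt) g

/-! ### The convolution algebra and its sheaf version -/

section Undeformed

variable (𝕜 : Type*) [RCLike 𝕜]

/-- The convolution product of functions on the space of arrows. -/
def conv {𝕜 : Type*} [RCLike 𝕜] (a b : G₁ → 𝕜) (g : G₁) : 𝕜 :=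
  ∑ᶠ p : G.Factor g, a p.1.1 * b p.1.2

/-- The vector space of smooth functions with compact support on the space of arrows. -/
def convAlg (_G : ProperEtaleLieGroupoid E G₀ G₁) : Submodule 𝕜 (G₁ → 𝕜) where
  carrier := {a | ContMDiff 𝓘(ℝ, E) 𝓘(ℝ, 𝕜) ∞ a ∧ HasCompactSupport a}
  zero_mem' := ⟨contMDiff_const, HasCompactSupport.zero⟩
  add_mem' ha hb := ⟨ha.1.add hb.1, ha.2.add hb.2⟩
  smul_mem' c _ ha := ⟨(ContinuousLinearMap.mul ℝ 𝕜 c).contMDiff.comp ha.1, ha.2.smul_left (f := fun _ => c)⟩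

variable {𝕜} in
/-- Bounded sets of compactly supported smooth functions: there is a common compact support, and for
each differential operator there is a common bound. -/
def ConvBdd [IsManifold 𝓘(ℝ, E) ∞ G₁] (S : Set (G.convAlg 𝕜)) : Prop :=
  ∃ K, IsCompact K ∧ (∀ a ∈ S, tsupport a.1 ⊆ K) ∧
    ∀ D : (G₁ → 𝕜) → G₁ → 𝕜, IsDiffOp E D → ∃ r : ℝ, ∀ a ∈ S, ∀ g ∈ K, ‖D a.1 g‖ ≤ r

/-- A function on the arrows has fibrewise compact support over `U`. -/
def FibCompact {R : Type*} [Zero R] (U : Set G.Orbit) (a : G₁ → R) : Prop :=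
  ∀ K ⊆ U, IsCompact K → IsCompact (tsupport a ∩ G.arrowsOver K)

theorem FibCompact.zero {R : Type*} [Zero R] (U : Set G.Orbit) :
    G.FibCompact U (0 : G₁ → R) := by
  intro K _ _
  simp [tsupport]

theorem FibCompact.mono {R R' : Type*} [Zero R] [Zero R'] {U V : Set G.Orbit} {a : G₁ → R}
    {b : G₁ → R'} (ha : G.FibCompact U a) (hV : V ⊆ U) (hb : support b ⊆ support a) :
    G.FibCompact V b := by
  intro K hK hc
  have h : tsupport b ∩ G.arrowsOver K = tsupport a ∩ G.arrowsOver K ∩ tsupport b := by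
    have := closure_mono hb
    ext x
    exact ⟨fun hx => ⟨⟨this hx.1, hx.2⟩, hx.1⟩, fun hx => ⟨hx.2, hx.1.2⟩⟩
  rw [h]
  exact (ha K (hK.trans hV) hc).inter_right (isClosed_tsupport b)

theorem FibCompact.add {R : Type*} [AddMonoid R] {U : Set G.Orbit} {a b : G₁ → R}
    (ha : G.FibCompact U a) (hb : G.FibCompact U b) : G.FibCompact U (a + b) := by
  intro K hK hc
  have hs := tsupport_add a b
  have h : tsupport (a + b) ∩ G.arrowsOver K =
      (tsupport a ∩ G.arrowsOver K ∪ tsupport b ∩ G.arrowsOver K) ∩ tsupport (a + b) := by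
    ext x
    constructor
    · intro hx
      rcases hs hx.1 with h | h
      · exact ⟨Or.inl ⟨h, hx.2⟩, hx.1⟩
      · exact ⟨Or.inr ⟨h, hx.2⟩, hx.1⟩
    · rintro ⟨h | h, hx⟩
      · exact ⟨hx, h.2⟩
      · exact ⟨hx, h.2⟩
  rw [h]
  exact ((ha K hK hc).union (hb K hK hc)).inter_right (isClosed_tsupport _)

/-- The smooth functions with fibrewise compact support on the space of arrows over the open set `U`
of orbits. A function on the arrows over `U` is written as a function on all arrows that vanishes
outside of its domain. -/
def fcAlg (U : Opens G.Orbit) : Submodule 𝕜 (G₁ → 𝕜) where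
  carrier := {a | (∀ g ∉ G.arrowsOver U, a g = 0) ∧
    ContMDiffOn 𝓘(ℝ, E) 𝓘(ℝ, 𝕜) ∞ a (G.arrowsOver U) ∧ G.FibCompact U a}
  zero_mem' := ⟨fun _ _ => rfl, contMDiffOn_const, FibCompact.zero G U⟩
  add_mem' ha hb := ⟨fun g hg => by simp [ha.1 g hg, hb.1 g hg], ha.2.1.add hb.2.1,
    FibCompact.add G ha.2.2 hb.2.2⟩
  smul_mem' c a ha := ⟨fun g hg => by simp [ha.1 g hg], (ContinuousLinearMap.mul ℝ 𝕜 c).contMDiff.comp_contMDiffOn ha.2.1,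
    FibCompact.mono G ha.2.2 Subset.rfl (support_const_smul_subset c a)⟩

/-- Restriction of sections. -/
def fcRes (U V : Opens G.Orbit) (hV : V ≤ U) : G.fcAlg 𝕜 U →ₗ[𝕜] G.fcAlg 𝕜 V where
  toFun a := ⟨(G.arrowsOver V).indicator a.1, fun _ hg => indicator_of_notMem hg _,
    (a.2.2.1.mono (preimage_mono hV)).congr fun _ hg => indicator_of_mem hg _,
    FibCompact.mono G a.2.2.2 hV (by rw [support_indicator]; exact inter_subset_right)⟩
  map_add' a b := Subtype.ext (indicator_add _ a.1 b.1)
  map_smul' c a := Subtype.ext (indicator_const_smul _ c a.1)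

variable {𝕜} in
/-- Bounded sets of sections with fibrewise compact support: over each compact set of orbits the
supports lie in a common compact set, and each differential operator is bounded uniformly on each
compact set of arrows. -/
def FcBdd [IsManifold 𝓘(ℝ, E) ∞ G₁] (U : Opens G.Orbit) (S : Set (G.fcAlg 𝕜 U)) : Prop :=
  (∀ K ⊆ (U : Set G.Orbit), IsCompact K →
    ∃ L, IsCompact L ∧ ∀ a ∈ S, tsupport a.1 ∩ G.arrowsOver K ⊆ L) ∧
  ∀ D : (G₁ → 𝕜) → G₁ → 𝕜, IsDiffOp E D → ∀ L ⊆ G.arrowsOver U, IsCompact L →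
    ∃ r : ℝ, ∀ a ∈ S, ∀ g ∈ L, ‖D a.1 g‖ ≤ r

end Undeformed

/-! ### Invariant star products and the deformed convolution algebra -/

/-- Invariance of a 2-form: its pullbacks along source and target agree. -/
def InvariantForm (η : SymplecticForm E G₀) : Prop :=
  ∀ (g : G₁) (v v' : TangentSpace 𝓘(ℝ, E) g),
    η.form (G.src g) ![mfderiv 𝓘(ℝ, E) 𝓘(ℝ, E) G.src g v, mfderiv 𝓘(ℝ, E) 𝓘(ℝ, E) G.src g v'] =
    η.form (G.tgt g) ![mfderiv 𝓘(ℝ, E) 𝓘(ℝ, E) G.tgt g v, mfderiv 𝓘(ℝ, E) 𝓘(ℝ, E) G.tgt g v']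

section Deformed

variable (𝕜 : Type*) [RCLike 𝕜]

/-- The coefficient functions of a function with values in formal power series. -/
def coeffFun {𝕜 : Type*} [RCLike 𝕜] {M : Type*} (l : ℕ) (a : M → PowerSeries 𝕜) : M → 𝕜 :=
  fun x => PowerSeries.coeff l (a x)

theorem coeffFun_zero {𝕜 : Type*} [RCLike 𝕜] {M : Type*} (l : ℕ) :
    coeffFun l (0 : M → PowerSeries 𝕜) = fun _ => 0 :=
  funext fun _ => map_zero (PowerSeries.coeff (R := 𝕜) l)

theorem coeffFun_add {𝕜 : Type*} [RCLike 𝕜] {M : Type*} (l : ℕ) (a b : M → PowerSeries 𝕜) :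
    coeffFun l (a + b) = coeffFun l a + coeffFun l b :=
  funext fun x => map_add (PowerSeries.coeff (R := 𝕜) l) (a x) (b x)

theorem coeffFun_smul {𝕜 : Type*} [RCLike 𝕜] {M : Type*} (l : ℕ) (c : 𝕜)
    (a : M → PowerSeries 𝕜) : coeffFun l (c • a) = (fun _ => c) * coeffFun l a :=
  funext fun x => map_smul (PowerSeries.coeff (R := 𝕜) l) c (a x)

/-- The formal product `f ⋆ h = ∑ ħᵏ C k (f, h)`, extended to formal power series of functions. -/
def starOf {𝕜 : Type*} [RCLike 𝕜] {M : Type*} (C : ℕ → (M → 𝕜) → (M → 𝕜) → M → 𝕜)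
    (f h : M → PowerSeries 𝕜) : M → PowerSeries 𝕜 := fun x =>
  PowerSeries.mk fun n => ∑ q ∈ Finset.HasAntidiagonal.antidiagonal n, ∑ r ∈ Finset.HasAntidiagonal.antidiagonal q.2,
    C q.1 (coeffFun r.1 f) (coeffFun r.2 h) x

/-- An invariant local star product on the symplectic manifold of objects: an associative unital
product `f ⋆ h = ∑ ħᵏ C k (f, h)` on formal power series of smooth functions, given by
bidifferential operators `C k`, deforming the pointwise product in the direction of a nonzero
multiple of the Poisson bracket `{f, h} = η (X_f, X_h)` (where `η (X_f, ·) = df`), and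
compatible with the right action of the arrows on germs. The condition on the Poisson bracket is
stated for real functions; the operators are linear over `𝕜`. -/
structure InvariantStarProduct [IsManifold 𝓘(ℝ, E) ∞ G₀] (η : SymplecticForm E G₀) where
  C : ℕ → (G₀ → 𝕜) → (G₀ → 𝕜) → G₀ → 𝕜
  bidiff : ∀ k, IsBidiffOp E (C k)
  order_zero : ∀ x f h, SmoothNear E f x → SmoothNear E h x → C 0 f h x = f x * h x
  one_star : ∀ x (f : G₀ → PowerSeries 𝕜), (∀ l, ContMDiff 𝓘(ℝ, E) 𝓘(ℝ, 𝕜) ∞ (coeffFun l f)) →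
    starOf C (fun _ => 1) f x = f x
  star_one : ∀ x (f : G₀ → PowerSeries 𝕜), (∀ l, ContMDiff 𝓘(ℝ, E) 𝓘(ℝ, 𝕜) ∞ (coeffFun l f)) →
    starOf C f (fun _ => 1) x = f x
  assoc : ∀ x (f h e : G₀ → PowerSeries 𝕜), (∀ l, ContMDiff 𝓘(ℝ, E) 𝓘(ℝ, 𝕜) ∞ (coeffFun l f)) →
    (∀ l, ContMDiff 𝓘(ℝ, E) 𝓘(ℝ, 𝕜) ∞ (coeffFun l h)) →
    (∀ l, ContMDiff 𝓘(ℝ, E) 𝓘(ℝ, 𝕜) ∞ (coeffFun l e)) →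
    starOf C (starOf C f h) e x = starOf C f (starOf C h e) x
  poisson : ∃ c : 𝕜, c ≠ 0 ∧ ∀ f h : G₀ → ℝ, ContMDiff 𝓘(ℝ, E) 𝓘(ℝ, ℝ) ∞ f →
    ContMDiff 𝓘(ℝ, E) 𝓘(ℝ, ℝ) ∞ h → ∀ (x : G₀) (X Y : TangentSpace 𝓘(ℝ, E) x),
    (∀ Z, η.form x ![X, Z] = mfderiv 𝓘(ℝ, E) 𝓘(ℝ, ℝ) f x Z) →
    (∀ Z, η.form x ![Y, Z] = mfderiv 𝓘(ℝ, E) 𝓘(ℝ, ℝ) h x Z) →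
    C 1 (fun y => (f y : 𝕜)) (fun y => (h y : 𝕜)) x -
      C 1 (fun y => (h y : 𝕜)) (fun y => (f y : 𝕜)) x = c * ((η.form x ![X, Y] : ℝ) : 𝕜)
  invariant : ∀ k g f h, SmoothNear E f (G.tgt g) → SmoothNear E h (G.tgt g) →
    C k (G.act f g) (G.act h g) (G.src g) = C k f h (G.tgt g)

variable {𝕜} in
/-- The deformed convolution product `[a ⋆ b]_g = ∑ ([a]_{g₁} g₂) ⋆ [b]_{g₂}` over all
factorizations `g = g₁ · g₂`, evaluated at `g`. -/
def defConv [IsManifold 𝓘(ℝ, E) ∞ G₀] {η : SymplecticForm E G₀}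
    (P : G.InvariantStarProduct 𝕜 η) (a b : G₁ → PowerSeries 𝕜) (g : G₁) : PowerSeries 𝕜 :=
  ∑ᶠ p : G.Factor g, starOf P.C (G.act (G.germ a p.1.1) p.1.2) (G.germ b p.1.2) (G.src g)

/-- Formal power series of smooth functions on the space of arrows, with compact support. -/
def defConvAlg (_G : ProperEtaleLieGroupoid E G₀ G₁) : Submodule 𝕜 (G₁ → PowerSeries 𝕜) where
  carrier := {a | (∀ l, ContMDiff 𝓘(ℝ, E) 𝓘(ℝ, 𝕜) ∞ (coeffFun l a)) ∧ HasCompactSupport a}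
  zero_mem' := ⟨fun l => by
    rw [coeffFun_zero]; exact contMDiff_const, HasCompactSupport.zero⟩
  add_mem' ha hb := ⟨fun l => by
    rw [coeffFun_add]; exact (ha.1 l).add (hb.1 l), ha.2.add hb.2⟩
  smul_mem' c a ha := ⟨fun l => by
    rw [coeffFun_smul]; exact (ContinuousLinearMap.mul ℝ 𝕜 c).contMDiff.comp (ha.1 l), ha.2.smul_left (f := fun _ => c)⟩

variable {𝕜} in
/-- The bounded sets of the deformed convolution algebra. -/
def DefConvBdd [IsManifold 𝓘(ℝ, E) ∞ G₁] (S : Set (G.defConvAlg 𝕜)) : Prop :=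
  ∃ K, IsCompact K ∧ (∀ a ∈ S, tsupport a.1 ⊆ K) ∧
    ∀ D : (G₁ → 𝕜) → G₁ → 𝕜, IsDiffOp E D → ∀ l : ℕ,
      ∃ r : ℝ, ∀ a ∈ S, ∀ g ∈ K, ‖D (coeffFun l a.1) g‖ ≤ r

/-- Formal power series of smooth functions on the space of arrows over `U`, with fibrewise compact
support, again extended by zero. -/
def defFcAlg (U : Opens G.Orbit) : Submodule 𝕜 (G₁ → PowerSeries 𝕜) where
  carrier := {a | (∀ g ∉ G.arrowsOver U, a g = 0) ∧
    (∀ l, ContMDiffOn 𝓘(ℝ, E) 𝓘(ℝ, 𝕜) ∞ (coeffFun l a) (G.arrowsOver U)) ∧ G.FibCompact U a}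
  zero_mem' := ⟨fun _ _ => rfl, fun l => by
    rw [coeffFun_zero]; exact contMDiffOn_const, FibCompact.zero G U⟩
  add_mem' ha hb := ⟨fun g hg => by simp [ha.1 g hg, hb.1 g hg], fun l => by
    rw [coeffFun_add]; exact (ha.2.1 l).add (hb.2.1 l), FibCompact.add G ha.2.2 hb.2.2⟩
  smul_mem' c a ha := ⟨fun g hg => by simp [ha.1 g hg], fun l => by
    rw [coeffFun_smul]; exact (ContinuousLinearMap.mul ℝ 𝕜 c).contMDiff.comp_contMDiffOn (ha.2.1 l),
    FibCompact.mono G ha.2.2 Subset.rfl (support_const_smul_subset c a)⟩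

/-- Restriction of sections. -/
def defFcRes (U V : Opens G.Orbit) (hV : V ≤ U) : G.defFcAlg 𝕜 U →ₗ[𝕜] G.defFcAlg 𝕜 V where
  toFun a := ⟨(G.arrowsOver V).indicator a.1, fun _ hg => indicator_of_notMem hg _,
    fun l => ((a.2.2.1 l).mono (preimage_mono hV)).congr fun _ hg =>
      congrArg (PowerSeries.coeff l) (indicator_of_mem hg _),
    FibCompact.mono G a.2.2.2 hV (by rw [support_indicator]; exact inter_subset_right)⟩
  map_add' a b := Subtype.ext (indicator_add _ a.1 b.1)
  map_smul' c a := Subtype.ext (indicator_const_smul _ c a.1)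

variable {𝕜} in
/-- The bounded sets of sections of the deformed sheaf. -/
def DefFcBdd [IsManifold 𝓘(ℝ, E) ∞ G₁] (U : Opens G.Orbit) (S : Set (G.defFcAlg 𝕜 U)) : Prop :=
  (∀ K ⊆ (U : Set G.Orbit), IsCompact K →
    ∃ L, IsCompact L ∧ ∀ a ∈ S, tsupport a.1 ∩ G.arrowsOver K ⊆ L) ∧
  ∀ D : (G₁ → 𝕜) → G₁ → 𝕜, IsDiffOp E D → ∀ l : ℕ, ∀ L ⊆ G.arrowsOver U, IsCompact L →
    ∃ r : ℝ, ∀ a ∈ S, ∀ g ∈ L, ‖D (coeffFun l a.1) g‖ ≤ r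

end Deformed

end ProperEtaleLieGroupoid

end

noncomputable section

/-! ### Disks and polar hulls -/

section Disks

variable {𝕜 : Type*} [RCLike 𝕜] {V : Type*} [AddCommGroup V] [Module 𝕜 V]

/-! All the algebras in the theorem have one shape. Their elements are formal power series of smooth
functions on the arrows over an open set `U` of orbits, with supports that are compact, or compact
over compact subsets of `U`. Their product is the convolution defined by an invariant local star
product. The undeformed algebras belong to the star product with `C 0` pointwise multiplication and
`C k = 0` for `k ≠ 0`, restricted to series of degree `0`. Everything is therefore proved once, for
an abstract `IsSectionSpace` with a degree set `Q` and a flag `c` that selects the kind of support.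

Product. The source map is étale, so a germ at an arrow is a germ on the objects. Since a fibrewise
compact set meets each source fibre in finitely many arrows, the convolution is locally a finite sum
of star products of such germs, over one fixed finite set of arrows (`eventually_starConv`).
Smoothness, bilinearity and bounds follow; associativity follows from associativity on germs
together with invariance (`starConv_assoc`). Properness of `(s, t)` enters through the Hausdorff
property of the orbit space (`t2Space_orbit`).

Completeness. A bounded set is enlarged to its bipolar with respect to the functionals "value at an
arrow of a derivative of a coefficient". A sequence with uniform bounds on all derivatives is a
smooth function with values in the Banach space of bounded sequences (`unifSmoothNear_of_bounds`).
Composing with the ultralimit functional shows that its ultralimit is smooth and that differential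
operators commute with the limit. Hence these bipolars are completant
(`isCompletant_polarHull_functionals`).

Quasi-unitality. The units are open and closed in the space of arrows, so functions on the objects
extend by zero; those equal to `1` near the sources and targets of a support act on it as a
two-sided unit. Thus the approximate identity can be a constant sequence. For projectivity, take a
partition of unity `φ i` on the objects over `U` and cutoffs `ψ i` equal to `1` near the support of
`φ i`. A homomorphism `f` lifts to `a ↦ ∑ (a * φ i) • σ (f (ψ i))`. In the algebra the family `a * φ
i` is locally finite, so it stays bounded after multiplication by `2 ^ i`
(`secBdd_of_locallyFinite`); hence the sum converges geometrically in every complete module. The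
partition must be such that the `ψ i` needed for one bounded set form a bounded set
(`nonempty_unitPartition`).

Sheaf property. Smoothness, admissibility of supports and uniform smoothness of sequences are all
local over the orbit space. -/

theorem IsDisk.smul_mem {T : Set V} (h : IsDisk 𝕜 T) {c : 𝕜} (hc : ‖c‖ ≤ 1) {v : V} (hv : v ∈ T) :
    c • v ∈ T := by
  simpa using h.add_mem v hv 0 h.zero_mem c 0 (by simpa)

theorem IsDisk.balanced {T : Set V} (h : IsDisk 𝕜 T) : Balanced 𝕜 T := by
  rintro c hc _ ⟨v, hv, rfl⟩
  exact h.smul_mem hc hv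

/-- Convexity in the form `aT + bT ⊆ (a + b)T`, the triangle inequality of the gauge. Gauge
estimates below are made with dilates of the disk, which avoids arithmetic with infinite values. -/
theorem IsDisk.smul_add_smul_mem {T : Set V} (h : IsDisk 𝕜 T) {a b : ℝ} (ha : 0 ≤ a) (hb : 0 ≤ b)
    {x y : V} (hx : x ∈ (a : 𝕜) • T) (hy : y ∈ (b : 𝕜) • T) : x + y ∈ ((a + b : ℝ) : 𝕜) • T := by
  obtain ⟨v, hv, rfl⟩ := hx
  obtain ⟨v', hv', rfl⟩ := hy
  rcases (add_nonneg ha hb).eq_or_lt with h0 | h0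
  · have ha0 : a = 0 := by linarith
    have hb0 : b = 0 := by linarith
    exact ⟨0, h.zero_mem, by simp [ha0, hb0]⟩
  · refine ⟨((a / (a + b) : ℝ) : 𝕜) • v + ((b / (a + b) : ℝ) : 𝕜) • v',
      h.add_mem v hv v' hv' _ _ ?_, ?_⟩
    · rw [RCLike.norm_ofReal, RCLike.norm_ofReal, abs_of_nonneg (by positivity),
        abs_of_nonneg (by positivity), ← add_div, div_self h0.ne']
    · simp only [smul_add, smul_smul, ← RCLike.ofReal_mul]
      rw [mul_div_cancel₀ _ h0.ne', mul_div_cancel₀ _ h0.ne']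

theorem IsDisk.smul_mono {T : Set V} (h : IsDisk 𝕜 T) {a b : 𝕜} (hab : ‖a‖ ≤ ‖b‖) :
    a • T ⊆ b • T :=
  h.balanced.smul_mono hab

theorem IsDisk.mem_smul_of_egauge_lt {T : Set V} (h : IsDisk 𝕜 T) {r : ℝ} (hr : 0 < r) {v : V}
    (hv : egauge 𝕜 T v < ENNReal.ofReal r) : v ∈ (r : 𝕜) • T := by
  refine _root_.mem_smul_of_egauge_lt h.balanced ?_
  rwa [← ofReal_norm, RCLike.norm_ofReal, abs_of_pos hr]

theorem egauge_le_ofReal {T : Set V} {r : ℝ} (hr : 0 ≤ r) {v : V} (hv : v ∈ (r : 𝕜) • T) :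
    egauge 𝕜 T v ≤ ENNReal.ofReal r := by
  refine (egauge_le_of_mem_smul hv).trans ?_
  rw [← ofReal_norm, RCLike.norm_ofReal, abs_of_nonneg hr]

theorem IsDisk.exists_mem_smul_of_mem_span {T : Set V} (h : IsDisk 𝕜 T) {v : V}
    (hv : v ∈ Submodule.span 𝕜 T) : ∃ r : ℝ, 0 < r ∧ v ∈ (r : 𝕜) • T := by
  induction hv using Submodule.span_induction with
  | mem x hx => exact ⟨1, one_pos, by simpa using hx⟩
  | zero => exact ⟨1, one_pos, by simpa using h.zero_mem⟩
  | add x y _ _ hx hy =>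
    obtain ⟨a, ha, hx⟩ := hx
    obtain ⟨b, hb, hy⟩ := hy
    exact ⟨a + b, by positivity, h.smul_add_smul_mem ha.le hb.le hx hy⟩
  | smul c x _ hx =>
    obtain ⟨a, ha, v, hv, rfl⟩ := hx
    refine ⟨(‖c‖ + 1) * a, by positivity, ?_⟩
    refine h.smul_mono (a := c * (a : 𝕜)) ?_ ⟨v, hv, by simp [mul_smul]⟩
    rw [norm_mul, RCLike.norm_ofReal, RCLike.norm_ofReal, abs_of_pos ha,
      abs_of_pos (by positivity)]
    gcongr
    linarith

theorem smul_subset_span {T : Set V} (c : 𝕜) : c • T ⊆ Submodule.span 𝕜 T := by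
  rintro _ ⟨v, hv, rfl⟩
  exact Submodule.smul_mem _ _ (Submodule.subset_span hv)

/-- The absolute bipolar of a set with respect to a set of linear functionals. -/
def polarHull (Λ : Set (V →ₗ[𝕜] 𝕜)) (S : Set V) : Set V :=
  {v | ∀ l ∈ Λ, ∀ r : ℝ, 0 ≤ r → (∀ b ∈ S, ‖l b‖ ≤ r) → ‖l v‖ ≤ r}

theorem subset_polarHull (Λ : Set (V →ₗ[𝕜] 𝕜)) (S : Set V) : S ⊆ polarHull Λ S :=
  fun v hv _ _ _ _ h => h v hv

/-- Condition (3) for approximate identities compares the disks of nested bounded sets; a canonical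
hull makes the choice of these disks monotone. -/
theorem polarHull_mono (Λ : Set (V →ₗ[𝕜] 𝕜)) {S S' : Set V} (h : S ⊆ S') :
    polarHull Λ S ⊆ polarHull Λ S' :=
  fun _ hv l hl r hr hb => hv l hl r hr fun b hbS => hb b (h hbS)

theorem isDisk_polarHull (Λ : Set (V →ₗ[𝕜] 𝕜)) (S : Set V) : IsDisk 𝕜 (polarHull Λ S) where
  zero_mem _ _ _ hr _ := by simpa using hr
  add_mem v₁ h₁ v₂ h₂ c₁ c₂ hc l hl r hr hb := by
    have e₁ := h₁ l hl r hr hb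
    have e₂ := h₂ l hl r hr hb
    calc ‖l (c₁ • v₁ + c₂ • v₂)‖ = ‖c₁ * l v₁ + c₂ * l v₂‖ := by simp
      _ ≤ ‖c₁‖ * ‖l v₁‖ + ‖c₂‖ * ‖l v₂‖ := by
        refine (norm_add_le _ _).trans ?_
        rw [norm_mul, norm_mul]
      _ ≤ ‖c₁‖ * r + ‖c₂‖ * r := by gcongr
      _ = (‖c₁‖ + ‖c₂‖) * r := by ring
      _ ≤ 1 * r := by gcongr
      _ = r := one_mul r

theorem norm_le_of_mem_smul_polarHull {Λ : Set (V →ₗ[𝕜] 𝕜)} {S : Set V} {δ : ℝ} (hδ : 0 ≤ δ)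
    {v : V} (hv : v ∈ (δ : 𝕜) • polarHull Λ S) {l : V →ₗ[𝕜] 𝕜} (hl : l ∈ Λ) {r : ℝ} (hr : 0 ≤ r)
    (hb : ∀ b ∈ S, ‖l b‖ ≤ r) : ‖l v‖ ≤ δ * r := by
  obtain ⟨w, hw, rfl⟩ := hv
  have := hw l hl r hr hb
  simp only [map_smul, smul_eq_mul, norm_mul, RCLike.norm_ofReal, abs_of_nonneg hδ]
  gcongr

/-- With `norm_le_of_mem_smul_polarHull`, this turns membership in a dilate of the hull into closed
inequalities between values of functionals, which survive weak limits. -/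
theorem mem_smul_polarHull {Λ : Set (V →ₗ[𝕜] 𝕜)} {S : Set V} {δ : ℝ} (hδ : 0 < δ) {v : V}
    (h : ∀ l ∈ Λ, ∀ r : ℝ, 0 ≤ r → (∀ b ∈ S, ‖l b‖ ≤ r) → ‖l v‖ ≤ δ * r) :
    v ∈ (δ : 𝕜) • polarHull Λ S := by
  have hδ' : (δ : 𝕜) ≠ 0 := by simpa using hδ.ne'
  rw [mem_smul_set_iff_inv_smul_mem₀ hδ']
  intro l hl r hr hb
  have := h l hl r hr hb
  simp only [map_smul, smul_eq_mul, norm_mul, norm_inv, RCLike.norm_ofReal, abs_of_pos hδ]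
  rwa [inv_mul_le_iff₀ hδ]

/-- A gauge-Cauchy sequence is gauge-bounded, so by `lim` it has a weak limit along an ultrafilter.
The Cauchy inequalities, tested on a functional, pass to that limit in one of the two indices and
give convergence in gauge. Only a weak ultralimit has to be produced, with no convergent
subsequence. -/
theorem isCompletant_polarHull {Λ : Set (V →ₗ[𝕜] 𝕜)} {S : Set V}
    (hS : ∀ l ∈ Λ, ∃ r, ∀ b ∈ S, ‖l b‖ ≤ r) (sep : ∀ v, (∀ l ∈ Λ, l v = 0) → v = 0)
    (lim : ∀ x : ℕ → V, (∃ c : ℝ, 0 < c ∧ ∀ n, x n ∈ (c : 𝕜) • polarHull Λ S) →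
      ∃ y, ∀ l ∈ Λ, Tendsto (fun n => l (x n)) (hyperfilter ℕ : Filter ℕ) (𝓝 (l y))) :
    IsCompletant 𝕜 (polarHull Λ S) where
  isDisk := isDisk_polarHull Λ S
  norming v hv := by
    refine sep v fun l hl => ?_
    obtain ⟨r, hr⟩ := hS l hl
    have hr' : ∀ b ∈ S, ‖l b‖ ≤ max r 0 := fun b hb => (hr b hb).trans (le_max_left _ _)
    refine norm_le_zero_iff.1 (le_of_forall_pos_le_add fun ε hε => ?_)
    have hε' : 0 < ε / (max r 0 + 1) := by positivity
    have := norm_le_of_mem_smul_polarHull hε'.le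
      ((isDisk_polarHull Λ S).mem_smul_of_egauge_lt hε' (by rw [hv]; simpa using hε')) hl
      (le_max_right r 0) hr'
    refine this.trans ?_
    rw [zero_add, div_mul_eq_mul_div, div_le_iff₀ (by positivity)]
    nlinarith [le_max_right r 0]
  complete x hx hcauchy := by
    have hd := isDisk_polarHull Λ S
    have hc : ∀ ε : ℝ, 0 < ε → ∃ N, ∀ n ≥ N, ∀ m ≥ N, x n - x m ∈ (ε : 𝕜) • polarHull Λ S := by
      intro ε hε
      have h1 := hcauchy.eventually (gt_mem_nhds (ENNReal.ofReal_pos.2 hε))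
      obtain ⟨⟨N, N'⟩, hN⟩ := eventually_atTop.1 h1
      refine ⟨max N N', fun n hn m hm => hd.mem_smul_of_egauge_lt hε ?_⟩
      exact hN (n, m) ⟨(le_max_left _ _).trans hn, (le_max_right _ _).trans hm⟩
    choose c hc0 hxc using fun n => hd.exists_mem_smul_of_mem_span (hx n)
    obtain ⟨N, hN⟩ := hc 1 one_pos
    -- One dilate contains the whole sequence: the sum of the `c i` controls the terms up to `N`,
    -- and the extra `1` the later ones, which differ from `x N` by an element of the hull.
    have hbd : ∃ d : ℝ, 0 < d ∧ ∀ n, x n ∈ (d : 𝕜) • polarHull Λ S := by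
      have hsum : ∀ n ∈ Finset.range (N + 1), c n ≤ ∑ i ∈ Finset.range (N + 1), c i := fun n hn =>
        Finset.single_le_sum (fun i _ => (hc0 i).le) hn
      have hpos : 0 ≤ ∑ i ∈ Finset.range (N + 1), c i := Finset.sum_nonneg fun i _ => (hc0 i).le
      have hle : ∀ a : ℝ, 0 ≤ a → a ≤ ∑ i ∈ Finset.range (N + 1), c i + 1 →
          ((a : 𝕜) • polarHull Λ S ⊆
            ((∑ i ∈ Finset.range (N + 1), c i + 1 : ℝ) : 𝕜) • polarHull Λ S) := by
        intro a ha hab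
        apply hd.smul_mono
        rw [RCLike.norm_ofReal, RCLike.norm_ofReal, abs_of_nonneg ha, abs_of_nonneg (by linarith)]
        exact hab
      refine ⟨∑ i ∈ Finset.range (N + 1), c i + 1, by linarith, fun n => ?_⟩
      rcases le_total n N with h | h
      · exact hle (c n) (hc0 n).le (by linarith [hsum n (by simp; omega)]) (hxc n)
      · have := hd.smul_add_smul_mem (hc0 N).le zero_le_one (hxc N) (hN n h N le_rfl)
        rw [add_sub_cancel] at this
        exact hle _ (by linarith [hc0 N]) (by linarith [hsum N (by simp)]) this
    obtain ⟨y, hy⟩ := lim x hbd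
    have key : ∀ ε : ℝ, 0 < ε → ∃ N, ∀ n ≥ N, x n - y ∈ (ε : 𝕜) • polarHull Λ S := by
      intro ε hε
      obtain ⟨N, hN⟩ := hc ε hε
      refine ⟨N, fun n hn => mem_smul_polarHull hε fun l hl r hr hb => ?_⟩
      have h1 : Tendsto (fun m => ‖l (x n) - l (x m)‖) (hyperfilter ℕ : Filter ℕ)
          (𝓝 ‖l (x n) - l y‖) := (tendsto_const_nhds.sub (hy l hl)).norm
      rw [map_sub]
      refine le_of_tendsto h1 (Nat.hyperfilter_le_atTop ?_)
      filter_upwards [eventually_ge_atTop N] with m hm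
      rw [← map_sub]
      exact norm_le_of_mem_smul_polarHull hε.le (hN n hn m hm) hl hr hb
    refine ⟨y, ?_, ?_⟩
    · obtain ⟨N, hN⟩ := key 1 one_pos
      rw [← sub_sub_cancel (x N) y]
      exact Submodule.sub_mem _ (hx N) (smul_subset_span _ (hN N le_rfl))
    · rw [ENNReal.tendsto_atTop_zero]
      intro ε hε
      rcases eq_or_ne ε ∞ with rfl | hε'
      · exact ⟨0, fun _ _ => le_top⟩
      · obtain ⟨N, hN⟩ := key ε.toReal (ENNReal.toReal_pos hε.ne' hε')
        refine ⟨N, fun n hn => (egauge_le_ofReal ENNReal.toReal_nonneg (hN n hn)).trans ?_⟩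
        rw [ENNReal.ofReal_toReal hε']

end Disks

/-! ### Convex bornologies -/

namespace ConvexBornology

variable {𝕜 : Type*} [RCLike 𝕜] {V : Type*} [AddCommGroup V] [Module 𝕜 V]

/-- A convex bornology given by its bounded sets, which are stable under polar hulls. -/
def ofPolar (Bd : Set V → Prop) (Λ : Set (V →ₗ[𝕜] 𝕜))
    (subset : ∀ S, Bd S → ∀ S' ⊆ S, Bd S') (union : ∀ S, Bd S → ∀ S', Bd S' → Bd (S ∪ S'))
    (singleton : ∀ v, Bd {v}) (smul : ∀ (c : 𝕜) S, Bd S → Bd (c • S))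
    (polar : ∀ S, Bd S → Bd (polarHull Λ S)) : ConvexBornology 𝕜 V where
  toBornology := Bornology.ofBounded {S | Bd S} (subset _ (singleton 0) _ (empty_subset _))
    subset union singleton
  bdd_smul c S hS := by
    rw [Bornology.isBounded_ofBounded_iff] at hS ⊢
    exact smul c S hS
  bdd_diskHull S hS := by
    rw [Bornology.isBounded_ofBounded_iff] at hS ⊢
    exact subset _ (polar S hS) _ (sInter_subset_of_mem
      ⟨subset_polarHull Λ S, isDisk_polarHull Λ S⟩)

theorem bdd_ofPolar {Bd : Set V → Prop} {Λ : Set (V →ₗ[𝕜] 𝕜)} {h₁ h₂ h₃ h₄ h₅} {S : Set V} :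
    (ofPolar Bd Λ h₁ h₂ h₃ h₄ h₅).Bdd S ↔ Bd S :=
  @Bornology.isBounded_ofBounded_iff V S {S | Bd S} _ h₁ h₂ h₃

variable {B : ConvexBornology 𝕜 V}

theorem Bdd.mono {S S' : Set V} (h : B.Bdd S) (hS : S' ⊆ S) : B.Bdd S' :=
  @Bornology.IsBounded.subset V B.toBornology _ _ h hS

theorem Bdd.union {S S' : Set V} (h : B.Bdd S) (h' : B.Bdd S') : B.Bdd (S ∪ S') :=
  @Bornology.IsBounded.union V B.toBornology _ _ h h'

theorem Bdd.smul {S : Set V} (h : B.Bdd S) (c : 𝕜) : B.Bdd (c • S) := B.bdd_smul c S h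

variable (B) in
theorem bdd_singleton (v : V) : B.Bdd {v} := @Bornology.isBounded_singleton V B.toBornology v

/-- A sum `a + b` is twice the midpoint of `a` and `b`, so it lies in twice the disk hull of the
union. -/
theorem Bdd.add {S S' : Set V} (h : B.Bdd S) (h' : B.Bdd S') : B.Bdd (S + S') := by
  have hd : B.Bdd _ := B.bdd_diskHull _ (h.union h')
  refine (hd.smul (2 : 𝕜)).mono ?_
  rintro _ ⟨a, ha, b, hb, rfl⟩
  refine ⟨(2⁻¹ : 𝕜) • a + (2⁻¹ : 𝕜) • b, ?_, ?_⟩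
  · rintro T ⟨hT, hd⟩
    refine hd.add_mem a (hT (.inl ha)) b (hT (.inr hb)) _ _ ?_
    rw [norm_inv, RCLike.norm_ofNat]
    norm_num
  · simp [smul_smul]

theorem two_inv_pow_mul (n : ℕ) : (((2⁻¹ : ℝ) ^ n : ℝ) : 𝕜) * (2 : 𝕜) ^ n = 1 := by
  push_cast
  rw [← mul_pow]
  simp

/-- Convergence faster than a geometric series in a bornological vector space. -/
def FastConv (B : ConvexBornology 𝕜 V) (x : ℕ → V) (y : V) : Prop :=
  B.Bdd (range fun n => (2 : 𝕜) ^ n • (x n - y))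

theorem FastConv.add {x x' : ℕ → V} {y y' : V} (h : B.FastConv x y) (h' : B.FastConv x' y') :
    B.FastConv (fun n => x n + x' n) (y + y') := by
  refine (Bdd.add h h').mono ?_
  rintro _ ⟨n, rfl⟩
  exact ⟨_, ⟨n, rfl⟩, _, ⟨n, rfl⟩, by simp only [← smul_add]; congr 1; abel⟩

theorem FastConv.map {W : Type*} [AddCommGroup W] [Module 𝕜 W] {D : ConvexBornology 𝕜 W}
    {f : V →ₗ[𝕜] W} (hf : IsBddMap B D f) {x : ℕ → V} {y : V} (h : B.FastConv x y) :
    D.FastConv (fun n => f (x n)) (f y) := by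
  refine (hf _ h).mono ?_
  rintro _ ⟨n, rfl⟩
  exact ⟨_, ⟨n, rfl⟩, by simp⟩

theorem isBddMap_smul (c : 𝕜) : IsBddMap B B (c • LinearMap.id) := fun S hS => by
  refine (hS.smul c).mono ?_
  rintro _ ⟨v, hv, rfl⟩
  exact ⟨v, hv, rfl⟩

/-- The zero sequence then converges fast to `y - y'`, so up to sign all `2 ^ n • (y - y')` lie in
one completant disk. The gauge of `y - y'` is at most `2⁻ⁿ` for all `n`, hence zero. -/
theorem FastConv.unique (hB : B.IsComplete) {x : ℕ → V} {y y' : V} (h : B.FastConv x y)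
    (h' : B.FastConv x y') : y = y' := by
  have h1 : B.FastConv (fun _ => 0) (y - y') := by
    have := h.add (h'.map (isBddMap_smul (-1)))
    simpa [sub_eq_add_neg] using this
  obtain ⟨T, hT, -, hc⟩ := hB _ h1
  refine sub_eq_zero.1 (hc.norming _ ?_)
  refine le_antisymm (ENNReal.le_of_forall_pos_le_add fun ε hε _ => ?_) bot_le
  obtain ⟨n, hn⟩ := exists_pow_lt_of_lt_one (NNReal.coe_pos.2 hε) (show (2⁻¹ : ℝ) < 1 by norm_num)
  have h2 : y - y' ∈ (((2⁻¹ : ℝ) ^ n : ℝ) : 𝕜) • T := by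
    have h3 := hc.isDisk.smul_mem (c := (-1 : 𝕜)) (by simp) (hT ⟨n, rfl⟩)
    refine ⟨_, h3, ?_⟩
    simp only [zero_sub, smul_neg, smul_smul, neg_mul, one_mul, neg_smul, neg_neg]
    rw [two_inv_pow_mul, one_smul]
  refine (egauge_le_ofReal (by positivity) h2).trans ?_
  rw [zero_add, ← ENNReal.ofReal_coe_nnreal]
  exact ENNReal.ofReal_le_ofReal hn.le

/-- Each `m i` lies in `2⁻ⁱ T`; the dilation factor is the exact value of the geometric sum from `n`
to `n + k - 1`. -/
theorem sum_Ico_mem {T : Set V} (hT : IsDisk 𝕜 T) {m : ℕ → V}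
    (hm : ∀ i, (2 : 𝕜) ^ i • m i ∈ T) (n k : ℕ) :
    ∑ i ∈ Finset.Ico n (n + k), m i ∈
      ((2 * (2⁻¹ : ℝ) ^ n - 2 * (2⁻¹ : ℝ) ^ (n + k) : ℝ) : 𝕜) • T := by
  induction k with
  | zero => exact ⟨0, hT.zero_mem, by simp⟩
  | succ k ih =>
    have h1 : m (n + k) ∈ (((2⁻¹ : ℝ) ^ (n + k) : ℝ) : 𝕜) • T :=
      ⟨_, hm (n + k), by simp only [smul_smul]; rw [two_inv_pow_mul, one_smul]⟩
    rw [← add_assoc, Finset.sum_Ico_succ_top (by omega)]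
    have h2 := hT.smul_add_smul_mem ?_ (by positivity) ih h1
    · convert h2 using 3
      ring
    · have : (2⁻¹ : ℝ) ^ (n + k) ≤ (2⁻¹ : ℝ) ^ n :=
        pow_le_pow_of_le_one (by norm_num) (by norm_num) (by omega)
      linarith

/-- The factor `3` is `2 + 1`: a tail of the series lies in `2 · 2⁻ⁿ T`, and some far partial sum is
within `2⁻ⁿ` of the limit. The factor is the same for every `m`, so the bound is uniform over
families of series. -/
theorem exists_sum {T : Set V} (hT : IsCompletant 𝕜 T) {m : ℕ → V}
    (hm : ∀ i, (2 : 𝕜) ^ i • m i ∈ T) :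
    ∃ y, ∀ n, (2 : 𝕜) ^ n • (∑ i ∈ Finset.range n, m i - y) ∈ (3 : 𝕜) • T := by
  set x : ℕ → V := fun n => ∑ i ∈ Finset.range n, m i with hx
  have hd := hT.isDisk
  have hmem : ∀ n k, x (n + k) - x n ∈ ((2 * (2⁻¹ : ℝ) ^ n : ℝ) : 𝕜) • T := by
    intro n k
    have h1 := sum_Ico_mem hd hm n k
    rw [Finset.sum_Ico_eq_sub _ (by omega)] at h1
    refine hd.smul_mono ?_ h1
    have : (2⁻¹ : ℝ) ^ (n + k) ≤ (2⁻¹ : ℝ) ^ n :=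
      pow_le_pow_of_le_one (by norm_num) (by norm_num) (by omega)
    have h0 : (0 : ℝ) < (2⁻¹ : ℝ) ^ (n + k) := by positivity
    rw [RCLike.norm_ofReal, RCLike.norm_ofReal, abs_of_nonneg (by linarith),
      abs_of_nonneg (by positivity)]
    linarith
  have hneg : ∀ {v : V} {c : 𝕜}, v ∈ c • T → -v ∈ c • T := by
    rintro _ c ⟨v, hv, rfl⟩
    exact ⟨-v, by simpa using hd.smul_mem (c := (-1 : 𝕜)) (by simp) hv, by simp⟩
  have hcauchy : Tendsto (fun p : ℕ × ℕ => egauge 𝕜 T (x p.1 - x p.2)) atTop (𝓝 0) := by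
    have hlim : Tendsto (fun p : ℕ × ℕ => ENNReal.ofReal (2 * (2⁻¹ : ℝ) ^ (min p.1 p.2))) atTop
        (𝓝 0) := by
      have h1 : Tendsto (fun n : ℕ => ENNReal.ofReal (2 * (2⁻¹ : ℝ) ^ n)) atTop (𝓝 0) := by
        have := (tendsto_pow_atTop_nhds_zero_of_lt_one (r := (2⁻¹ : ℝ)) (by norm_num)
          (by norm_num)).const_mul 2
        simpa using ENNReal.tendsto_ofReal this
      refine h1.comp (tendsto_atTop.2 fun N => ?_)
      filter_upwards [eventually_ge_atTop (N, N)] with p hp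
      exact le_min hp.1 hp.2
    refine tendsto_of_tendsto_of_tendsto_of_le_of_le tendsto_const_nhds hlim
      (fun _ => bot_le) fun p => egauge_le_ofReal (by positivity) ?_
    rcases le_total p.1 p.2 with h | h
    · obtain ⟨k, hk⟩ := Nat.exists_eq_add_of_le h
      rw [min_eq_left h, ← neg_sub, hk]
      exact hneg (hmem _ k)
    · obtain ⟨k, hk⟩ := Nat.exists_eq_add_of_le h
      rw [min_eq_right h, hk]
      exact hmem _ k
  have hspan : ∀ n, x n ∈ Submodule.span 𝕜 T := fun n => by
    simpa [hx] using smul_subset_span _ (hmem 0 n)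
  obtain ⟨y, -, hy⟩ := hT.complete x hspan hcauchy
  refine ⟨y, fun n => ?_⟩
  have hpos : (0 : ℝ) < (2⁻¹ : ℝ) ^ n := by positivity
  obtain ⟨k, hk⟩ := ((tendsto_add_atTop_iff_nat n).2 hy).eventually
    (gt_mem_nhds (ENNReal.ofReal_pos.2 hpos)) |>.exists
  rw [add_comm] at hk
  have h1 := hd.mem_smul_of_egauge_lt hpos hk
  obtain ⟨v, hv, hv'⟩ := hd.smul_add_smul_mem (by positivity) hpos.le (hneg (hmem n k)) h1
  refine ⟨v, hv, ?_⟩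
  rw [neg_sub, sub_add_sub_cancel] at hv'
  rw [show ∑ i ∈ Finset.range n, m i - y = x n - y from rfl, ← hv']
  simp only [smul_smul]
  congr 1
  push_cast
  have : (2 : 𝕜) ^ n * (2⁻¹) ^ n = 1 := by rw [← mul_pow]; simp
  linear_combination (-3 : 𝕜) * this

end ConvexBornology

/-! ### Criteria for approximate identities and projectivity -/

namespace BornAlg

variable {𝕜 : Type*} [RCLike 𝕜] {A : Type*} [AddCommGroup A] [Module 𝕜 A] (B : BornAlg 𝕜 A)

/-- If `u S` is a unit for the whole span of `T S`, the constant sequence works: every difference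
that has to be small is zero, and in (3) the left side vanishes because the span of `T S₁` lies in
that of `T S₂`. -/
theorem hasApproximateIdentity_of_local_units (T : Set A → Set A) (hT : Monotone T)
    (hsub : ∀ S, S ⊆ T S) (hbdd : ∀ S, B.born.Bdd S → B.born.Bdd (T S) ∧ IsCompletant 𝕜 (T S))
    (hunit : ∀ S, B.born.Bdd S → ∃ u, ∀ a ∈ S, B.mul u a = a ∧ B.mul a u = a) :
    B.HasApproximateIdentity := by
  have hu : ∀ S, ∃ u, B.born.Bdd S → ∀ a ∈ Submodule.span 𝕜 (T S),
      B.mul u a = a ∧ B.mul a u = a := by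
    intro S
    by_cases hS : B.born.Bdd S
    -- The unit is chosen for `T S`, not just for `S`, since (3) tests it on the span of a hull.
    · obtain ⟨u, hu⟩ := hunit (T S) (hbdd S hS).1
      refine ⟨u, fun _ a ha => ?_⟩
      induction ha using Submodule.span_induction with
      | mem x hx => exact hu x hx
      | zero => simp
      | add x y _ _ hx hy => simp [hx, hy]
      | smul c x _ hx => simp [hx]
    · exact ⟨0, fun h => absurd h hS⟩
  choose u hu using hu
  refine ⟨fun S _ => u S, T, fun S hS => ⟨?_, (hbdd S hS).1, (hbdd S hS).2, ?_, ?_⟩, ?_⟩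
  · rw [range_const]
    exact B.born.bdd_singleton _
  · intro a ha _
    have ha' := Submodule.span_mono (hsub S) ha
    rw [(hu S hS a ha').1, (hu S hS a ha').2]
    exact ⟨ha', ha'⟩
  · intro ε _
    refine ⟨0, fun _ _ a ha => ?_⟩
    have ha' := hu S hS a (Submodule.subset_span (hsub S ha))
    rw [ha'.1, ha'.2, sub_self, egauge_zero_right 𝕜 ⟨0, (hbdd S hS).2.isDisk.zero_mem⟩]
    exact ⟨bot_le, bot_le⟩
  · intro S₁ S₂ _ h₂ hS a ha _
    rw [(hu S₂ h₂ a (Submodule.span_mono (hT hS) ha)).1, sub_self,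
      egauge_zero_right 𝕜 ⟨0, (hbdd S₂ h₂).2.isDisk.zero_mem⟩]
    exact bot_le

/-- The lift is `F a = ∑ (a φᵢ) · σ (f ψᵢ)`. It is a module map because `a` occurs only on the far
left, and `p (F a) = ∑ f (a φᵢ ψᵢ) = ∑ f (a φᵢ) = f a`. The weights `2 ^ i` and `2 ^ n` force
geometric convergence, which makes sense in any complete bornological module; `I` lists the indices
that matter for `S`. -/
theorem isProjective_self_of_local_units (φ ψ : ℕ → A) (hφ : ∀ i, B.mul (φ i) (ψ i) = φ i)
    (h : ∀ S, B.born.Bdd S → ∃ I : Set ℕ, B.born.Bdd (ψ '' I) ∧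
      (∀ a ∈ S, ∀ i ∉ I, B.mul a (φ i) = 0) ∧
      B.born.Bdd (image2 (fun a i => (2 : 𝕜) ^ i • B.mul a (φ i)) S univ) ∧
      B.born.Bdd (image2 (fun a n => (2 : 𝕜) ^ n •
        (∑ i ∈ Finset.range n, B.mul a (φ i) - a)) S univ)) :
    BornModule.IsProjective.{w} B.self := by
  intro M N _ _ _ _ BM BN p σ hp hσ hpσ f hf
  have bdd_act : ∀ b, IsBddMap BM.born BM.born (BM.act b) := fun b S hS => by
    refine (BM.act_bdd {b} S (B.born.bdd_singleton b) hS).mono ?_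
    rw [image2_singleton_left]
  -- For `i ∉ I` the term is zero, so only the `ψ i` with `i ∈ I` have to be jointly bounded.
  have hconv : ∀ S, B.born.Bdd S → ∃ T, BM.born.Bdd T ∧ IsCompletant 𝕜 T ∧ ∀ a ∈ S, ∀ i,
      (2 : 𝕜) ^ i • BM.act (B.mul a (φ i)) (σ (f (ψ i))) ∈ T := by
    intro S hS
    obtain ⟨I, hI, h0, h1, -⟩ := h S hS
    have h2 := BM.act_bdd _ _ h1 (hσ _ (hf.1 _ hI))
    obtain ⟨T, hT, hT', hc⟩ := BM.complete _ h2
    refine ⟨T, hT', hc, fun a ha i => ?_⟩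
    by_cases hi : i ∈ I
    · exact hT ⟨_, ⟨a, ha, i, trivial, rfl⟩, _, ⟨_, ⟨_, ⟨i, hi, rfl⟩, rfl⟩, rfl⟩, by simp⟩
    · rw [h0 a ha i hi]
      simpa using hc.isDisk.zero_mem
  have hlim : ∀ a, ∃ y, BM.born.FastConv
      (fun n => ∑ i ∈ Finset.range n, BM.act (B.mul a (φ i)) (σ (f (ψ i)))) y := by
    intro a
    obtain ⟨T, hT, hc, hm⟩ := hconv {a} (B.born.bdd_singleton a)
    obtain ⟨y, hy⟩ := ConvexBornology.exists_sum hc (hm a rfl)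
    exact ⟨y, (hT.smul 3).mono (range_subset_iff.2 hy)⟩
  choose F hF using hlim
  -- Linearity, compatibility with the action and the lifting identity all follow by applying
  -- bounded maps to fast convergent sequences and using uniqueness of the limit.
  let F' : A →ₗ[𝕜] M :=
    { toFun := F
      map_add' := fun a b => by
        refine (hF (a + b)).unique BM.complete ?_
        have := (hF a).add (hF b)
        simpa [Finset.sum_add_distrib] using this
      map_smul' := fun c a => by
        refine (hF (c • a)).unique BM.complete ?_
        have := (hF a).map (ConvexBornology.isBddMap_smul c)
        simpa [Finset.smul_sum] using this }
  refine ⟨F', ⟨fun S hS => ?_, fun b a => ?_⟩, fun a => ?_⟩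
  · obtain ⟨T, hT, hc, hm⟩ := hconv S hS
    refine ((hT.smul 3).smul (-1)).mono ?_
    rintro _ ⟨a, ha, rfl⟩
    obtain ⟨y, hy⟩ := ConvexBornology.exists_sum hc (hm a ha)
    have hy' : F a = y :=
      (hF a).unique BM.complete ((hT.smul 3).mono (range_subset_iff.2 hy))
    refine ⟨-y, ?_, ?_⟩
    -- At `n = 0` the partial sum is empty, so the convergence estimate becomes a bound on the limit
    -- itself.
    · simpa using hy 0
    · change (-1 : 𝕜) • -y = F a
      simpa using hy'.symm
  · refine (hF (B.mul b a)).unique BM.complete ?_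
    have := (hF a).map (bdd_act b)
    change BM.born.FastConv _ (BM.act b (F a))
    simpa [BM.mul_act, B.mul_assoc] using this
  · have h1 := (hF a).map hp.1
    have h2 : BN.born.FastConv (fun n => f (∑ i ∈ Finset.range n, B.mul a (φ i))) (f a) := by
      obtain ⟨-, -, -, -, h3⟩ := h {a} (B.born.bdd_singleton a)
      refine ConvexBornology.FastConv.map hf.1 (h3.mono ?_)
      rintro _ ⟨n, rfl⟩
      exact ⟨a, rfl, n, trivial, rfl⟩
    refine h1.unique BN.complete ?_
    convert h2 using 2 with n
    rw [map_sum, map_sum]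
    refine Finset.sum_congr rfl fun i _ => ?_
    rw [hp.2, hpσ, ← hf.2]
    change f (B.mul (B.mul a (φ i)) (ψ i)) = _
    rw [B.mul_assoc, hφ]

end BornAlg

end

noncomputable section

/-! ### Differential operators and uniformly smooth sequences -/

section DiffOps

open scoped BoundedContinuousFunction

variable {𝕜 : Type*} [RCLike 𝕜]
  {E : Type*} [NormedAddCommGroup E] [NormedSpace ℝ E]
  {M : Type*} [TopologicalSpace M] [ChartedSpace E M]
  {M' : Type*} [TopologicalSpace M'] [ChartedSpace E M']

theorem smoothNear_iff {f : M → 𝕜} {x : M} :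
    SmoothNear E f x ↔ ∀ᶠ y in 𝓝 x, ContMDiffAt 𝓘(ℝ, E) 𝓘(ℝ, 𝕜) ∞ f y := by
  constructor
  · rintro ⟨W, hW, hf⟩
    filter_upwards [eventually_mem_nhds_iff.2 hW] with y hy
    exact (hf y (mem_of_mem_nhds hy)).contMDiffAt hy
  · intro h
    exact ⟨_, h, fun y hy => ContMDiffAt.contMDiffWithinAt hy⟩

theorem SmoothNear.eventually {f : M → 𝕜} {x : M} (h : SmoothNear E f x) :
    ∀ᶠ y in 𝓝 x, SmoothNear E f y := by
  simp only [smoothNear_iff] at h ⊢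
  exact h.eventually_nhds

theorem SmoothNear.contMDiffAt {f : M → 𝕜} {x : M} (h : SmoothNear E f x) :
    ContMDiffAt 𝓘(ℝ, E) 𝓘(ℝ, 𝕜) ∞ f x := (smoothNear_iff.1 h).self_of_nhds

theorem SmoothNear.congr {f f' : M → 𝕜} {x : M} (h : SmoothNear E f x) (h' : f =ᶠ[𝓝 x] f') :
    SmoothNear E f' x := by
  simp only [smoothNear_iff] at h ⊢
  filter_upwards [h, h'.symm.eventuallyEq_nhds] with y hy hy'
  exact hy.congr_of_eventuallyEq hy'

theorem ContMDiffOn.smoothNear {f : M → 𝕜} {W : Set M}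
    (h : ContMDiffOn 𝓘(ℝ, E) 𝓘(ℝ, 𝕜) ∞ f W) {x : M} (hx : W ∈ 𝓝 x) : SmoothNear E f x :=
  ⟨W, hx, h⟩

theorem ContMDiff.smoothNear {f : M → 𝕜} (h : ContMDiff 𝓘(ℝ, E) 𝓘(ℝ, 𝕜) ∞ f) (x : M) :
    SmoothNear E f x :=
  ⟨univ, univ_mem, h.contMDiffOn⟩

section Lift

variable [IsManifold 𝓘(ℝ, E) ∞ M]

/-- Locality has to be proved for the inductive class, since its members are operators on arbitrary
functions, smooth or not. -/
theorem IsDiffOp.congr {D : (M → 𝕜) → M → 𝕜} (hD : IsDiffOp E D) {f f' : M → 𝕜} {x : M}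
    (h : f =ᶠ[𝓝 x] f') : D f x = D f' x := by
  induction hD generalizing f f' x with
  | mul a ha => simp only [h.self_of_nhds]
  | deriv X hX => simp only [h.mfderiv_eq]; rfl
  | add D D' _ _ hD hD' => simp only [hD h, hD' h]
  | comp D D' _ _ hD hD' =>
    refine hD ?_
    filter_upwards [h.eventuallyEq_nhds] with y hy
    exact hD' hy

theorem contMDiffAt_mfderiv_apply {V : Type*} [NormedAddCommGroup V] [NormedSpace ℝ V] {F : M → V}
    {X : ∀ x : M, TangentSpace 𝓘(ℝ, E) x}
    (hX : ContMDiff 𝓘(ℝ, E) 𝓘(ℝ, E).tangent ∞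
      fun x => (⟨x, X x⟩ : TangentBundle 𝓘(ℝ, E) M))
    {x : M} (hF : ∀ᶠ y in 𝓝 x, ContMDiffAt 𝓘(ℝ, E) 𝓘(ℝ, V) ∞ F y) :
    ContMDiffAt 𝓘(ℝ, E) 𝓘(ℝ, V) ∞ (fun y => (mfderiv 𝓘(ℝ, E) 𝓘(ℝ, V) F y (X y) : V)) x := by
  obtain ⟨W, hW, hWo, hx⟩ := eventually_nhds_iff.1 hF
  have : IsManifold 𝓘(ℝ, E) 1 M := IsManifold.of_le (n := ∞) (by simp)
  have h1 : ContMDiffOn 𝓘(ℝ, E) 𝓘(ℝ, V) ∞ F W := fun y hy => (hW y hy).contMDiffWithinAt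
  have h2 := h1.contMDiffOn_tangentMapWithin (m := ∞) (by simp) hWo.uniqueMDiffOn
  have h3 := h2.comp (hX.contMDiffOn (s := W)) (fun y hy => hy)
  have h4 := (contMDiff_snd_tangentBundle_modelSpace V 𝓘(ℝ, V)).comp_contMDiffOn h3
  refine (h4.congr fun y hy => ?_).contMDiffAt (hWo.mem_nhds hx)
  simp only [Function.comp, tangentMapWithin, mfderivWithin_of_isOpen hWo hy]
  rfl

/-- A scalar operator built from functions and vector fields acts equally on smooth maps into a
normed space and commutes there with bounded functionals. Different spaces `V` give the properties
needed: `𝕜` gives smoothness of `D f`, `𝕜 × 𝕜` linearity, and bounded sequences uniform bounds and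
ultralimits. -/
theorem IsDiffOp.exists_lift {V : Type*} [NormedAddCommGroup V] [NormedSpace ℝ V]
    [NormedSpace 𝕜 V] [IsScalarTower ℝ 𝕜 V] {D : (M → 𝕜) → M → 𝕜} (hD : IsDiffOp E D)
    (F : M → V) : ∃ F' : M → V, ∀ x, (∀ᶠ y in 𝓝 x, ContMDiffAt 𝓘(ℝ, E) 𝓘(ℝ, V) ∞ F y) →
      ContMDiffAt 𝓘(ℝ, E) 𝓘(ℝ, V) ∞ F' x ∧
      ∀ Λ : V →L[𝕜] 𝕜, D (fun y => Λ (F y)) x = Λ (F' x) := by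
  induction hD generalizing F with
  | mul a ha =>
    refine ⟨fun x => a x • F x, fun x hx => ⟨?_, fun Λ => by simp⟩⟩
    have h1 : ContMDiffAt 𝓘(ℝ, E) 𝓘(ℝ, V) ∞ F x := hx.self_of_nhds
    exact ((ContinuousLinearMap.lsmul ℝ 𝕜 (E := V)).contMDiff.contMDiffAt.comp x
      (ha x)).clm_apply h1
  | deriv X hX =>
    refine ⟨fun y => (mfderiv 𝓘(ℝ, E) 𝓘(ℝ, V) F y (X y) : V), fun x hx =>
      ⟨contMDiffAt_mfderiv_apply hX hx, fun Λ => ?_⟩⟩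
    have h1 : MDifferentiableAt 𝓘(ℝ, E) 𝓘(ℝ, V) F x := hx.self_of_nhds.mdifferentiableAt (by simp)
    have h2 := (Λ.restrictScalars ℝ).hasMFDerivAt (x := F x)
    have h3 := h2.comp x h1.hasMFDerivAt
    exact congrArg (fun L => L (X x)) h3.mfderiv
  | add D D' _ _ hD hD' =>
    obtain ⟨F₁, h₁⟩ := hD F
    obtain ⟨F₂, h₂⟩ := hD' F
    exact ⟨fun x => F₁ x + F₂ x, fun x hx => ⟨(h₁ x hx).1.add (h₂ x hx).1, fun Λ => by
      simp only [(h₁ x hx).2, (h₂ x hx).2, map_add]⟩⟩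
  | comp D D' hD₀ _ hD hD' =>
    obtain ⟨F₂, h₂⟩ := hD' F
    obtain ⟨F₁, h₁⟩ := hD F₂
    refine ⟨F₁, fun x hx => ?_⟩
    have h3 := h₁ x (hx.eventually_nhds.mono fun y hy => (h₂ y hy).1)
    refine ⟨h3.1, fun Λ => ?_⟩
    rw [← h3.2]
    exact hD₀.congr (hx.eventually_nhds.mono fun y hy => (h₂ y hy).2 Λ)

theorem IsDiffOp.smoothNear {D : (M → 𝕜) → M → 𝕜} (hD : IsDiffOp E D) {f : M → 𝕜} {x : M}
    (hf : SmoothNear E f x) : SmoothNear E (D f) x := by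
  obtain ⟨F, hF⟩ := hD.exists_lift f
  rw [smoothNear_iff] at hf ⊢
  have h1 : D f =ᶠ[𝓝 x] F := hf.eventually_nhds.mono fun y hy =>
    (hF y hy).2 (ContinuousLinearMap.id 𝕜 𝕜)
  filter_upwards [hf.eventually_nhds, h1.eventuallyEq_nhds] with y hy hy'
  exact (hF y hy).1.congr_of_eventuallyEq hy'

theorem IsDiffOp.add_smul {D : (M → 𝕜) → M → 𝕜} (hD : IsDiffOp E D) {f h : M → 𝕜} {x : M} (c : 𝕜)
    (hf : SmoothNear E f x) (hh : SmoothNear E h x) :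
    D (fun y => f y + c * h y) x = D f x + c * D h x := by
  obtain ⟨F, hF⟩ := hD.exists_lift fun y => (f y, h y)
  rw [smoothNear_iff] at hf hh
  have h1 := hF x ((hf.and hh).mono fun y hy => hy.1.prodMk_space hy.2)
  have e1 := h1.2 (ContinuousLinearMap.fst 𝕜 𝕜 𝕜)
  have e2 := h1.2 (ContinuousLinearMap.snd 𝕜 𝕜 𝕜)
  -- One lift of the pair `(f, h)` serves the two projections and their combination, so linearity of
  -- `D` is inherited from linearity in the functional.
  have e3 := h1.2 (ContinuousLinearMap.fst 𝕜 𝕜 𝕜 + c • ContinuousLinearMap.snd 𝕜 𝕜 𝕜)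
  simp only [ContinuousLinearMap.coe_fst', ContinuousLinearMap.coe_snd',
    add_apply, smul_apply, smul_eq_mul] at e1 e2 e3
  rw [e1, e2, e3]

theorem IsDiffOp.zero {D : (M → 𝕜) → M → 𝕜} (hD : IsDiffOp E D) (x : M) :
    D (fun _ => 0) x = 0 := by
  have h0 : SmoothNear E (fun _ : M => (0 : 𝕜)) x := contMDiff_const.smoothNear x
  have := hD.add_smul (-1) h0 h0
  simpa using this

theorem isDiffOp_id : IsDiffOp E (fun (f : M → 𝕜) x => f x) := by
  have := IsDiffOp.mul (E := E) (fun _ : M => (1 : 𝕜)) contMDiff_const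
  simpa using this

end Lift

variable (E) in
/-- A sequence of functions is uniformly smooth near a point if it defines a smooth function with
values in the Banach space of bounded sequences. -/
def UnifSmoothNear (f : ℕ → M → 𝕜) (x : M) : Prop :=
  ∃ F : M → ℕ →ᵇ 𝕜, ∀ᶠ y in 𝓝 x, ContMDiffAt 𝓘(ℝ, E) 𝓘(ℝ, ℕ →ᵇ 𝕜) ∞ F y ∧ ∀ n, F y n = f n y

namespace UnifSmoothNear

variable {f h : ℕ → M → 𝕜} {x : M}

theorem congr (hf : UnifSmoothNear E f x) (hh : ∀ᶠ y in 𝓝 x, ∀ n, f n y = h n y) :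
    UnifSmoothNear E h x := by
  obtain ⟨F, hF⟩ := hf
  exact ⟨F, hF.mp (hh.mono fun y hy h' => ⟨h'.1, fun n => (h'.2 n).trans (hy n)⟩)⟩

theorem const {a : M → 𝕜} (ha : SmoothNear E a x) : UnifSmoothNear E (fun _ => a) x := by
  rw [smoothNear_iff] at ha
  refine ⟨fun y => a y • (1 : ℕ →ᵇ 𝕜), ha.mono fun y hy => ⟨?_, fun n => by simp⟩⟩
  exact ((ContinuousLinearMap.lsmul ℝ 𝕜 (E := ℕ →ᵇ 𝕜)).contMDiff.contMDiffAt.comp y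
      hy).clm_apply contMDiffAt_const

theorem smoothNear (hf : UnifSmoothNear E f x) (n : ℕ) : SmoothNear E (f n) x := by
  obtain ⟨F, hF⟩ := hf
  have h1 : SmoothNear E (fun y => F y n) x := smoothNear_iff.2 <| hF.mono fun y hy =>
    ((BoundedContinuousFunction.evalCLM 𝕜 n).restrictScalars ℝ).contMDiff.contMDiffAt.comp y hy.1
  exact h1.congr (hF.mono fun y hy => hy.2 n)

theorem add (hf : UnifSmoothNear E f x) (hh : UnifSmoothNear E h x) :
    UnifSmoothNear E (fun n y => f n y + h n y) x := by
  obtain ⟨F, hF⟩ := hf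
  obtain ⟨F', hF'⟩ := hh
  exact ⟨fun y => F y + F' y, (hF.and hF').mono fun y hy => ⟨hy.1.1.add hy.2.1, fun n => by
    simp [hy.1.2, hy.2.2]⟩⟩

theorem mul (hf : UnifSmoothNear E f x) (hh : UnifSmoothNear E h x) :
    UnifSmoothNear E (fun n y => f n y * h n y) x := by
  obtain ⟨F, hF⟩ := hf
  obtain ⟨F', hF'⟩ := hh
  exact ⟨fun y => F y * F' y, (hF.and hF').mono fun y hy =>
    ⟨((ContinuousLinearMap.mul ℝ (ℕ →ᵇ 𝕜)).contMDiff.contMDiffAt.comp y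
      hy.1.1).clm_apply hy.2.1, fun n => by simp [hy.1.2, hy.2.2]⟩⟩

theorem sum {ι : Type*} {s : Finset ι} {f : ι → ℕ → M → 𝕜}
    (hf : ∀ i ∈ s, UnifSmoothNear E (f i) x) :
    UnifSmoothNear E (fun n y => ∑ i ∈ s, f i n y) x := by
  classical
  induction s using Finset.induction_on with
  | empty => simpa using const (contMDiff_const.smoothNear x)
  | insert i s hi ih =>
    simp only [Finset.sum_insert hi]
    exact (hf i (by simp)).add (ih fun j hj => hf j (by simp [hj]))

theorem comp {φ : M' → M} {y : M'} (hf : UnifSmoothNear E f (φ y))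
    (hφ : ∀ᶠ z in 𝓝 y, ContMDiffAt 𝓘(ℝ, E) 𝓘(ℝ, E) ∞ φ z) :
    UnifSmoothNear E (fun n z => f n (φ z)) y := by
  obtain ⟨F, hF⟩ := hf
  refine ⟨fun z => F (φ z), ?_⟩
  filter_upwards [hφ.self_of_nhds.continuousAt.eventually hF, hφ] with z hz hz'
  exact ⟨hz.1.comp z hz', hz.2⟩

theorem bounded (hf : UnifSmoothNear E f x) : ∃ r : ℝ, ∀ᶠ y in 𝓝 x, ∀ n, ‖f n y‖ ≤ r := by
  obtain ⟨F, hF⟩ := hf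
  refine ⟨‖F x‖ + 1, ?_⟩
  have h1 : ContinuousAt (fun y => ‖F y‖) x := hF.self_of_nhds.1.continuousAt.norm
  filter_upwards [hF, h1.eventually (gt_mem_nhds (lt_add_one _))] with y hy hy' n
  rw [← hy.2 n]
  exact ((F y).norm_coe_le_norm n).trans hy'.le

theorem diffOp [IsManifold 𝓘(ℝ, E) ∞ M] {D : (M → 𝕜) → M → 𝕜} (hD : IsDiffOp E D)
    (hf : UnifSmoothNear E f x) : UnifSmoothNear E (fun n => D (f n)) x := by
  obtain ⟨F, hF⟩ := hf
  obtain ⟨F', hF'⟩ := hD.exists_lift F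
  refine ⟨F', hF.eventually_nhds.mono fun y hy => ?_⟩
  have h1 := hF' y (hy.mono fun z hz => hz.1)
  refine ⟨h1.1, fun n => ?_⟩
  have h2 := h1.2 (BoundedContinuousFunction.evalCLM 𝕜 n)
  simp only [BoundedContinuousFunction.evalCLM_apply] at h2
  rw [← h2]
  exact hD.congr (hy.mono fun z hz => hz.2 n)

end UnifSmoothNear

/-- A bounded sequence stays in a compact ball of `𝕜`, so it converges along the ultrafilter.
Uniqueness of limits gives linearity, and the ball gives norm at most `1`. -/
theorem exists_ultralimit_functional : ∃ Λ : (ℕ →ᵇ 𝕜) →L[𝕜] 𝕜, ∀ b : ℕ →ᵇ 𝕜,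
    Tendsto b (hyperfilter ℕ : Filter ℕ) (𝓝 (Λ b)) := by
  have h : ∀ b : ℕ →ᵇ 𝕜, ∃ l ∈ Metric.closedBall (0 : 𝕜) ‖b‖,
      Tendsto b (hyperfilter ℕ : Filter ℕ) (𝓝 l) := by
    intro b
    refine (isCompact_closedBall (0 : 𝕜) ‖b‖).ultrafilter_le_nhds ((hyperfilter ℕ).map b) ?_
    rw [le_principal_iff]
    exact Filter.mem_map.2 (Filter.univ_mem' fun n => by simpa using b.norm_coe_le_norm n)
  choose l hl hl' using h
  refine ⟨LinearMap.mkContinuous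
    { toFun := l
      map_add' := fun b b' => tendsto_nhds_unique (hl' (b + b')) ((hl' b).add (hl' b'))
      map_smul' := fun c b =>
        tendsto_nhds_unique (hl' (c • b)) ((hl' b).const_smul c) } 1 fun b => ?_, hl'⟩
  simpa using hl b

theorem UnifSmoothNear.exists_ultralimit {f : ℕ → M → 𝕜} {x : M} (hf : UnifSmoothNear E f x) :
    ∃ l, Tendsto (fun n => f n x) (hyperfilter ℕ : Filter ℕ) (𝓝 l) := by
  obtain ⟨F, hF⟩ := hf
  obtain ⟨Λ, hΛ⟩ := exists_ultralimit_functional (𝕜 := 𝕜)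
  exact ⟨Λ (F x), (hΛ (F x)).congr hF.self_of_nhds.2⟩

/-- Near `x` the pointwise ultralimit is `Λ ∘ F` with `F` smooth into bounded sequences and `Λ` the
ultralimit functional. Hence it is smooth, and differential operators commute with the limit by
`exists_lift`. -/
theorem UnifSmoothNear.ultralimit [IsManifold 𝓘(ℝ, E) ∞ M] {f : ℕ → M → 𝕜} {x : M}
    (hf : UnifSmoothNear E f x) {a : M → 𝕜}
    (ha : ∀ᶠ y in 𝓝 x, Tendsto (fun n => f n y) (hyperfilter ℕ : Filter ℕ) (𝓝 (a y))) :
    SmoothNear E a x ∧ ∀ D : (M → 𝕜) → M → 𝕜, IsDiffOp E D →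
      Tendsto (fun n => D (f n) x) (hyperfilter ℕ : Filter ℕ) (𝓝 (D a x)) := by
  obtain ⟨F, hF⟩ := hf
  obtain ⟨Λ, hΛ⟩ := exists_ultralimit_functional (𝕜 := 𝕜)
  have h1 : (fun y => Λ (F y)) =ᶠ[𝓝 x] a := by
    filter_upwards [ha, hF] with y hy hy'
    exact tendsto_nhds_unique (hΛ (F y)) (hy.congr fun n => (hy'.2 n).symm)
  refine ⟨SmoothNear.congr (smoothNear_iff.2 <| hF.mono fun y hy =>
    (Λ.restrictScalars ℝ).contMDiff.contMDiffAt.comp y hy.1) h1, fun D hD => ?_⟩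
  obtain ⟨F', hF'⟩ := hD.exists_lift F
  have h2 := (hF' x (hF.mono fun z hz => hz.1)).2
  rw [← hD.congr h1, h2]
  convert hΛ (F' x) using 2 with n
  have h3 := h2 (BoundedContinuousFunction.evalCLM 𝕜 n)
  simp only [BoundedContinuousFunction.evalCLM_apply] at h3
  rw [← h3]
  exact (hD.congr (hF.mono fun z hz => hz.2 n)).symm

end DiffOps

end

noncomputable section

/-! ### Uniform smoothness from bounds on differential operators -/

section Bounds

open scoped BoundedContinuousFunction

variable {𝕜 : Type*} [RCLike 𝕜]
  {E : Type*} [NormedAddCommGroup E] [NormedSpace ℝ E]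

open Classical in
/-- A bounded sequence as an element of the Banach space of bounded sequences. -/
def boundedSeq (b : ℕ → 𝕜) : ℕ →ᵇ 𝕜 :=
  if h : ∃ r : ℝ, ∀ n, ‖b n‖ ≤ r then
    BoundedContinuousFunction.ofNormedAddCommGroupDiscrete b h.choose h.choose_spec else 0

theorem boundedSeq_apply {b : ℕ → 𝕜} (h : ∃ r : ℝ, ∀ n, ‖b n‖ ≤ r) (n : ℕ) :
    boundedSeq b n = b n := by
  rw [boundedSeq, dif_pos h]
  rfl

/-- A class of sequences of functions on `Ω` which are smooth and uniformly bounded, together with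
their directional derivatives. -/
structure IsDerivClosed (Ω : Set E) (𝓕 : (ℕ → E → 𝕜) → Prop) : Prop where
  smooth : ∀ f, 𝓕 f → ∀ n, ContDiffOn ℝ ∞ (f n) Ω
  bound : ∀ f, 𝓕 f → ∃ r : ℝ, ∀ n, ∀ y ∈ Ω, ‖f n y‖ ≤ r
  deriv : ∀ f, 𝓕 f → ∀ v, 𝓕 fun n y => fderiv ℝ (f n) y v

namespace IsDerivClosed

variable {Ω : Set E} {𝓕 : (ℕ → E → 𝕜) → Prop} (h : IsDerivClosed Ω 𝓕) {f : ℕ → E → 𝕜}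
include h

theorem differentiableAt (hΩ : IsOpen Ω) (hf : 𝓕 f) (n : ℕ) {y : E} (hy : y ∈ Ω) :
    DifferentiableAt ℝ (f n) y :=
  ((h.smooth f hf n).contDiffAt (hΩ.mem_nhds hy)).differentiableAt (by simp)

variable [FiniteDimensional ℝ E]

theorem exists_fderiv_bound (hf : 𝓕 f) : ∃ C : ℝ, 0 ≤ C ∧ ∀ n, ∀ y ∈ Ω, ‖fderiv ℝ (f n) y‖ ≤ C := by
  let b := Module.finBasis ℝ E
  obtain ⟨C, hC, hb⟩ := b.exists_opNorm_le (F := 𝕜)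
  choose r hr using fun i => h.bound _ (h.deriv f hf (b i))
  refine ⟨C * ∑ i, |r i|, by positivity, fun n y hy => hb (by positivity) fun i => ?_⟩
  exact ((hr i n y hy).trans (le_abs_self _)).trans
    (Finset.single_le_sum (f := fun i => |r i|) (fun i _ => abs_nonneg _) (Finset.mem_univ i))

theorem exists_fderiv_lipschitz (hΩ : IsOpen Ω) (hΩ' : Convex ℝ Ω) (hf : 𝓕 f) :
    ∃ C : ℝ, 0 ≤ C ∧ ∀ n, ∀ y ∈ Ω, ∀ z ∈ Ω,
      ‖fderiv ℝ (f n) z - fderiv ℝ (f n) y‖ ≤ C * ‖z - y‖ := by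
  let b := Module.finBasis ℝ E
  obtain ⟨C, hC, hb⟩ := b.exists_opNorm_le (F := 𝕜)
  choose r hr0 hr using fun i => h.exists_fderiv_bound (h.deriv f hf (b i))
  refine ⟨C * ∑ i, r i, mul_nonneg hC.le (Finset.sum_nonneg fun i _ => hr0 i),
    fun n y hy z hz => ?_⟩
  rw [mul_assoc]
  refine hb (mul_nonneg (Finset.sum_nonneg fun i _ => hr0 i) (norm_nonneg _)) fun i => ?_
  have h1 := hΩ'.norm_image_sub_le_of_norm_fderiv_le (𝕜 := ℝ)
    (fun w hw => h.differentiableAt hΩ (h.deriv f hf (b i)) n hw) (fun w hw => hr i n w hw) hy hz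
  refine h1.trans ?_
  gcongr
  exact Finset.single_le_sum (f := r) (fun i _ => hr0 i) (Finset.mem_univ i)

/-- The mean value inequality is applied on a segment, where the derivative moves by at most a
multiple of `‖z - y‖`. The constant is independent of `n`, so the remainder is quadratic in the
supremum norm. -/
theorem exists_taylor_bound (hΩ : IsOpen Ω) (hΩ' : Convex ℝ Ω) (hf : 𝓕 f) :
    ∃ C : ℝ, 0 ≤ C ∧ ∀ n, ∀ y ∈ Ω, ∀ z ∈ Ω,
      ‖f n z - f n y - fderiv ℝ (f n) y (z - y)‖ ≤ C * ‖z - y‖ ^ 2 := by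
  obtain ⟨C, hC, hL⟩ := h.exists_fderiv_lipschitz hΩ hΩ' hf
  refine ⟨C, hC, fun n y hy z hz => ?_⟩
  have hsub : segment ℝ y z ⊆ Ω := hΩ'.segment_subset hy hz
  have h1 := (convex_segment y z).norm_image_sub_le_of_norm_fderiv_le' (𝕜 := ℝ)
    (f := f n) (φ := fderiv ℝ (f n) y) (C := C * ‖z - y‖)
    (fun w hw => h.differentiableAt hΩ hf n (hsub hw)) (fun w hw => ?_)
    (left_mem_segment ℝ y z) (right_mem_segment ℝ y z)
  · rwa [mul_assoc, ← sq] at h1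
  · refine (hL n y hy w (hsub hw)).trans ?_
    gcongr
    exact norm_sub_le_of_mem_segment hw

theorem hasFDerivAt (hΩ : IsOpen Ω) (hΩ' : Convex ℝ Ω) (hf : 𝓕 f) {y : E} (hy : y ∈ Ω) :
    ∃ L : E →L[ℝ] ℕ →ᵇ 𝕜, (∀ v, L v = boundedSeq fun n => fderiv ℝ (f n) y v) ∧
      HasFDerivAt (fun z => boundedSeq fun n => f n z) L y := by
  have hap : ∀ {f : ℕ → E → 𝕜}, 𝓕 f → ∀ {z : E}, z ∈ Ω → ∀ n,
      boundedSeq (fun n => f n z) n = f n z := fun hf z hz n => by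
    obtain ⟨r, hr⟩ := h.bound _ hf
    exact boundedSeq_apply ⟨r, fun n => hr n z hz⟩ n
  let L : E →ₗ[ℝ] ℕ →ᵇ 𝕜 :=
    { toFun := fun v => boundedSeq fun n => fderiv ℝ (f n) y v
      map_add' := fun v w => by
        ext n
        rw [BoundedContinuousFunction.add_apply, hap (h.deriv f hf _) hy, hap (h.deriv f hf _) hy,
          hap (h.deriv f hf _) hy, map_add]
      map_smul' := fun c v => by
        ext n
        rw [BoundedContinuousFunction.smul_apply, hap (h.deriv f hf _) hy,
          hap (h.deriv f hf _) hy, map_smul]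
        rfl }
  refine ⟨L.toContinuousLinearMap, fun v => rfl, ?_⟩
  obtain ⟨C, hC, hT⟩ := h.exists_taylor_bound hΩ hΩ' hf
  refine .of_isLittleO (Asymptotics.IsBigO.trans_isLittleO ?_
    (Asymptotics.isLittleO_pow_sub_sub y one_lt_two))
  refine Asymptotics.IsBigO.of_bound C ?_
  filter_upwards [hΩ.mem_nhds hy] with z hz
  rw [norm_pow, norm_norm]
  refine (BoundedContinuousFunction.norm_le (by positivity)).2 fun n => ?_
  have h1 := hT n y hy z hz
  change ‖boundedSeq (fun n => f n z) n - boundedSeq (fun n => f n y) n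
    - boundedSeq (fun n => fderiv ℝ (f n) y (z - y)) n‖ ≤ _
  rwa [hap hf hz, hap hf hy, hap (h.deriv f hf (z - y)) hy]

/-- The directional derivative of the sequence-valued map is the sequence of directional
derivatives, which belongs to the same class; induction on the order applies. -/
theorem contDiffOn (hΩ : IsOpen Ω) (hΩ' : Convex ℝ Ω) (hf : 𝓕 f) :
    ContDiffOn ℝ ∞ (fun z => boundedSeq fun n => f n z) Ω := by
  rw [contDiffOn_infty]
  intro k
  induction k generalizing f with
  | zero =>
    rw [Nat.cast_zero, contDiffOn_zero]
    intro y hy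
    obtain ⟨L, -, hL⟩ := h.hasFDerivAt hΩ hΩ' hf hy
    exact hL.continuousAt.continuousWithinAt
  | succ k ih =>
    push_cast
    refine contDiffOn_succ_of_fderiv_apply (fun y hy => ?_) (by simp) fun v => ?_
    · obtain ⟨L, -, hL⟩ := h.hasFDerivAt hΩ hΩ' hf hy
      exact hL.differentiableAt.differentiableWithinAt
    · refine (ih (h.deriv f hf v)).congr fun y hy => ?_
      obtain ⟨L, hL', hL⟩ := h.hasFDerivAt hΩ hΩ' hf hy
      rw [fderivWithin_of_isOpen hΩ hy, hL.fderiv, hL']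

end IsDerivClosed

variable [FiniteDimensional ℝ E] {M : Type*} [TopologicalSpace M] [ChartedSpace E M] [IsManifold 𝓘(ℝ, E) ∞ M] [T2Space M]

/-- Global vector fields that are coordinate vector fields near a given point. -/
theorem exists_coordinate_vectorField (x : M) (N : Set M) (hN : N ∈ 𝓝 x) :
    ∃ U : Set M, IsOpen U ∧ x ∈ U ∧ U ⊆ N ∧ U ⊆ (extChartAt 𝓘(ℝ, E) x).source ∧
      ∀ v : E, ∃ X : ∀ y : M, TangentSpace 𝓘(ℝ, E) y,
        ContMDiff 𝓘(ℝ, E) 𝓘(ℝ, E).tangent ∞ (fun y => (⟨y, X y⟩ : TangentBundle 𝓘(ℝ, E) M)) ∧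
        ∀ y ∈ U, X y = mfderiv 𝓘(ℝ, E) 𝓘(ℝ, E) (extChartAt 𝓘(ℝ, E) x).symm
          (extChartAt 𝓘(ℝ, E) x y) v := by
  obtain ⟨χ⟩ : Nonempty (SmoothBumpFunction 𝓘(ℝ, E) x) := inferInstance
  have : IsManifold 𝓘(ℝ, E) 1 M := IsManifold.of_le (n := ∞) (by simp)
  obtain ⟨U, hU, hUo, hxU⟩ := eventually_nhds_iff.1
    ((χ.eventuallyEq_one.and hN).and (extChartAt_source_mem_nhds (I := 𝓘(ℝ, E)) x))
  refine ⟨U, hUo, hxU, fun y hy => (hU y hy).1.2, fun y hy => (hU y hy).2, fun v => ?_⟩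
  let t := trivializationAt E (TangentSpace 𝓘(ℝ, E) : M → Type _) x
  have hbase : t.baseSet = (chartAt E x).source := rfl
  have h1 : ContMDiffOn 𝓘(ℝ, E) 𝓘(ℝ, E).tangent ∞
      (fun y => (⟨y, t.symm y v⟩ : TangentBundle 𝓘(ℝ, E) M)) t.baseSet := by
    intro y hy
    rw [t.contMDiffWithinAt_section _ hy]
    exact (contMDiffOn_const (c := v)).congr (fun z hz => by simp [t.apply_mk_symm hz]) y hy
  refine ⟨fun y => χ y • t.symm y v, ?_, fun y hy => ?_⟩
  · refine ContMDiffOn.smul_section_of_tsupport (u := t.baseSet) χ.contMDiff.contMDiffOn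
      t.open_baseSet ?_ h1
    rw [hbase]
    exact χ.tsupport_subset_chartAt_source
  · have h2 := (hU y hy).2
    rw [extChartAt_source] at h2
    have h3 := TangentBundle.symmL_trivializationAt (I := 𝓘(ℝ, E)) (x₀ := x) h2
    have h4 : t.symm y v = mfderiv 𝓘(ℝ, E) 𝓘(ℝ, E) (extChartAt 𝓘(ℝ, E) x).symm
        (extChartAt 𝓘(ℝ, E) x y) v := by
      simp only [modelWithCornersSelf_coe, range_id, mfderivWithin_univ] at h3
      rw [← Bundle.Trivialization.symmL_apply (R := ℝ) t h2]
      exact congrArg (fun L => L v) h3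
    have h5 : χ y = 1 := (hU y hy).1.1
    change χ y • t.symm y v = _
    rw [h5, one_smul, h4]

/-- In a chart the coordinate derivatives are restrictions of global vector fields, so bounds on
global differential operators bound all iterated partial derivatives. The chart expressions of such
sequences form a class closed under directional derivatives. -/
theorem unifSmoothNear_of_bounds {f : ℕ → M → 𝕜} {x : M} {N : Set M} (hN : N ∈ 𝓝 x)
    (hf : ∀ n, ContMDiffOn 𝓘(ℝ, E) 𝓘(ℝ, 𝕜) ∞ (f n) N)
    (hb : ∀ D : (M → 𝕜) → M → 𝕜, IsDiffOp E D → ∃ r : ℝ, ∀ n, ∀ y ∈ N, ‖D (f n) y‖ ≤ r) :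
    UnifSmoothNear E f x := by
  obtain ⟨U, hUo, hxU, hUN, hUs, hX⟩ :=
    exists_coordinate_vectorField (E := E) x N hN
  choose X hXs hXc using hX
  set φ := extChartAt 𝓘(ℝ, E) x with hφ
  have hφs : ContMDiffOn 𝓘(ℝ, E) 𝓘(ℝ, E) ∞ φ.symm φ.target := contMDiffOn_extChartAt_symm x
  have hto : IsOpen φ.target := isOpen_extChartAt_target x
  have hpre : IsOpen (φ.target ∩ φ.symm ⁻¹' U) :=
    hφs.continuousOn.isOpen_inter_preimage hto hUo
  have hxm : φ x ∈ φ.target ∩ φ.symm ⁻¹' U :=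
    ⟨mem_extChartAt_target x, by simpa [hφ, extChartAt_to_inv] using hxU⟩
  obtain ⟨ε, hε, hball⟩ := Metric.isOpen_iff.1 hpre _ hxm
  set Ω := Metric.ball (φ x) ε with hΩ
  -- The sequence `a` on the manifold is kept as a witness: a directional derivative of the chart
  -- expression corresponds to applying the vector field `X v` to `a`. Smoothness is asked only at
  -- interior points of `N`, where it is inherited by derivatives.
  let 𝓕 : (ℕ → E → 𝕜) → Prop := fun u => ∃ a : ℕ → M → 𝕜, (∀ n, ∀ y ∈ N, N ∈ 𝓝 y →
      SmoothNear E (a n) y) ∧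
      (∀ D : (M → 𝕜) → M → 𝕜, IsDiffOp E D → ∃ r : ℝ, ∀ n, ∀ y ∈ N, ‖D (a n) y‖ ≤ r) ∧
      ∀ n, ∀ y ∈ Ω, u n y = a n (φ.symm y)
  have hU𝓝 : ∀ y ∈ U, N ∈ 𝓝 y := fun y hy => mem_of_superset (hUo.mem_nhds hy) hUN
  have hat : ∀ {a : M → 𝕜}, (∀ y ∈ N, N ∈ 𝓝 y → SmoothNear E a y) → ∀ y ∈ Ω,
      ContMDiffAt 𝓘(ℝ, E) 𝓘(ℝ, 𝕜) ∞ a (φ.symm y) := fun ha y hy =>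
    (ha _ (hUN (hball hy).2) (hU𝓝 _ (hball hy).2)).contMDiffAt
  have hsat : ∀ y ∈ Ω, ContMDiffAt 𝓘(ℝ, E) 𝓘(ℝ, E) ∞ φ.symm y := fun y hy =>
    hφs.contMDiffAt (hto.mem_nhds (hball hy).1)
  have h𝓕 : IsDerivClosed Ω 𝓕 := by
    refine ⟨?_, ?_, ?_⟩
    · rintro u ⟨a, ha, -, hu⟩ n
      refine ContDiffOn.congr (f := fun y => a n (φ.symm y)) (fun y hy => ?_) (hu n)
      exact ((hat (ha n) y hy).comp y (hsat y hy)).contDiffAt.contDiffWithinAt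
    · rintro u ⟨a, -, ha, hu⟩
      obtain ⟨r, hr⟩ := ha _ isDiffOp_id
      exact ⟨r, fun n y hy => by rw [hu n y hy]; exact hr n _ (hUN (hball hy).2)⟩
    · rintro u ⟨a, ha, ha', hu⟩ v
      have hD := IsDiffOp.deriv (𝕜 := 𝕜) (X v) (hXs v)
      refine ⟨_, fun n y hy hy' => hD.smoothNear (ha n y hy hy'), fun D hD' =>
        ha' _ (.comp _ _ hD' hD), fun n y hy => ?_⟩
      have h1 : u n =ᶠ[𝓝 y] a n ∘ φ.symm :=
        Filter.mem_of_superset (Metric.isOpen_ball.mem_nhds hy) (hu n)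
      have h2 := (hat (ha n) y hy).mdifferentiableAt (by simp)
      have h3 := (hsat y hy).mdifferentiableAt (by simp)
      have h4 : fderiv ℝ (u n) y = (mfderiv 𝓘(ℝ, E) 𝓘(ℝ, 𝕜) (a n) (φ.symm y)).comp
          (mfderiv 𝓘(ℝ, E) 𝓘(ℝ, E) φ.symm y) := by
        rw [h1.fderiv_eq, ← mfderiv_eq_fderiv]
        exact mfderiv_comp y h2 h3
      have h5 := (hXc v _ (hball hy).2).trans (congrArg
        (fun w => (show E →L[ℝ] E from mfderiv 𝓘(ℝ, E) 𝓘(ℝ, E) φ.symm w) v)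
        (φ.right_inv (hball hy).1))
      refine (congrArg (fun L => L v) h4).trans ?_
      exact congrArg (mfderiv 𝓘(ℝ, E) 𝓘(ℝ, 𝕜) (a n) (φ.symm y)) h5.symm
  have hmem : 𝓕 fun n y => f n (φ.symm y) :=
    ⟨f, fun n y _ hy' => (hf n).smoothNear hy', hb, fun n y _ => rfl⟩
  have key := h𝓕.contDiffOn Metric.isOpen_ball (convex_ball _ _) hmem
  -- `boundedSeq` is zero on unbounded sequences and `φ` is arbitrary off its source; both are
  -- harmless, since only `y` near `x` count.
  refine ⟨fun y => boundedSeq fun n => f n (φ.symm (φ y)), ?_⟩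
  have hφat : ∀ᶠ y in 𝓝 x, ContMDiffAt 𝓘(ℝ, E) 𝓘(ℝ, E) ∞ φ y := by
    filter_upwards [(isOpen_extChartAt_source (I := 𝓘(ℝ, E)) x).mem_nhds
      (mem_extChartAt_source x)] with y hy
    rw [extChartAt_source] at hy
    exact contMDiffAt_extChartAt' hy
  have hev : ∀ᶠ y in 𝓝 x, φ y ∈ Ω :=
    hφat.self_of_nhds.continuousAt (Metric.ball_mem_nhds _ hε)
  filter_upwards [hφat, hev, hUo.mem_nhds hxU] with y hy hy' hyU
  refine ⟨?_, fun n => ?_⟩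
  · exact (key.contDiffAt (Metric.isOpen_ball.mem_nhds hy')).contMDiffAt.comp y hy
  · obtain ⟨r, hr⟩ := hb _ isDiffOp_id
    rw [boundedSeq_apply ⟨r, fun n => hr n _ (hUN (hball hy').2)⟩, φ.left_inv (hUs hyU)]

end Bounds

end

noncomputable section

/-! ### Local star products on germs -/

section Star

open ProperEtaleLieGroupoid (coeffFun starOf)

variable {𝕜 : Type*} [RCLike 𝕜]
  {E : Type*} [NormedAddCommGroup E] [NormedSpace ℝ E]
  {M : Type*} [TopologicalSpace M] [ChartedSpace E M]

theorem UnifSmoothNear.eventually {f : ℕ → M → 𝕜} {x : M} (h : UnifSmoothNear E f x) :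
    ∀ᶠ y in 𝓝 x, UnifSmoothNear E f y := by
  obtain ⟨F, hF⟩ := h
  exact hF.eventually_nhds.mono fun y hy => ⟨F, hy⟩

theorem SmoothNear.add_smul {f h : M → 𝕜} {x : M} (hf : SmoothNear E f x)
    (hh : SmoothNear E h x) (c : 𝕜) : SmoothNear E (fun y => f y + c * h y) x := by
  rw [smoothNear_iff] at hf hh ⊢
  filter_upwards [hf, hh] with y hy hy'
  exact hy.add ((ContinuousLinearMap.mul ℝ 𝕜 c).contMDiff.contMDiffAt.comp y hy')

/-! ### Locality, bilinearity and smoothness of bidifferential operators. -/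

section Bidiff

variable [IsManifold 𝓘(ℝ, E) ∞ M] {C : (M → 𝕜) → (M → 𝕜) → M → 𝕜} {x : M}

theorem IsBidiffOp.congr (hC : IsBidiffOp E C) {f f' h h' : M → 𝕜} (hf : SmoothNear E f x)
    (hh : SmoothNear E h x) (hff : f =ᶠ[𝓝 x] f') (hhh : h =ᶠ[𝓝 x] h') :
    C f h x = C f' h' x := by
  obtain ⟨W, hW, n, D, D', hD, hD', e⟩ := hC x
  have hx := mem_of_mem_nhds hW
  rw [e x hx f h hf hh, e x hx f' h' (hf.congr hff) (hh.congr hhh)]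
  exact Finset.sum_congr rfl fun i _ => by rw [(hD i).congr hff, (hD' i).congr hhh]

theorem IsBidiffOp.add_smul_left (hC : IsBidiffOp E C) {f f' h : M → 𝕜} (c : 𝕜)
    (hf : SmoothNear E f x) (hf' : SmoothNear E f' x) (hh : SmoothNear E h x) :
    C (fun y => f y + c * f' y) h x = C f h x + c * C f' h x := by
  obtain ⟨W, hW, n, D, D', hD, hD', e⟩ := hC x
  have hx := mem_of_mem_nhds hW
  rw [e x hx _ h (hf.add_smul hf' c) hh, e x hx f h hf hh, e x hx f' h hf' hh, Finset.mul_sum,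
    ← Finset.sum_add_distrib]
  refine Finset.sum_congr rfl fun i _ => ?_
  rw [(hD i).add_smul c hf hf']
  ring

theorem IsBidiffOp.add_smul_right (hC : IsBidiffOp E C) {f h h' : M → 𝕜} (c : 𝕜)
    (hf : SmoothNear E f x) (hh : SmoothNear E h x) (hh' : SmoothNear E h' x) :
    C f (fun y => h y + c * h' y) x = C f h x + c * C f h' x := by
  obtain ⟨W, hW, n, D, D', hD, hD', e⟩ := hC x
  have hx := mem_of_mem_nhds hW
  rw [e x hx f _ hf (hh.add_smul hh' c), e x hx f h hf hh, e x hx f h' hf hh', Finset.mul_sum,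
    ← Finset.sum_add_distrib]
  refine Finset.sum_congr rfl fun i _ => ?_
  rw [(hD' i).add_smul c hh hh']
  ring

theorem IsBidiffOp.unifSmoothNear (hC : IsBidiffOp E C) {f h : ℕ → M → 𝕜}
    (hf : UnifSmoothNear E f x) (hh : UnifSmoothNear E h x) :
    UnifSmoothNear E (fun n => C (f n) (h n)) x := by
  obtain ⟨W, hW, n, D, D', hD, hD', e⟩ := hC x
  have h1 : UnifSmoothNear E (fun k y => ∑ i, D i (f k) y * D' i (h k) y) x :=
    UnifSmoothNear.sum fun i _ => (hf.diffOp (hD i)).mul (hh.diffOp (hD' i))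
  refine h1.congr ?_
  filter_upwards [hW, hf.eventually, hh.eventually] with y hy hy' hy'' k
  exact (e y hy _ _ (hy'.smoothNear k) (hy''.smoothNear k)).symm

theorem IsBidiffOp.smoothNear (hC : IsBidiffOp E C) {f h : M → 𝕜}
    (hf : SmoothNear E f x) (hh : SmoothNear E h x) : SmoothNear E (C f h) x :=
  (hC.unifSmoothNear (.const hf) (.const hh)).smoothNear 0

end Bidiff

variable (E) in
/-- A function with values in formal power series represents a germ of formal power series of smooth
functions. -/
def SmoothGerm (f : M → PowerSeries 𝕜) (x : M) : Prop :=
  ∀ᶠ y in 𝓝 x, ∀ l, SmoothNear E (coeffFun l f) y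

namespace SmoothGerm

variable {f f' : M → PowerSeries 𝕜} {x : M}

theorem coeff (h : SmoothGerm E f x) (l : ℕ) : SmoothNear E (coeffFun l f) x := h.self_of_nhds l

theorem eventually (h : SmoothGerm E f x) : ∀ᶠ y in 𝓝 x, SmoothGerm E f y := h.eventually_nhds

theorem congr (h : SmoothGerm E f x) (h' : f =ᶠ[𝓝 x] f') : SmoothGerm E f' x := by
  filter_upwards [h, h'.eventuallyEq_nhds] with y hy hy' l
  exact (hy l).congr (hy'.fun_comp (PowerSeries.coeff l))

theorem add_smul (h : SmoothGerm E f x) (h' : SmoothGerm E f' x) (c : 𝕜) :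
    SmoothGerm E (fun y => f y + c • f' y) x := by
  filter_upwards [h, h'] with y hy hy' l
  refine ((hy l).add_smul (hy' l) c).congr (.of_eq (funext fun z => ?_))
  simp [coeffFun]

theorem const (r : PowerSeries 𝕜) : SmoothGerm E (fun _ : M => r) x :=
  .of_forall fun y _ => contMDiff_const.smoothNear y

theorem sum {ι : Type*} {s : Finset ι} {f : ι → M → PowerSeries 𝕜}
    (hf : ∀ i ∈ s, SmoothGerm E (f i) x) : SmoothGerm E (fun y => ∑ i ∈ s, f i y) x := by
  classical
  induction s using Finset.induction_on with
  | empty => simpa using const 0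
  | insert i s hi ih =>
    simp only [Finset.sum_insert hi]
    simpa using (hf i (by simp)).add_smul (ih fun j hj => hf j (by simp [hj])) 1

theorem comp {M' : Type*} [TopologicalSpace M'] [ChartedSpace E M'] {φ : M' → M} {y : M'}
    (hf : SmoothGerm E f (φ y)) (hφ : ∀ᶠ z in 𝓝 y, ContMDiffAt 𝓘(ℝ, E) 𝓘(ℝ, E) ∞ φ z) :
    SmoothGerm E (fun z => f (φ z)) y := by
  filter_upwards [hφ.self_of_nhds.continuousAt.eventually hf, hφ.eventually_nhds] with z hz hz' l
  exact ((UnifSmoothNear.const (hz l)).comp hz').smoothNear 0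

end SmoothGerm

variable [IsManifold 𝓘(ℝ, E) ∞ M] {C : ℕ → (M → 𝕜) → (M → 𝕜) → M → 𝕜}

omit [TopologicalSpace M] in
theorem coeffFun_starOf (f h : M → PowerSeries 𝕜) (n : ℕ) :
    coeffFun n (starOf C f h) = fun x => ∑ q ∈ Finset.HasAntidiagonal.antidiagonal n,
      ∑ r ∈ Finset.HasAntidiagonal.antidiagonal q.2,
        C q.1 (coeffFun r.1 f) (coeffFun r.2 h) x :=
  funext fun _ => PowerSeries.coeff_mk _ _

omit [TopologicalSpace M] in
theorem coeff_starOf (f h : M → PowerSeries 𝕜) (n : ℕ) (x : M) :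
    PowerSeries.coeff n (starOf C f h x) = ∑ q ∈ Finset.HasAntidiagonal.antidiagonal n,
      ∑ r ∈ Finset.HasAntidiagonal.antidiagonal q.2,
        C q.1 (coeffFun r.1 f) (coeffFun r.2 h) x :=
  PowerSeries.coeff_mk _ _

section Bilinear

variable (hC : ∀ k, IsBidiffOp E (C k)) {x : M} {f f' h h' : M → PowerSeries 𝕜}
include hC

theorem starOf_congr (hf : SmoothGerm E f x) (hh : SmoothGerm E h x) (hff : f =ᶠ[𝓝 x] f')
    (hhh : h =ᶠ[𝓝 x] h') : starOf C f h x = starOf C f' h' x := by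
  ext n
  rw [coeff_starOf, coeff_starOf]
  exact Finset.sum_congr rfl fun q _ => Finset.sum_congr rfl fun r _ =>
    (hC _).congr (hf.coeff _) (hh.coeff _) (hff.fun_comp (PowerSeries.coeff _))
      (hhh.fun_comp (PowerSeries.coeff _))

theorem starOf_eventuallyEq (hf : SmoothGerm E f x) (hh : SmoothGerm E h x)
    (hff : f =ᶠ[𝓝 x] f') (hhh : h =ᶠ[𝓝 x] h') : starOf C f h =ᶠ[𝓝 x] starOf C f' h' := by
  filter_upwards [hf.eventually, hh.eventually, hff.eventuallyEq_nhds, hhh.eventuallyEq_nhds]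
    with y h1 h2 h3 h4
  exact starOf_congr hC h1 h2 h3 h4

theorem smoothGerm_starOf (hf : SmoothGerm E f x) (hh : SmoothGerm E h x) :
    SmoothGerm E (starOf C f h) x := by
  filter_upwards [hf, hh] with y hy hy' n
  rw [coeffFun_starOf]
  refine (UnifSmoothNear.sum fun q _ => UnifSmoothNear.sum fun r _ =>
    UnifSmoothNear.const ?_).smoothNear 0
  exact (hC _).smoothNear (hy _) (hy' _)

theorem starOf_add_smul_left (c : 𝕜) (hf : SmoothGerm E f x) (hf' : SmoothGerm E f' x)
    (hh : SmoothGerm E h x) :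
    starOf C (fun y => f y + c • f' y) h x = starOf C f h x + c • starOf C f' h x := by
  ext n
  simp only [coeff_starOf, map_add, map_smul, smul_eq_mul, Finset.mul_sum,
    ← Finset.sum_add_distrib]
  refine Finset.sum_congr rfl fun q _ => Finset.sum_congr rfl fun r _ => ?_
  rw [← (hC q.1).add_smul_left c (hf.coeff _) (hf'.coeff _) (hh.coeff _)]
  congr 1

theorem starOf_add_smul_right (c : 𝕜) (hf : SmoothGerm E f x) (hh : SmoothGerm E h x)
    (hh' : SmoothGerm E h' x) :
    starOf C f (fun y => h y + c • h' y) x = starOf C f h x + c • starOf C f h' x := by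
  ext n
  simp only [coeff_starOf, map_add, map_smul, smul_eq_mul, Finset.mul_sum,
    ← Finset.sum_add_distrib]
  refine Finset.sum_congr rfl fun q _ => Finset.sum_congr rfl fun r _ => ?_
  rw [← (hC q.1).add_smul_right c (hf.coeff _) (hh.coeff _) (hh'.coeff _)]
  congr 1

/-- Additivity applied to `0 + (-1) • 0` shows that the value equals its difference with itself. -/
theorem starOf_zero_left (hh : SmoothGerm E h x) : starOf C (fun _ => 0) h x = 0 := by
  have := starOf_add_smul_left hC (-1 : 𝕜) (SmoothGerm.const 0) (SmoothGerm.const 0) hh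
  simpa using this

theorem starOf_zero_right (hf : SmoothGerm E f x) : starOf C f (fun _ => 0) x = 0 := by
  have := starOf_add_smul_right hC (-1 : 𝕜) hf (SmoothGerm.const 0) (SmoothGerm.const 0)
  simpa using this

theorem starOf_sum_left {ι : Type*} {s : Finset ι} {f : ι → M → PowerSeries 𝕜}
    (hf : ∀ i ∈ s, SmoothGerm E (f i) x) (hh : SmoothGerm E h x) :
    starOf C (fun y => ∑ i ∈ s, f i y) h x = ∑ i ∈ s, starOf C (f i) h x := by
  classical
  induction s using Finset.induction_on with
  | empty => simpa using starOf_zero_left hC hh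
  | insert i s hi ih =>
    simp only [Finset.sum_insert hi]
    have hs : ∀ j ∈ s, SmoothGerm E (f j) x := fun j hj => hf j (by simp [hj])
    rw [← ih hs]
    simpa using starOf_add_smul_left hC 1 (hf i (by simp)) (SmoothGerm.sum hs) hh

theorem starOf_sum_right {ι : Type*} {s : Finset ι} {h : ι → M → PowerSeries 𝕜}
    (hf : SmoothGerm E f x) (hh : ∀ i ∈ s, SmoothGerm E (h i) x) :
    starOf C f (fun y => ∑ i ∈ s, h i y) x = ∑ i ∈ s, starOf C f (h i) x := by
  classical
  induction s using Finset.induction_on with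
  | empty => simpa using starOf_zero_right hC hf
  | insert i s hi ih =>
    simp only [Finset.sum_insert hi]
    have hs : ∀ j ∈ s, SmoothGerm E (h j) x := fun j hj => hh j (by simp [hj])
    rw [← ih hs]
    simpa using starOf_add_smul_right hC 1 hf (hh i (by simp)) (SmoothGerm.sum hs)

theorem unifSmoothNear_starOf {f h : ℕ → M → PowerSeries 𝕜}
    (hf : ∀ l, UnifSmoothNear E (fun n => coeffFun l (f n)) x)
    (hh : ∀ l, UnifSmoothNear E (fun n => coeffFun l (h n)) x) (l : ℕ) :
    UnifSmoothNear E (fun n => coeffFun l (starOf C (f n) (h n))) x := by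
  simp only [coeffFun_starOf]
  exact UnifSmoothNear.sum fun q _ => UnifSmoothNear.sum fun r _ =>
    (hC q.1).unifSmoothNear (hf r.1) (hh r.2)

end Bilinear

variable (E) in
/-- A unital associative product on formal power series of smooth functions which is given by
bidifferential operators. -/
structure IsLocalStar (C : ℕ → (M → 𝕜) → (M → 𝕜) → M → 𝕜) : Prop where
  bidiff : ∀ k, IsBidiffOp E (C k)
  one_star : ∀ x (f : M → PowerSeries 𝕜), (∀ l, ContMDiff 𝓘(ℝ, E) 𝓘(ℝ, 𝕜) ∞ (coeffFun l f)) →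
    starOf C (fun _ => 1) f x = f x
  star_one : ∀ x (f : M → PowerSeries 𝕜), (∀ l, ContMDiff 𝓘(ℝ, E) 𝓘(ℝ, 𝕜) ∞ (coeffFun l f)) →
    starOf C f (fun _ => 1) x = f x
  assoc : ∀ x (f h e : M → PowerSeries 𝕜), (∀ l, ContMDiff 𝓘(ℝ, E) 𝓘(ℝ, 𝕜) ∞ (coeffFun l f)) →
    (∀ l, ContMDiff 𝓘(ℝ, E) 𝓘(ℝ, 𝕜) ∞ (coeffFun l h)) →
    (∀ l, ContMDiff 𝓘(ℝ, E) 𝓘(ℝ, 𝕜) ∞ (coeffFun l e)) →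
    starOf C (starOf C f h) e x = starOf C f (starOf C h e) x

/-- A bump function supported where all coefficients are smooth extends the germ. One neighbourhood
for all degrees is needed, which is why `SmoothGerm` quantifies over `l` inside the neighbourhood.
With locality of the operators, identities known for global functions pass to germs. -/
theorem SmoothGerm.exists_global [FiniteDimensional ℝ E] [T2Space M] {f : M → PowerSeries 𝕜}
    {x : M} (hf : SmoothGerm E f x) : ∃ f' : M → PowerSeries 𝕜,
      (∀ l, ContMDiff 𝓘(ℝ, E) 𝓘(ℝ, 𝕜) ∞ (coeffFun l f')) ∧ f =ᶠ[𝓝 x] f' := by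
  obtain ⟨χ, -, hχ⟩ := (SmoothBumpFunction.nhds_basis_tsupport (I := 𝓘(ℝ, E)) x).mem_iff.1 hf
  refine ⟨fun y => (χ y : 𝕜) • f y, fun l y => ?_, ?_⟩
  · by_cases hy : y ∈ tsupport χ
    · have h1 : ContMDiffAt 𝓘(ℝ, E) 𝓘(ℝ, 𝕜) ∞ (coeffFun l f) y := (hχ hy l).contMDiffAt
      refine (χ.contMDiffAt.smul h1).congr_of_eventuallyEq (.of_eq (funext fun z => ?_))
      simp [coeffFun, RCLike.real_smul_eq_coe_mul]
    · refine (contMDiffAt_const (c := (0 : 𝕜))).congr_of_eventuallyEq ?_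
      filter_upwards [(isClosed_tsupport χ).isOpen_compl.mem_nhds hy] with z hz
      simp [coeffFun, image_eq_zero_of_notMem_tsupport hz]
  · filter_upwards [χ.eventuallyEq_one] with y hy
    simp [hy]

namespace IsLocalStar

variable [FiniteDimensional ℝ E] [T2Space M] (hC : IsLocalStar E C) {x : M}
  {f h e : M → PowerSeries 𝕜}
include hC

theorem one_star_germ (hf : SmoothGerm E f x) : starOf C (fun _ => 1) f x = f x := by
  obtain ⟨f', hf', hff⟩ := hf.exists_global
  rw [starOf_congr hC.bidiff (SmoothGerm.const 1) hf .rfl hff, hC.one_star x f' hf',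
    hff.self_of_nhds]

theorem star_one_germ (hf : SmoothGerm E f x) : starOf C f (fun _ => 1) x = f x := by
  obtain ⟨f', hf', hff⟩ := hf.exists_global
  rw [starOf_congr hC.bidiff hf (SmoothGerm.const 1) hff .rfl, hC.star_one x f' hf',
    hff.self_of_nhds]

theorem assoc_germ (hf : SmoothGerm E f x) (hh : SmoothGerm E h x) (he : SmoothGerm E e x) :
    starOf C (starOf C f h) e x = starOf C f (starOf C h e) x := by
  obtain ⟨f', hf', hff⟩ := hf.exists_global
  obtain ⟨h', hh', hhh⟩ := hh.exists_global
  obtain ⟨e', he', hee⟩ := he.exists_global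
  have hb := hC.bidiff
  rw [starOf_congr hb (smoothGerm_starOf hb hf hh) he (starOf_eventuallyEq hb hf hh hff hhh) hee,
    hC.assoc x f' h' e' hf' hh' he',
    starOf_congr hb hf (smoothGerm_starOf hb hh he) hff (starOf_eventuallyEq hb hh he hhh hee)]

end IsLocalStar

end Star

end

noncomputable section

/-! ### Local sections of the source map -/

namespace ProperEtaleLieGroupoid

variable {E : Type*} [NormedAddCommGroup E] [NormedSpace ℝ E]
  {G₀ G₁ : Type*} [TopologicalSpace G₀] [ChartedSpace E G₀]
  [TopologicalSpace G₁] [ChartedSpace E G₁]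
  (G : ProperEtaleLieGroupoid E G₀ G₁)

theorem mul_inv_cancel_right {g h : G₁} (hgh : G.src g = G.tgt h) :
    G.mul (G.mul g h) (G.inv h) = g := by
  rw [G.mul_assoc g h _ hgh (G.tgt_inv h).symm, G.mul_inv, ← hgh, G.mul_one]

theorem mul_inv_mul_cancel {g h : G₁} (hgh : G.src g = G.src h) :
    G.mul (G.mul g (G.inv h)) h = g := by
  rw [G.mul_assoc g _ h (by rw [G.tgt_inv, hgh]) (G.src_inv h), G.inv_mul, ← hgh, G.mul_one]

theorem src_mul_inv {g h : G₁} (hgh : G.src g = G.src h) :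
    G.src (G.mul g (G.inv h)) = G.tgt h := by
  rw [G.src_mul _ _ (by rw [G.tgt_inv, hgh]), G.src_inv]

theorem tgt_mul_inv {g h : G₁} (hgh : G.src g = G.src h) :
    G.tgt (G.mul g (G.inv h)) = G.tgt g :=
  G.tgt_mul _ _ (by rw [G.tgt_inv, hgh])

theorem eq_mul_inv {g h k : G₁} (hgh : G.src g = G.tgt h) (e : G.mul g h = k) :
    G.mul k (G.inv h) = g := by
  rw [← e, G.mul_inv_cancel_right hgh]

theorem mul_inv_mul_inv {g h k : G₁} (hg : G.src g = G.src h) (hk : G.src k = G.src h) :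
    G.mul (G.mul g (G.inv h)) (G.inv (G.mul k (G.inv h))) = G.mul g (G.inv k) := by
  have hs : G.src (G.mul g (G.inv k)) = G.tgt (G.mul k (G.inv h)) := by
    rw [G.src_mul_inv (hg.trans hk.symm), G.tgt_mul_inv hk]
  refine G.eq_mul_inv hs ?_
  have h1 : G.src k = G.tgt (G.inv h) := by rw [G.tgt_inv, hk]
  rw [← G.mul_assoc _ _ _ (G.src_mul_inv (hg.trans hk.symm)) h1,
    G.mul_inv_mul_cancel (hg.trans hk.symm)]

theorem continuous_src : Continuous G.src := G.etale_src.contMDiff.continuous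

theorem continuous_tgt : Continuous G.tgt := G.etale_tgt.contMDiff.continuous

/-- The local section of the source map through an arrow. -/
def sec (g : G₁) : G₀ → G₁ := (G.etale_src g).localInverse

theorem sec_src (g : G₁) : G.sec g (G.src g) = g :=
  (G.etale_src g).localInverse_left_inv (G.etale_src g).localInverse_mem_target

theorem eventually_src_sec (g : G₁) : ∀ᶠ x in 𝓝 (G.src g), G.src (G.sec g x) = x :=
  (G.etale_src g).localInverse_eventuallyEq_right

theorem eventually_sec_src (g : G₁) : ∀ᶠ h in 𝓝 g, G.sec g (G.src h) = h :=
  (G.etale_src g).localInverse_eventuallyEq_left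

theorem eventually_contMDiffAt_sec (g : G₁) :
    ∀ᶠ x in 𝓝 (G.src g), ContMDiffAt 𝓘(ℝ, E) 𝓘(ℝ, E) ∞ (G.sec g) x := by
  filter_upwards [(G.etale_src g).localInverse_open_source.mem_nhds
    (G.etale_src g).localInverse_mem_source] with x hx
  exact (G.etale_src g).localInverse_contMDiffOn.contMDiffAt
    ((G.etale_src g).localInverse_open_source.mem_nhds hx)

theorem continuousAt_sec (g : G₁) : ContinuousAt (G.sec g) (G.src g) :=
  (G.eventually_contMDiffAt_sec g).self_of_nhds.continuousAt

theorem tendsto_sec (g : G₁) : Tendsto (G.sec g) (𝓝 (G.src g)) (𝓝 g) := by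
  simpa [ContinuousAt, G.sec_src] using G.continuousAt_sec g

/-- The source map is locally injective, so a continuous lift through it is determined near a point
by its value there. The identities between germs of local sections below are instances of this. -/
theorem lift_unique {Y : Type*} [TopologicalSpace Y] {α β : Y → G₁} {y : Y}
    (hα : ContinuousAt α y) (hβ : ContinuousAt β y) (h : α y = β y)
    (hs : ∀ᶠ z in 𝓝 y, G.src (α z) = G.src (β z)) : α =ᶠ[𝓝 y] β := by
  have h1 := hα.eventually (G.eventually_sec_src (α y))
  have h2 := hβ.eventually (h ▸ G.eventually_sec_src (α y))
  filter_upwards [h1, h2, hs] with z hz hz' hz''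
  rw [← hz, ← hz', hz'', h]

theorem eventually_sec_sec (g : G₁) :
    ∀ᶠ x in 𝓝 (G.src g), G.sec (G.sec g x) =ᶠ[𝓝 x] G.sec g := by
  filter_upwards [G.eventually_contMDiffAt_sec g, (G.eventually_src_sec g).eventually_nhds]
    with x hx hx'
  have h0 : G.src (G.sec g x) = x := hx'.self_of_nhds
  have h1 := G.continuousAt_sec (G.sec g x)
  have h2 := G.eventually_src_sec (G.sec g x)
  have h3 := G.sec_src (G.sec g x)
  rw [h0] at h1 h2 h3
  refine G.lift_unique h1 hx.continuousAt h3 ?_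
  filter_upwards [h2, hx'] with z hz hw
  rw [hz, hw]

/-- The quotient of the local sections through two arrows with the same source. -/
def divSec (g h : G₁) : G₀ → G₁ := fun x => G.sec (G.mul g (G.inv h)) (G.tgt (G.sec h x))

section Div

variable {g h : G₁} (hgh : G.src g = G.src h)
include hgh

theorem divSec_src : G.divSec g h (G.src h) = G.mul g (G.inv h) := by
  rw [divSec, G.sec_src, ← G.src_mul_inv hgh, G.sec_src]

theorem tendsto_tgt_sec :
    Tendsto (fun x => G.tgt (G.sec h x)) (𝓝 (G.src h)) (𝓝 (G.src (G.mul g (G.inv h)))) := by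
  rw [G.src_mul_inv hgh]
  exact (G.continuous_tgt.tendsto h).comp (G.tendsto_sec h)

theorem eventually_src_divSec :
    ∀ᶠ x in 𝓝 (G.src h), G.src (G.divSec g h x) = G.tgt (G.sec h x) :=
  (G.tendsto_tgt_sec hgh).eventually (G.eventually_src_sec (G.mul g (G.inv h)))

theorem eventually_contMDiffAt_divSec :
    ∀ᶠ x in 𝓝 (G.src h), ContMDiffAt 𝓘(ℝ, E) 𝓘(ℝ, E) ∞ (G.divSec g h) x := by
  filter_upwards [(G.tendsto_tgt_sec hgh).eventually
    (G.eventually_contMDiffAt_sec (G.mul g (G.inv h))), G.eventually_contMDiffAt_sec h] with x hx hx'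
  exact hx.comp x ((G.etale_tgt.contMDiff _).comp x hx')

/-- The left side is the section through which the germ `[a]_{g h⁻¹} h` in the convolution product
is formed; the right side shows that it is the pointwise quotient of the sections through `g` and
`h`. They agree at the base point and have the same sources. -/
theorem eventually_divSec_eq :
    ∀ᶠ x in 𝓝 (G.src h), G.divSec g h x = G.mul (G.sec g x) (G.inv (G.sec h x)) := by
  have hg1 := G.eventually_src_sec g
  have hg2 := G.continuousAt_sec g
  rw [hgh] at hg1 hg2
  have hmem : ∀ᶠ x in 𝓝 (G.src h),
      (G.sec g x, G.inv (G.sec h x)) ∈ {p : G₁ × G₁ | G.src p.1 = G.tgt p.2} := by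
    filter_upwards [hg1, G.eventually_src_sec h] with x hx hx'
    rw [G.tgt_inv, hx, hx']
  refine G.lift_unique (G.eventually_contMDiffAt_divSec hgh).self_of_nhds.continuousAt ?_ ?_ ?_
  · have h1 := G.smooth_mul.continuousOn _ hmem.self_of_nhds
    refine Tendsto.comp h1 (tendsto_nhdsWithin_iff.2 ⟨?_, hmem⟩)
    exact hg2.prodMk (G.smooth_inv.continuous.continuousAt.comp (G.continuousAt_sec h))
  · rw [G.divSec_src hgh, G.sec_src, ← hgh, G.sec_src]
  · filter_upwards [hmem, G.eventually_src_divSec hgh] with x hx hx'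
    rw [hx', G.src_mul _ _ hx, G.src_inv]

theorem eventually_divSec_sec :
    ∀ᶠ x in 𝓝 (G.src h), G.divSec (G.sec g x) (G.sec h x) =ᶠ[𝓝 x] G.divSec g h := by
  have hg1 := G.eventually_src_sec g
  rw [hgh] at hg1
  filter_upwards [hg1, G.eventually_src_sec h, G.eventually_divSec_eq hgh,
    G.eventually_contMDiffAt_divSec hgh, (G.eventually_src_divSec hgh).eventually_nhds,
    G.eventually_sec_sec h] with x h1 h2 h3 h4 h5 h6
  have h7 : G.src (G.sec g x) = G.src (G.sec h x) := h1.trans h2.symm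
  have e1 := (G.eventually_contMDiffAt_divSec h7).self_of_nhds.continuousAt
  have e2 := G.eventually_src_divSec h7
  have e3 := G.divSec_src h7
  rw [h2] at e1 e2 e3
  refine G.lift_unique e1 h4.continuousAt (e3.trans h3.symm) ?_
  filter_upwards [e2, h5, h6] with z hz hz' hz''
  rw [hz, hz', hz'']

/-- This is `(g h⁻¹)(k h⁻¹)⁻¹ = g k⁻¹` on the level of sections; it matches the germs of the first
factor in the two bracketings of a triple product. -/
theorem eventually_divSec_divSec {k : G₁} (hk : G.src k = G.src h) :
    ∀ᶠ x in 𝓝 (G.src h),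
      G.divSec (G.mul g (G.inv h)) (G.mul k (G.inv h)) (G.tgt (G.sec h x)) = G.divSec g k x := by
  have hk1 := G.eventually_src_sec k
  rw [hk] at hk1
  filter_upwards [G.eventually_divSec_eq hk, hk1, G.eventually_src_sec h] with x hx hx' hx''
  rw [divSec, G.mul_inv_mul_inv hgh hk, divSec]
  change G.sec _ (G.tgt (G.divSec k h x)) = _
  rw [hx, G.tgt_mul_inv (hx'.trans hx''.symm)]

end Div

/-! ### The orbit space -/

/-- The saturation of an open set `V` is `t (s⁻¹ V)`, and the target map is open. -/
theorem isOpenQuotientMap_mk : IsOpenQuotientMap (Quotient.mk G.orbitSetoid) := by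
  refine ⟨Quotient.mk_surjective, continuous_quotient_mk', fun V hV => ?_⟩
  have : Quotient.mk G.orbitSetoid ⁻¹' (Quotient.mk G.orbitSetoid '' V) =
      G.tgt '' (G.src ⁻¹' V) := by
    ext x
    constructor
    · rintro ⟨y, hy, e⟩
      obtain ⟨g, hg, hg'⟩ := Quotient.exact e
      exact ⟨g, by rwa [mem_preimage, hg], hg'⟩
    · rintro ⟨g, hg, rfl⟩
      exact ⟨G.src g, hg, Quotient.sound ⟨g, rfl, rfl⟩⟩
  exact isOpen_coinduced.2 (this ▸ G.etale_tgt.isOpenMap _ (hV.preimage G.continuous_src))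

/-- The orbit relation is the range of the proper map `(s, t)`, hence closed, and the quotient map
is open. -/
theorem t2Space_orbit : T2Space G.Orbit := by
  rw [t2_iff_isClosed_diagonal]
  have : IsOpenQuotientMap (Prod.map (Quotient.mk G.orbitSetoid) (Quotient.mk G.orbitSetoid)) :=
    G.isOpenQuotientMap_mk.prodMap G.isOpenQuotientMap_mk
  rw [← this.isQuotientMap.isClosed_preimage]
  convert G.proper.isClosedMap.isClosed_range
  ext ⟨x, y⟩
  simp only [mem_preimage, Prod.map_apply, mem_diagonal_iff, mem_range, Prod.mk.injEq]
  rw [Quotient.eq]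
  rfl

theorem locallyCompactSpace_orbit [FiniteDimensional ℝ E] : LocallyCompactSpace G.Orbit :=
  have : LocallyCompactSpace G₀ := Manifold.locallyCompact_of_finiteDimensional 𝓘(ℝ, E)
  G.isOpenQuotientMap_mk.locallyCompactSpace

theorem continuous_proj : Continuous G.proj :=
  G.isOpenQuotientMap_mk.continuous.comp G.continuous_src

theorem isOpen_arrowsOver (U : Opens G.Orbit) : IsOpen (G.arrowsOver U) :=
  U.isOpen.preimage G.continuous_proj

theorem proj_eq_tgt (g : G₁) : G.proj g = Quotient.mk G.orbitSetoid (G.tgt g) :=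
  Quotient.sound ⟨g, rfl, rfl⟩

theorem proj_eq_of_src_eq {g h : G₁} (e : G.src g = G.src h) : G.proj g = G.proj h :=
  congrArg (Quotient.mk G.orbitSetoid) e

theorem proj_eq_of_src_eq_tgt {g h : G₁} (e : G.src g = G.tgt h) : G.proj g = G.proj h := by
  rw [G.proj_eq_tgt h, ← e]
  rfl

theorem proj_mul {g h : G₁} (e : G.src g = G.tgt h) : G.proj (G.mul g h) = G.proj h :=
  G.proj_eq_of_src_eq (G.src_mul g h e)

theorem proj_mul_inv {g h : G₁} (e : G.src g = G.src h) :
    G.proj (G.mul g (G.inv h)) = G.proj g := by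
  rw [G.proj_eq_of_src_eq_tgt (G.src_mul_inv e), G.proj_eq_of_src_eq e]

theorem proj_one (x : G₀) : G.proj (G.one x) = Quotient.mk G.orbitSetoid x := by
  rw [proj, G.src_one]

/-- Sets of arrows over `U` that are compact over compact sets of orbits. -/
def FibCompactSet (U : Opens G.Orbit) (L : Set G₁) : Prop :=
  L ⊆ G.arrowsOver U ∧ ∀ K ⊆ (U : Set G.Orbit), IsCompact K → IsCompact (L ∩ G.arrowsOver K)

variable {G} in
-- Local compactness of the orbit space makes a fibrewise compact set closed relative to the arrows
-- over `U`.
theorem FibCompactSet.eventually_notMem [FiniteDimensional ℝ E] [T2Space G₁] {U : Opens G.Orbit}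
    {L : Set G₁} (hL : G.FibCompactSet U L) {g : G₁} (hg : g ∈ G.arrowsOver U) (hgL : g ∉ L) :
    ∀ᶠ h in 𝓝 g, h ∉ L := by
  have := G.locallyCompactSpace_orbit
  obtain ⟨K, hK, hKU, hKc⟩ := local_compact_nhds (U.isOpen.mem_nhds hg)
  have h1 := (hL.2 K hKU hKc).isClosed.isOpen_compl.mem_nhds (show g ∉ _ from fun h => hgL h.1)
  filter_upwards [h1, G.continuous_proj.continuousAt hK] with h hh hh' hhL
  exact hh ⟨hhL, hh'⟩

variable {G} in
-- A source fibre of `L` is compact, and each local section through one of its arrows contains no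
-- other arrow of the fibre.
theorem FibCompactSet.finite_fibre {U : Opens G.Orbit} {L : Set G₁} (hL : G.FibCompactSet U L)
    (x : G₀) [T2Space G₀] : {h | h ∈ L ∧ G.src h = x}.Finite := by
  by_cases hx : Quotient.mk G.orbitSetoid x ∈ U
  · have hc : IsCompact {h | h ∈ L ∧ G.src h = x} := by
      have h1 := (hL.2 {Quotient.mk G.orbitSetoid x} (by simpa using hx) isCompact_singleton).inter_right
        (isClosed_singleton (x := x) |>.preimage G.continuous_src)
      convert h1 using 1
      ext h
      constructor
      · rintro ⟨h2, e⟩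
        exact ⟨⟨h2, congrArg (Quotient.mk G.orbitSetoid) e⟩, e⟩
      · rintro ⟨⟨h1, -⟩, h2⟩
        exact ⟨h1, h2⟩
    obtain ⟨t, ht, hcov⟩ := hc.elim_nhds_subcover (fun g => {h | G.sec g (G.src h) = h})
      fun g _ => G.eventually_sec_src g
    refine t.finite_toSet.subset fun h hh => ?_
    obtain ⟨g, hg, hgh⟩ := mem_iUnion₂.1 (hcov hh)
    have e : G.src h = G.src g := hh.2.trans (ht g hg).2.symm
    have : h = g := by rw [← G.sec_src g, ← e]; exact Eq.symm hgh
    exact this ▸ hg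
  · refine Set.Finite.subset finite_empty fun h hh => hx ?_
    have := hL.1 hh.1
    rw [arrowsOver, mem_preimage, proj, hh.2] at this
    exact this

variable {G} in
-- Over a compact neighbourhood of the orbit of `x`, the part of `L` outside the open union of local
-- sections through `H` is compact. Its image under the source map is closed and misses `x`, hence
-- misses all nearby points.
theorem FibCompactSet.eventually_eq_sec [FiniteDimensional ℝ E] [T2Space G₀] [T2Space G₁]
    {U : Opens G.Orbit}
    {L : Set G₁} (hL : G.FibCompactSet U L) {x : G₀} (hx : Quotient.mk G.orbitSetoid x ∈ U)
    {H : Set G₁} (hH : ∀ h ∈ L, G.src h = x → h ∈ H) :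
    ∀ᶠ y in 𝓝 x, ∀ h' ∈ L, G.src h' = y → ∃ h ∈ H, h' = G.sec h y := by
  have := G.locallyCompactSpace_orbit
  obtain ⟨K, hK, hKU, hKc⟩ := local_compact_nhds (U.isOpen.mem_nhds hx)
  let O : Set G₁ := ⋃ h ∈ H, interior {h' | G.sec h (G.src h') = h'}
  have hO : IsOpen O := isOpen_biUnion fun _ _ => isOpen_interior
  have hZ : IsCompact (G.src '' ((L ∩ G.arrowsOver K) \ O)) :=
    ((hL.2 K hKU hKc).diff hO).image G.continuous_src
  have hxZ : x ∉ G.src '' ((L ∩ G.arrowsOver K) \ O) := by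
    rintro ⟨h, ⟨⟨hhL, -⟩, hhO⟩, e⟩
    exact hhO (mem_biUnion (hH h hhL e) (mem_interior_iff_mem_nhds.2 (G.eventually_sec_src h)))
  filter_upwards [hZ.isClosed.isOpen_compl.mem_nhds hxZ,
    G.isOpenQuotientMap_mk.continuous.continuousAt hK] with y hy hyK h' hh' e
  by_cases hO' : h' ∈ O
  · obtain ⟨h, hh, hhO⟩ := mem_iUnion₂.1 hO'
    refine ⟨h, hh, ?_⟩
    have h1 : h' ∈ {k | G.sec h (G.src k) = k} := interior_subset hhO
    have h2 : G.sec h (G.src h') = h' := h1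
    rw [← e, h2]
  · refine absurd ⟨h', ⟨⟨hh', ?_⟩, hO'⟩, e⟩ hy
    rw [arrowsOver, mem_preimage, proj, e]
    exact hyK

end ProperEtaleLieGroupoid

end

noncomputable section

/-! ### The convolution product defined by a local star product -/

namespace ProperEtaleLieGroupoid

variable {E : Type*} [NormedAddCommGroup E] [NormedSpace ℝ E]
  {G₀ G₁ : Type*} [TopologicalSpace G₀] [ChartedSpace E G₀]
  [TopologicalSpace G₁] [ChartedSpace E G₁]
  (G : ProperEtaleLieGroupoid E G₀ G₁)
  {𝕜 : Type*} [RCLike 𝕜]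

/-- The convolution product of functions with values in formal power series. -/
def starConv (C : ℕ → (G₀ → 𝕜) → (G₀ → 𝕜) → G₀ → 𝕜) (a b : G₁ → PowerSeries 𝕜) (g : G₁) :
    PowerSeries 𝕜 :=
  ∑ᶠ p : G.Factor g, starOf C (G.act (G.germ a p.1.1) p.1.2) (G.germ b p.1.2) (G.src g)

/-- The contribution of an arrow `h` to the convolution product at `g`. -/
def convTerm (C : ℕ → (G₀ → 𝕜) → (G₀ → 𝕜) → G₀ → 𝕜) (a b : G₁ → PowerSeries 𝕜) (g h : G₁) :
    PowerSeries 𝕜 :=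
  starOf C (fun x => a (G.divSec g h x)) (fun x => b (G.sec h x)) (G.src g)

/-- Factorizations of `g` are given by their second factor, an arrow with the same source. -/
def factorEquiv (g : G₁) : G.Factor g ≃ {h // h ∈ {h | G.src h = G.src g}} where
  toFun p := ⟨p.1.2, by
    have := G.src_mul _ _ p.2.1
    rw [p.2.2] at this
    exact this.symm⟩
  invFun h := ⟨(G.mul g (G.inv h.1), h.1), G.src_mul_inv h.2.symm, G.mul_inv_mul_cancel h.2.symm⟩
  left_inv p := Subtype.ext (Prod.ext (G.eq_mul_inv p.2.1 p.2.2) rfl)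
  right_inv _ := rfl

theorem finsum_factor {R : Type*} [AddCommMonoid R] (g : G₁) (F : G₁ → G₁ → R) {H : Finset G₁}
    (hH : ∀ h ∈ H, G.src h = G.src g)
    (hH' : ∀ h, G.src h = G.src g → F (G.mul g (G.inv h)) h ≠ 0 → h ∈ H) :
    ∑ᶠ p : G.Factor g, F p.1.1 p.1.2 = ∑ h ∈ H, F (G.mul g (G.inv h)) h := by
  rw [← finsum_mem_eq_sum_of_subset (s := {h | G.src h = G.src g})
    (fun h => F (G.mul g (G.inv h)) h) (fun h hh => hH' h hh.1 hh.2) hH,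
    ← finsum_set_coe_eq_finsum_mem (f := fun h => F (G.mul g (G.inv h)) h)]
  refine finsum_eq_of_bijective (G.factorEquiv g) (G.factorEquiv g).bijective fun p => ?_
  change F p.1.1 p.1.2 = F (G.mul g (G.inv p.1.2)) p.1.2
  rw [G.eq_mul_inv p.2.1 p.2.2]

/-- `convTerm` is by definition the summand of the factorization with second factor `h`, whose first
factor must be `g h⁻¹`. The set `H` may be larger than needed. -/
theorem starConv_eq_sum (C : ℕ → (G₀ → 𝕜) → (G₀ → 𝕜) → G₀ → 𝕜) (a b : G₁ → PowerSeries 𝕜)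
    {g : G₁} {H : Finset G₁} (hH : ∀ h ∈ H, G.src h = G.src g)
    (hH' : ∀ h, G.src h = G.src g → G.convTerm C a b g h ≠ 0 → h ∈ H) :
    G.starConv C a b g = ∑ h ∈ H, G.convTerm C a b g h :=
  G.finsum_factor g (fun k h => starOf C (G.act (G.germ a k) h) (G.germ b h) (G.src g)) hH hH'

variable {C : ℕ → (G₀ → 𝕜) → (G₀ → 𝕜) → G₀ → 𝕜} {U : Opens G.Orbit}

/-- Formal power series of smooth functions on the arrows over `U`. -/
def RegularOn (U : Opens G.Orbit) (a : G₁ → PowerSeries 𝕜) : Prop :=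
  ∀ g ∈ G.arrowsOver U, SmoothGerm E a g

section Germs

variable {G} {a b : G₁ → PowerSeries 𝕜}

theorem RegularOn.sec (hb : G.RegularOn U b) {h : G₁} (hh : h ∈ G.arrowsOver U) :
    SmoothGerm E (fun x => b (G.sec h x)) (G.src h) := by
  refine SmoothGerm.comp ?_ (G.eventually_contMDiffAt_sec h)
  rw [G.sec_src]
  exact hb h hh

theorem mul_inv_mem_arrowsOver {g h : G₁} (hgh : G.src g = G.src h) (hg : g ∈ G.arrowsOver U) :
    G.mul g (G.inv h) ∈ G.arrowsOver U := by
  rw [arrowsOver, mem_preimage, G.proj_mul_inv hgh]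
  exact hg

theorem mem_arrowsOver_of_src_eq {g h : G₁} (hgh : G.src h = G.src g) (hg : g ∈ G.arrowsOver U) :
    h ∈ G.arrowsOver U := by
  rw [arrowsOver, mem_preimage, G.proj_eq_of_src_eq hgh]
  exact hg

theorem RegularOn.divSec (ha : G.RegularOn U a) {g h : G₁} (hgh : G.src g = G.src h)
    (hg : g ∈ G.arrowsOver U) : SmoothGerm E (fun x => a (G.divSec g h x)) (G.src h) := by
  refine SmoothGerm.comp ?_ (G.eventually_contMDiffAt_divSec hgh)
  rw [G.divSec_src hgh]
  exact ha _ (mul_inv_mem_arrowsOver hgh hg)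

theorem eventuallyEq_sec {R : Type*} {b b' : G₁ → R} {h : G₁} (hb : b =ᶠ[𝓝 h] b') :
    (fun x => b (G.sec h x)) =ᶠ[𝓝 (G.src h)] fun x => b' (G.sec h x) :=
  (G.tendsto_sec h).eventually hb

theorem eventuallyEq_divSec {R : Type*} {a a' : G₁ → R} {g h : G₁} (hgh : G.src g = G.src h)
    (ha : a =ᶠ[𝓝 (G.mul g (G.inv h))] a') :
    (fun x => a (G.divSec g h x)) =ᶠ[𝓝 (G.src h)] fun x => a' (G.divSec g h x) := by
  have h1 := (G.eventually_contMDiffAt_divSec hgh).self_of_nhds.continuousAt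
  rw [ContinuousAt, G.divSec_src hgh] at h1
  exact h1.eventually ha

/-- A finite set of arrows with the same source as `g` that contains a fibre of a given set. -/
theorem exists_fibre {L : Set G₁} (hL : G.FibCompactSet U L) [T2Space G₀] (x : G₀) :
    ∃ H : Finset G₁, (∀ h ∈ H, G.src h = x) ∧ ∀ h ∈ L, G.src h = x → h ∈ H :=
  ⟨(hL.finite_fibre x).toFinset, fun h hh => by simp at hh; exact hh.2,
    fun h hh e => by simp [hh, e]⟩

end Germs

/-! ### The convolution product as a locally finite sum of star products of germs. -/

section Product

variable [IsManifold 𝓘(ℝ, E) ∞ G₀] (hC : ∀ k, IsBidiffOp E (C k)) {G}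
  {a b : G₁ → PowerSeries 𝕜}
include hC

theorem convTerm_eq_zero_left (hb : G.RegularOn U b) {g h : G₁} (hgh : G.src h = G.src g)
    (hg : g ∈ G.arrowsOver U) (h0 : ∀ᶠ k in 𝓝 (G.mul g (G.inv h)), a k = 0) :
    G.convTerm C a b g h = 0 := by
  have h1 := eventuallyEq_divSec (a' := fun _ => 0) hgh.symm h0
  have h2 := hb.sec (mem_arrowsOver_of_src_eq hgh hg)
  rw [convTerm, ← hgh, starOf_congr hC ((SmoothGerm.const 0).congr h1.symm) h2 h1 .rfl,
    starOf_zero_left hC h2]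

theorem convTerm_eq_zero_right (ha : G.RegularOn U a) {g h : G₁} (hgh : G.src h = G.src g)
    (hg : g ∈ G.arrowsOver U) (h0 : ∀ᶠ k in 𝓝 h, b k = 0) : G.convTerm C a b g h = 0 := by
  have h1 := eventuallyEq_sec (G := G) (b' := fun _ => 0) h0
  have h2 := ha.divSec hgh.symm hg
  rw [convTerm, ← hgh, starOf_congr hC h2 ((SmoothGerm.const 0).congr h1.symm) .rfl h1,
    starOf_zero_right hC h2]

variable [FiniteDimensional ℝ E] [T2Space G₁]

theorem mem_of_convTerm_ne_zero (ha : G.RegularOn U a) (hb : G.RegularOn U b) {L L' : Set G₁}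
    (hL : G.FibCompactSet U L) (hL' : G.FibCompactSet U L') (haL : support a ⊆ L)
    (hbL : support b ⊆ L') {g h : G₁} (hgh : G.src h = G.src g) (hg : g ∈ G.arrowsOver U)
    (h0 : G.convTerm C a b g h ≠ 0) : G.mul g (G.inv h) ∈ L ∧ h ∈ L' := by
  constructor
  · by_contra hn
    refine h0 (convTerm_eq_zero_left hC hb hgh hg ?_)
    filter_upwards [hL.eventually_notMem (mul_inv_mem_arrowsOver hgh.symm hg) hn] with k hk
    exact notMem_support.1 fun hk' => hk (haL hk')
  · by_contra hn
    refine h0 (convTerm_eq_zero_right hC ha hgh hg ?_)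
    filter_upwards [hL'.eventually_notMem (mem_arrowsOver_of_src_eq hgh hg) hn] with k hk
    exact notMem_support.1 fun hk' => hk (hbL hk')

theorem mem_right_of_convTerm_ne_zero (ha : G.RegularOn U a) {L : Set G₁}
    (hL : G.FibCompactSet U L)
    (hbL : support b ⊆ L) {g h : G₁} (hgh : G.src h = G.src g) (hg : g ∈ G.arrowsOver U)
    (h0 : G.convTerm C a b g h ≠ 0) : h ∈ L := by
  by_contra hn
  refine h0 (convTerm_eq_zero_right hC ha hgh hg ?_)
  filter_upwards [hL.eventually_notMem (mem_arrowsOver_of_src_eq hgh hg) hn] with k hk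
  exact notMem_support.1 fun hk' => hk (hbL hk')

theorem starConv_eq_sum_of_support (ha : G.RegularOn U a) {L : Set G₁} (hL : G.FibCompactSet U L)
    (hbL : support b ⊆ L) {g : G₁} (hg : g ∈ G.arrowsOver U) {H : Finset G₁}
    (hH : ∀ h ∈ H, G.src h = G.src g) (hH' : ∀ h ∈ L, G.src h = G.src g → h ∈ H) :
    G.starConv C a b g = ∑ h ∈ H, G.convTerm C a b g h :=
  G.starConv_eq_sum C a b hH fun h e h0 =>
    hH' h (mem_right_of_convTerm_ne_zero hC ha hL hbL e hg h0) e

theorem support_starConv (ha : G.RegularOn U a) (hb : G.RegularOn U b) {L L' : Set G₁}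
    (hL : G.FibCompactSet U L) (hL' : G.FibCompactSet U L') (haL : support a ⊆ L)
    (hbL : support b ⊆ L') {g : G₁} (hg : g ∈ G.arrowsOver U) (h0 : G.starConv C a b g ≠ 0) :
    ∃ k ∈ L, ∃ h ∈ L', G.src k = G.tgt h ∧ G.mul k h = g := by
  by_contra! hn
  refine h0 ?_
  rw [G.starConv_eq_sum C a b (H := ∅) (by simp), Finset.sum_empty]
  intro h e h1
  obtain ⟨h2, h3⟩ := mem_of_convTerm_ne_zero hC ha hb hL hL' haL hbL e hg h1
  exact absurd (G.mul_inv_mul_cancel e.symm) (hn _ h2 h h3 (G.src_mul_inv e.symm))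

variable [T2Space G₀]

/-- The arrows over `x` that can contribute are the values at `x` of the sections through `H`; by
the Hausdorff property they remain distinct near `src g`. The neighbourhood depends only on `L`, `g`
and `H`, not on `a` and `b`, so the formula applies to a whole sequence at once. -/
theorem eventually_starConv {L : Set G₁} (hL : G.FibCompactSet U L) {g : G₁}
    (hg : g ∈ G.arrowsOver U) {H : Finset G₁} (hH : ∀ h ∈ H, G.src h = G.src g)
    (hH' : ∀ h ∈ L, G.src h = G.src g → h ∈ H) :
    ∀ᶠ x in 𝓝 (G.src g), ∀ a b : G₁ → PowerSeries 𝕜, G.RegularOn U a → G.RegularOn U b →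
      support b ⊆ L → G.starConv C a b (G.sec g x) =
        ∑ h ∈ H, starOf C (fun y => a (G.divSec g h y)) (fun y => b (G.sec h y)) x := by
  classical
  have hinj : ∀ᶠ x in 𝓝 (G.src g), ∀ h ∈ H, ∀ h' ∈ H, h ≠ h' → G.sec h x ≠ G.sec h' x := by
    rw [Filter.eventually_all_finset]
    intro h hh
    rw [Filter.eventually_all_finset]
    intro h' hh'
    by_cases e : h = h'
    · simp [e]
    · have h1 := G.tendsto_sec h
      have h2 := G.tendsto_sec h'
      rw [hH h hh] at h1
      rw [hH h' hh'] at h2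
      exact ((h1.prodMk_nhds h2).eventually (isClosed_diagonal.isOpen_compl.mem_nhds e)).mono
        fun x hx _ => hx
  have hsec : ∀ᶠ x in 𝓝 (G.src g), ∀ h ∈ H, G.src (G.sec h x) = x ∧
      G.sec (G.sec h x) =ᶠ[𝓝 x] G.sec h ∧
      G.divSec (G.sec g x) (G.sec h x) =ᶠ[𝓝 x] G.divSec g h := by
    rw [Filter.eventually_all_finset]
    intro h hh
    have h1 := G.eventually_src_sec h
    have h2 := G.eventually_sec_sec h
    have h3 := G.eventually_divSec_sec (hH h hh).symm
    rw [hH h hh] at h1 h2 h3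
    exact h1.and (h2.and h3)
  have hopen : ∀ᶠ x in 𝓝 (G.src g), Quotient.mk G.orbitSetoid x ∈ U :=
    G.isOpenQuotientMap_mk.continuous.continuousAt (U.isOpen.mem_nhds hg)
  filter_upwards [hinj, hsec, hopen, G.eventually_src_sec g, hL.eventually_eq_sec hg hH']
    with x hx1 hx2 hx3 hx4 hx5 a b ha hb hbL
  have hgx : G.sec g x ∈ G.arrowsOver U := by
    rw [arrowsOver, mem_preimage, proj, hx4]
    exact hx3
  rw [starConv_eq_sum_of_support hC ha hL hbL hgx (H := H.image fun h => G.sec h x)]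
  · rw [Finset.sum_image fun h hh h' hh' e => by_contra fun hne => hx1 h hh h' hh' hne e]
    refine Finset.sum_congr rfl fun h hh => ?_
    obtain ⟨e1, e2, e3⟩ := hx2 h hh
    have e4 : G.src (G.sec g x) = G.src (G.sec h x) := hx4.trans e1.symm
    have s1 := ha.divSec e4 hgx
    have s2 := hb.sec (mem_arrowsOver_of_src_eq e4.symm hgx)
    rw [e1] at s1 s2
    rw [convTerm, hx4]
    exact starOf_congr hC s1 s2 (e3.fun_comp a) (e2.fun_comp b)
  · intro h' hh'
    obtain ⟨h, hh, rfl⟩ := Finset.mem_image.1 hh'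
    rw [(hx2 h hh).1, hx4]
  · intro h' hh' e
    obtain ⟨h, hh, rfl⟩ := hx5 h' hh' (e.trans hx4)
    exact Finset.mem_image.2 ⟨h, hh, rfl⟩

theorem eventuallyEq_starConv {L : Set G₁} (hL : G.FibCompactSet U L) (ha : G.RegularOn U a)
    (hb : G.RegularOn U b) (hbL : support b ⊆ L) {g : G₁}
    (hg : g ∈ G.arrowsOver U) {H : Finset G₁} (hH : ∀ h ∈ H, G.src h = G.src g)
    (hH' : ∀ h ∈ L, G.src h = G.src g → h ∈ H) :
    (fun x => G.starConv C a b (G.sec g x)) =ᶠ[𝓝 (G.src g)] fun x =>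
        ∑ h ∈ H, starOf C (fun y => a (G.divSec g h y)) (fun y => b (G.sec h y)) x :=
  (eventually_starConv hC hL hg hH hH').mono fun _ hx => hx a b ha hb hbL

theorem regularOn_starConv {L : Set G₁} (hL : G.FibCompactSet U L) (ha : G.RegularOn U a)
    (hb : G.RegularOn U b) (hbL : support b ⊆ L) : G.RegularOn U (G.starConv C a b) := by
  intro g hg
  obtain ⟨H, hH, hH'⟩ := exists_fibre hL (G.src g)
  have h1 : SmoothGerm E (fun x => G.starConv C a b (G.sec g x)) (G.src g) := by
    refine SmoothGerm.congr (SmoothGerm.sum fun h hh => ?_)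
      (eventuallyEq_starConv hC hL ha hb hbL hg hH hH').symm
    have s1 := ha.divSec (hH h hh).symm hg
    have s2 := hb.sec (mem_arrowsOver_of_src_eq (hH h hh) hg)
    rw [hH h hh] at s1 s2
    exact smoothGerm_starOf hC s1 s2
  refine (SmoothGerm.comp h1 (.of_forall G.etale_src.contMDiff)).congr ?_
  exact (G.eventually_sec_src g).mono fun k hk => congrArg _ hk

theorem unifSmoothNear_starConv {L : Set G₁} (hL : G.FibCompactSet U L)
    {a b : ℕ → G₁ → PowerSeries 𝕜} (ha : ∀ n, G.RegularOn U (a n))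
    (hb : ∀ n, G.RegularOn U (b n)) (hbL : ∀ n, support (b n) ⊆ L)
    (ha' : ∀ g ∈ G.arrowsOver U, ∀ l, UnifSmoothNear E (fun n => coeffFun l (a n)) g)
    (hb' : ∀ g ∈ G.arrowsOver U, ∀ l, UnifSmoothNear E (fun n => coeffFun l (b n)) g)
    {g : G₁} (hg : g ∈ G.arrowsOver U) (l : ℕ) :
    UnifSmoothNear E (fun n => coeffFun l (G.starConv C (a n) (b n))) g := by
  obtain ⟨H, hH, hH'⟩ := exists_fibre hL (G.src g)
  have h1 : UnifSmoothNear E (fun n x => coeffFun l (G.starConv C (a n) (b n)) (G.sec g x))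
      (G.src g) := by
    refine UnifSmoothNear.congr (UnifSmoothNear.sum (s := H) (f := fun h n => coeffFun l
      (starOf C (fun y => a n (G.divSec g h y)) (fun y => b n (G.sec h y)))) fun h hh => ?_) ?_
    · have hgh := (hH h hh).symm
      refine unifSmoothNear_starOf hC (fun m => ?_) (fun m => ?_) l
      · rw [hgh]
        refine UnifSmoothNear.comp (f := fun n => coeffFun m (a n)) ?_
          (G.eventually_contMDiffAt_divSec hgh)
        rw [G.divSec_src hgh]
        exact ha' _ (mul_inv_mem_arrowsOver hgh hg) m
      · rw [hgh]
        refine UnifSmoothNear.comp (f := fun n => coeffFun m (b n)) ?_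
          (G.eventually_contMDiffAt_sec h)
        rw [G.sec_src]
        exact hb' _ (mem_arrowsOver_of_src_eq hgh.symm hg) m
    · filter_upwards [eventually_starConv hC hL hg hH hH'] with x hx n
      simp only [coeffFun, hx (a n) (b n) (ha n) (hb n) (hbL n), map_sum]
  refine (UnifSmoothNear.comp h1 (.of_forall G.etale_src.contMDiff)).congr ?_
  exact (G.eventually_sec_src g).mono fun k hk n => by simp only [hk]

theorem starConv_add_smul_left {L : Set G₁} (hL : G.FibCompactSet U L)
    {a' : G₁ → PowerSeries 𝕜} (c : 𝕜) (ha : G.RegularOn U a)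
    (ha' : G.RegularOn U a') (hb : G.RegularOn U b) (hbL : support b ⊆ L) {g : G₁}
    (hg : g ∈ G.arrowsOver U) :
    G.starConv C (a + c • a') b g = G.starConv C a b g + c • G.starConv C a' b g := by
  obtain ⟨H, hH, hH'⟩ := exists_fibre hL (G.src g)
  change G.starConv C (fun k => a k + c • a' k) b g = _
  rw [starConv_eq_sum_of_support hC (fun k hk => (ha k hk).add_smul (ha' k hk) c) hL hbL hg hH hH',
    starConv_eq_sum_of_support hC ha hL hbL hg hH hH',
    starConv_eq_sum_of_support hC ha' hL hbL hg hH hH', Finset.smul_sum,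
    ← Finset.sum_add_distrib]
  refine Finset.sum_congr rfl fun h hh => ?_
  have s1 := ha.divSec (hH h hh).symm hg
  have s2 := ha'.divSec (hH h hh).symm hg
  have s3 := hb.sec (mem_arrowsOver_of_src_eq (hH h hh) hg)
  rw [hH h hh] at s1 s2 s3
  exact starOf_add_smul_left hC c s1 s2 s3

theorem starConv_add_smul_right {L : Set G₁} (hL : G.FibCompactSet U L)
    {b' : G₁ → PowerSeries 𝕜} (c : 𝕜) (ha : G.RegularOn U a)
    (hb : G.RegularOn U b) (hb' : G.RegularOn U b') (hbL : support b ⊆ L)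
    (hbL' : support b' ⊆ L) {g : G₁} (hg : g ∈ G.arrowsOver U) :
    G.starConv C a (b + c • b') g = G.starConv C a b g + c • G.starConv C a b' g := by
  obtain ⟨H, hH, hH'⟩ := exists_fibre hL (G.src g)
  have hs : support (b + c • b') ⊆ L := (support_add _ _).trans
    (union_subset hbL ((support_const_smul_subset c b').trans hbL'))
  rw [starConv_eq_sum_of_support hC ha hL hs hg hH hH',
    starConv_eq_sum_of_support hC ha hL hbL hg hH hH',
    starConv_eq_sum_of_support hC ha hL hbL' hg hH hH', Finset.smul_sum,
    ← Finset.sum_add_distrib]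
  refine Finset.sum_congr rfl fun h hh => ?_
  have s1 := ha.divSec (hH h hh).symm hg
  have s2 := hb.sec (mem_arrowsOver_of_src_eq (hH h hh) hg)
  have s3 := hb'.sec (mem_arrowsOver_of_src_eq (hH h hh) hg)
  rw [hH h hh] at s1 s2 s3
  exact starOf_add_smul_right hC c s1 s2 s3

end Product

/-- Invariance of a star product under the action of the arrows on germs. -/
def InvariantOps (C : ℕ → (G₀ → 𝕜) → (G₀ → 𝕜) → G₀ → 𝕜) : Prop :=
  ∀ k g f h, SmoothNear E f (G.tgt g) → SmoothNear E h (G.tgt g) →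
    C k (G.act f g) (G.act h g) (G.src g) = C k f h (G.tgt g)

variable {G}

theorem InvariantOps.star_eq (hI : G.InvariantOps C) {g : G₁} {f h : G₀ → PowerSeries 𝕜}
    (hf : SmoothGerm E f (G.tgt g)) (hh : SmoothGerm E h (G.tgt g)) :
    starOf C (fun x => f (G.tgt (G.sec g x))) (fun x => h (G.tgt (G.sec g x))) (G.src g) =
      starOf C f h (G.tgt g) := by
  ext n
  rw [coeff_starOf, coeff_starOf]
  exact Finset.sum_congr rfl fun q _ => Finset.sum_congr rfl fun r _ =>
    hI q.1 g _ _ (hf.coeff r.1) (hh.coeff r.2)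

/-- Invariance is a statement at one arrow; applying it at every arrow `sec g x` near `g` yields an
equality of germs, which can then be starred with a third factor. -/
theorem InvariantOps.starOf_eventuallyEq [IsManifold 𝓘(ℝ, E) ∞ G₀]
    (hC : ∀ k, IsBidiffOp E (C k)) (hI : G.InvariantOps C) {g : G₁} {f h : G₀ → PowerSeries 𝕜}
    (hf : SmoothGerm E f (G.tgt g)) (hh : SmoothGerm E h (G.tgt g)) :
    (fun x => starOf C f h (G.tgt (G.sec g x))) =ᶠ[𝓝 (G.src g)]
      starOf C (fun x => f (G.tgt (G.sec g x))) (fun x => h (G.tgt (G.sec g x))) := by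
  have ht : Tendsto (fun x => G.tgt (G.sec g x)) (𝓝 (G.src g)) (𝓝 (G.tgt g)) :=
    (G.continuous_tgt.tendsto g).comp (G.tendsto_sec g)
  filter_upwards [ht.eventually hf.eventually, ht.eventually hh.eventually,
    G.eventually_sec_sec g, G.eventually_src_sec g] with x h1 h2 h3 h4
  rw [← hI.star_eq h1 h2, h4]
  have e : ∀ F : G₀ → PowerSeries 𝕜, (fun y => F (G.tgt (G.sec (G.sec g x) y))) =ᶠ[𝓝 x]
      fun y => F (G.tgt (G.sec g y)) := fun F => h3.fun_comp (fun k => F (G.tgt k))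
  have hs : ∀ᶠ y in 𝓝 x, ContMDiffAt 𝓘(ℝ, E) 𝓘(ℝ, E) ∞
      (fun y => G.tgt (G.sec (G.sec g x) y)) y := by
    have := G.eventually_contMDiffAt_sec (G.sec g x)
    rw [h4] at this
    exact this.mono fun y hy => (G.etale_tgt.contMDiff _).comp y hy
  have e2 : G.tgt (G.sec (G.sec g x) x) = G.tgt (G.sec g x) := by
    rw [h3.self_of_nhds]
  exact starOf_congr hC (SmoothGerm.comp (φ := fun y => G.tgt (G.sec (G.sec g x) y))
    (by rw [e2]; exact h1) hs)
    (SmoothGerm.comp (φ := fun y => G.tgt (G.sec (G.sec g x) y)) (by rw [e2]; exact h2) hs)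
    (e f) (e h)

/-- Both bracketings become double sums over the same finite sets of triple star products, with `a`
at `g k⁻¹`, `b` at `k h⁻¹` and `c` at `h`; associativity on germs compares them termwise. Invariance
is needed on the left, where the inner product is computed at `tgt h` and transported to `src h`.
The products `ab` and `bc` are prescribed only over `U`, because sections are extended by zero. -/
theorem starConv_assoc [IsManifold 𝓘(ℝ, E) ∞ G₀] [FiniteDimensional ℝ E] [T2Space G₀] [T2Space G₁]
    (hC : IsLocalStar E C) (hI : G.InvariantOps C) {a b c : G₁ → PowerSeries 𝕜}
    (ha : G.RegularOn U a) (hb : G.RegularOn U b) (hc : G.RegularOn U c) {Lb Lc L : Set G₁}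
    (hLb : G.FibCompactSet U Lb) (hLc : G.FibCompactSet U Lc) (hL : G.FibCompactSet U L)
    (hbL : support b ⊆ Lb) (hcL : support c ⊆ Lc) {bc : G₁ → PowerSeries 𝕜}
    {ab : G₁ → PowerSeries 𝕜} (hab : EqOn ab (G.starConv C a b) (G.arrowsOver U))
    (hbc : EqOn bc (G.starConv C b c) (G.arrowsOver U)) (hbcL : support bc ⊆ L) {g : G₁}
    (hg : g ∈ G.arrowsOver U) : G.starConv C ab c g = G.starConv C a bc g := by
  classical
  have hB := hC.bidiff
  have hUo := G.isOpen_arrowsOver U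
  have hab' : ∀ k ∈ G.arrowsOver U, ab =ᶠ[𝓝 k] G.starConv C a b := fun k hk =>
    hab.eventuallyEq_of_mem (hUo.mem_nhds hk)
  have hbc' : ∀ k ∈ G.arrowsOver U, bc =ᶠ[𝓝 k] G.starConv C b c := fun k hk =>
    hbc.eventuallyEq_of_mem (hUo.mem_nhds hk)
  have rab : G.RegularOn U ab := fun k hk =>
    (regularOn_starConv hB hLb ha hb hbL k hk).congr (hab' k hk).symm
  have rbc : G.RegularOn U bc := fun k hk =>
    (regularOn_starConv hB hLc hb hc hcL k hk).congr (hbc' k hk).symm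
  obtain ⟨H, hH, hH'⟩ := exists_fibre hLc (G.src g)
  choose J hJ hJ' using fun h => exists_fibre hLb (G.tgt h)
  obtain ⟨K₀, hK₀, hK₀'⟩ := exists_fibre hL (G.src g)
  -- Large enough for both sides: `K₀` contains the fibre of a support of `bc`, and the products `k
  -- h` cover the arrows that the inner products on the left require.
  let K : Finset G₁ := K₀ ∪ H.biUnion fun h => (J h).image fun k => G.mul k h
  have hK : ∀ k ∈ K, G.src k = G.src g := by
    intro k hk
    rcases Finset.mem_union.1 hk with h1 | h1
    · exact hK₀ k h1
    · obtain ⟨h, hh, h2⟩ := Finset.mem_biUnion.1 h1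
      obtain ⟨j, hj, rfl⟩ := Finset.mem_image.1 h2
      rw [G.src_mul _ _ (hJ h j hj), hH h hh]
  have hW : ∀ {k}, G.src k = G.src g → k ∈ G.arrowsOver U := fun e =>
    mem_arrowsOver_of_src_eq e hg
  -- germs of the three factors at the source of `g`
  have sa : ∀ k ∈ K, SmoothGerm E (fun x => a (G.divSec g k x)) (G.src g) := fun k hk => by
    have := ha.divSec (hK k hk).symm hg
    rwa [hK k hk] at this
  have sb : ∀ k ∈ K, ∀ h ∈ H, SmoothGerm E (fun x => b (G.divSec k h x)) (G.src g) :=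
    fun k hk h hh => by
      have := hb.divSec ((hK k hk).trans (hH h hh).symm) (hW (hK k hk))
      rwa [hH h hh] at this
  have sc : ∀ h ∈ H, SmoothGerm E (fun x => c (G.sec h x)) (G.src g) := fun h hh => by
    have := hc.sec (hW (hH h hh))
    rwa [hH h hh] at this
  have left : G.starConv C ab c g = ∑ h ∈ H, ∑ k ∈ K, starOf C
      (starOf C (fun x => a (G.divSec g k x))
        (fun x => b (G.divSec k h x))) (fun x => c (G.sec h x)) (G.src g) := by
    rw [starConv_eq_sum_of_support hB rab hLc hcL hg hH hH']
    refine Finset.sum_congr rfl fun h hh => ?_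
    have egh : G.src g = G.src h := (hH h hh).symm
    rw [← starOf_sum_left hB (fun k hk => smoothGerm_starOf hB (sa k hk) (sb k hk h hh)) (sc h hh)]
    have s1 := rab.divSec egh hg
    rw [← egh] at s1
    refine starOf_congr hB s1 (sc h hh) ?_ .rfl
    have hgh : G.mul g (G.inv h) ∈ G.arrowsOver U := mul_inv_mem_arrowsOver egh hg
    have e1 := eventuallyEq_divSec egh (hab' _ hgh)
    rw [← egh] at e1
    refine e1.trans ?_
    -- the finite set of arrows `k h⁻¹`
    have hinj : ∀ k ∈ K, ∀ k' ∈ K, G.mul k (G.inv h) = G.mul k' (G.inv h) → k = k' := by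
      intro k hk k' hk' e
      rw [← G.mul_inv_mul_cancel ((hK k hk).trans egh), e,
        G.mul_inv_mul_cancel ((hK k' hk').trans egh)]
    have e2 := eventuallyEq_starConv hB hLb ha hb hbL hgh
      (H := K.image fun k => G.mul k (G.inv h)) (fun j hj => by
        obtain ⟨k, hk, rfl⟩ := Finset.mem_image.1 hj
        rw [G.src_mul_inv ((hK k hk).trans egh), G.src_mul_inv egh])
      (fun j hj e => by
        rw [G.src_mul_inv egh] at e
        refine Finset.mem_image.2 ⟨G.mul j h, Finset.mem_union_right _ (Finset.mem_biUnion.2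
          ⟨h, hh, Finset.mem_image.2 ⟨j, hJ' h j hj e, rfl⟩⟩), ?_⟩
        exact G.mul_inv_cancel_right e)
    have ht := G.tendsto_tgt_sec egh
    rw [← egh] at ht
    refine EventuallyEq.trans (ht.eventually e2) ?_
    simp only [Finset.sum_image hinj]
    -- Invariance moves the inner star product from `tgt (sec h x)` back to `x`, and the quotient
    -- identity for sections rewrites the germ of `a` independently of `h`.
    have e3 : ∀ k ∈ K, ∀ᶠ x in 𝓝 (G.src g),
        starOf C
          (fun y => a (G.divSec (G.mul g (G.inv h)) (G.mul k (G.inv h)) y))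
          (fun y => b (G.sec (G.mul k (G.inv h)) y)) (G.tgt (G.sec h x)) =
        starOf C (fun x => a (G.divSec g k x))
          (fun x => b (G.divSec k h x)) x := by
      intro k hk
      have ekh : G.src k = G.src h := (hK k hk).trans egh
      have e5 : G.src (G.mul g (G.inv h)) = G.src (G.mul k (G.inv h)) := by
        rw [G.src_mul_inv egh, G.src_mul_inv ekh]
      have t1 := ha.divSec e5 hgh
      have t2 := hb.sec (mul_inv_mem_arrowsOver ekh (hW (hK k hk)))
      rw [G.src_mul_inv ekh] at t1 t2
      have e4 := hI.starOf_eventuallyEq hB t1 t2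
      have e6 := (G.eventually_divSec_divSec egh ekh).mono fun x hx => congrArg a hx
      rw [← egh] at e4 e6
      refine e4.trans ?_
      exact (starOf_eventuallyEq hB (sa k hk) (sb k hk h hh) (EventuallyEq.symm e6) .rfl).symm
    filter_upwards [(Filter.eventually_all_finset K).2 e3] with x hx
    exact Finset.sum_congr rfl hx
  have right : G.starConv C a bc g = ∑ k ∈ K, ∑ h ∈ H, starOf C
      (fun x => a (G.divSec g k x)) (starOf C
        (fun x => b (G.divSec k h x)) (fun x => c (G.sec h x))) (G.src g) := by
    rw [starConv_eq_sum_of_support hB ha hL hbcL hg hK fun k hk e =>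
      Finset.mem_union_left _ (hK₀' k hk e)]
    refine Finset.sum_congr rfl fun k hk => ?_
    rw [← starOf_sum_right hB (sa k hk) fun h hh => smoothGerm_starOf hB (sb k hk h hh) (sc h hh)]
    have s1 := rbc.sec (hW (hK k hk))
    rw [hK k hk] at s1
    refine starOf_congr hB (sa k hk) s1 .rfl ?_
    have e1 := eventuallyEq_sec (G := G) (hbc' k (hW (hK k hk)))
    have e2 := eventuallyEq_starConv hB hLc hb hc hcL (hW (hK k hk)) (H := H)
      (fun h hh => (hH h hh).trans (hK k hk).symm) (fun h hh e => hH' h hh (e.trans (hK k hk)))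
    rw [hK k hk] at e1 e2
    exact e1.trans e2
  rw [left, right, Finset.sum_comm]
  exact Finset.sum_congr rfl fun k hk => Finset.sum_congr rfl fun h hh =>
    hC.assoc_germ (sa k hk) (sb k hk h hh) (sc h hh)

end ProperEtaleLieGroupoid

end

noncomputable section

/-! ### Functions supported on the units -/

namespace ProperEtaleLieGroupoid

variable {E : Type*} [NormedAddCommGroup E] [NormedSpace ℝ E]
  {G₀ G₁ : Type*} [TopologicalSpace G₀] [ChartedSpace E G₀]
  [TopologicalSpace G₁] [ChartedSpace E G₁]
  (G : ProperEtaleLieGroupoid E G₀ G₁)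
  {𝕜 : Type*} [RCLike 𝕜]

theorem inv_one (x : G₀) : G.inv (G.one x) = G.one x := by
  have h1 := G.one_mul (G.inv (G.one x))
  rw [G.tgt_inv, G.src_one, G.mul_inv, G.tgt_one] at h1
  exact h1.symm

theorem eventually_eq_one {g : G₁} (hg : g = G.one (G.src g)) :
    ∀ᶠ k in 𝓝 g, k = G.one (G.src k) :=
  G.lift_unique continuousAt_id
    (G.smooth_one.continuous.comp G.continuous_src).continuousAt hg
    (.of_forall fun k => (G.src_one (G.src k)).symm)

theorem eventually_ne_one [T2Space G₁] {g : G₁} (hg : g ≠ G.one (G.src g)) :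
    ∀ᶠ k in 𝓝 g, k ≠ G.one (G.src k) :=
  (isClosed_eq continuous_id
    (G.smooth_one.continuous.comp G.continuous_src)).isOpen_compl.mem_nhds hg

theorem eventually_sec_one (x : G₀) : ∀ᶠ y in 𝓝 x, G.sec (G.one x) y = G.one y := by
  have h1 := G.continuousAt_sec (G.one x)
  have h2 := G.eventually_src_sec (G.one x)
  have h3 := G.sec_src (G.one x)
  rw [G.src_one] at h1 h2 h3
  refine G.lift_unique h1 G.smooth_one.continuous.continuousAt h3 ?_
  filter_upwards [h2] with y hy
  rw [hy, G.src_one]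

open Classical in
/-- The extension by zero of a function on the objects, which are identified with the units. -/
def unitFun (v : G₀ → 𝕜) : G₁ → PowerSeries 𝕜 :=
  fun g => if g = G.one (G.src g) then PowerSeries.C (v (G.src g)) else 0

theorem unitFun_one (v : G₀ → 𝕜) (x : G₀) : G.unitFun v (G.one x) = PowerSeries.C (v x) := by
  rw [unitFun, if_pos (by rw [G.src_one]), G.src_one]

theorem unitFun_of_ne (v : G₀ → 𝕜) {g : G₁} (hg : g ≠ G.one (G.src g)) : G.unitFun v g = 0 :=
  if_neg hg

theorem unitFun_sum (s : Finset ℕ) (v : ℕ → G₀ → 𝕜) :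
    G.unitFun (fun x => ∑ i ∈ s, v i x) = ∑ i ∈ s, G.unitFun (v i) := by
  ext1 g
  rw [Finset.sum_apply]
  by_cases hg : g = G.one (G.src g)
  · simp only [unitFun, if_pos hg, map_sum]
  · simp only [unitFun, if_neg hg, Finset.sum_const_zero]

theorem coeff_unitFun (v : G₀ → 𝕜) {l : ℕ} (hl : l ≠ 0) (g : G₁) :
    PowerSeries.coeff l (G.unitFun v g) = 0 := by
  rw [unitFun]
  split_ifs
  · rw [PowerSeries.coeff_C, if_neg hl]
  · exact map_zero _

theorem support_unitFun (v : G₀ → 𝕜) : support (G.unitFun v) ⊆ G.one '' support v := by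
  intro g hg
  by_cases h : g = G.one (G.src g)
  · refine ⟨G.src g, fun h0 => hg ?_, h.symm⟩
    rw [unitFun, if_pos h, h0, map_zero]
  · exact absurd (G.unitFun_of_ne v h) hg

variable {G}

theorem unitFun_eventually_zero [T2Space G₁] {v : G₀ → 𝕜} {g : G₁} {p : G₁ → G₀}
    (hp : Continuous p) (hp1 : ∀ x, p (G.one x) = x) (hv : ∀ᶠ x in 𝓝 (p g), v x = 0) :
    ∀ᶠ k in 𝓝 g, G.unitFun v k = 0 := by
  by_cases hg : g = G.one (G.src g)
  · filter_upwards [hp.continuousAt.eventually hv, G.eventually_eq_one hg] with k hk hk'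
    rw [hk', hp1] at hk
    rw [unitFun, if_pos hk', hk, map_zero]
  · exact (G.eventually_ne_one hg).mono fun k hk => G.unitFun_of_ne v hk

theorem _root_.SmoothGerm.powerSeries_C {M : Type*} [TopologicalSpace M] [ChartedSpace E M]
    {v : M → 𝕜} {x : M} (hv : SmoothNear E v x) :
    SmoothGerm E (fun y => PowerSeries.C (v y)) x := by
  filter_upwards [hv.eventually] with y hy l
  by_cases hl : l = 0
  · subst hl
    refine hy.congr (.of_forall fun z => ?_)
    simp [coeffFun]
  · refine ((contMDiff_const (c := (0 : 𝕜))).smoothNear y).congr (.of_forall fun z => ?_)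
    simp [coeffFun, PowerSeries.coeff_C, hl]

variable {U : Opens G.Orbit}

theorem regularOn_unitFun [T2Space G₁] {v : G₀ → 𝕜}
    (hv : ∀ x, Quotient.mk G.orbitSetoid x ∈ U → SmoothNear E v x) :
    G.RegularOn U (G.unitFun v) := by
  intro g hg
  by_cases h : g = G.one (G.src g)
  · refine (SmoothGerm.comp (φ := G.src) (SmoothGerm.powerSeries_C (hv (G.src g) hg))
      (.of_forall G.etale_src.contMDiff)).congr ?_
    filter_upwards [G.eventually_eq_one h] with k hk
    rw [unitFun, if_pos hk]
  · exact (SmoothGerm.const 0).congr ((G.eventually_ne_one h).mono fun k hk =>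
      (G.unitFun_of_ne v hk).symm)

section Product

variable [IsManifold 𝓘(ℝ, E) ∞ G₀] {C : ℕ → (G₀ → 𝕜) → (G₀ → 𝕜) → G₀ → 𝕜}
  [T2Space G₁] {a : G₁ → PowerSeries 𝕜} {v : G₀ → 𝕜} {g : G₁}

/-- The first factor `g h⁻¹` is a unit only for `h = g`. The factor `v` is then pulled back along
the target map. -/
theorem starConv_unitFun_left (hC : ∀ k, IsBidiffOp E (C k)) (ha : G.RegularOn U a)
    (hv : ∀ x, Quotient.mk G.orbitSetoid x ∈ U → SmoothNear E v x) (hg : g ∈ G.arrowsOver U) :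
    G.starConv C (G.unitFun v) a g =
      starOf C (fun x => PowerSeries.C (v (G.tgt (G.sec g x)))) (fun x => a (G.sec g x))
        (G.src g) := by
  rw [G.starConv_eq_sum C (H := {g}) _ _ (by simp), Finset.sum_singleton]
  · refine starOf_congr hC ((regularOn_unitFun hv).divSec rfl hg) (ha.sec hg) ?_ .rfl
    filter_upwards [G.eventually_divSec_eq (rfl : G.src g = G.src g)] with x hx
    rw [hx, G.mul_inv, unitFun_one]
  · intro h e h0
    by_contra hne
    refine h0 (convTerm_eq_zero_left hC ha e hg ?_)
    have h1 : G.mul g (G.inv h) ≠ G.one (G.src (G.mul g (G.inv h))) := by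
      intro h2
      rw [G.src_mul_inv e.symm] at h2
      have h3 := G.mul_inv_mul_cancel e.symm
      rw [h2, G.one_mul] at h3
      exact hne (by simp [h3])
    exact (G.eventually_ne_one h1).mono fun k hk => G.unitFun_of_ne v hk

/-- Only the unit at `src g` contributes as second factor, so here `v` is read at the source. -/
theorem starConv_unitFun_right (hC : ∀ k, IsBidiffOp E (C k)) (ha : G.RegularOn U a)
    (hv : ∀ x, Quotient.mk G.orbitSetoid x ∈ U → SmoothNear E v x) (hg : g ∈ G.arrowsOver U) :
    G.starConv C a (G.unitFun v) g =
      starOf C (fun x => a (G.sec g x)) (fun x => PowerSeries.C (v x)) (G.src g) := by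
  have e : G.src g = G.src (G.one (G.src g)) := (G.src_one _).symm
  rw [G.starConv_eq_sum C (H := {G.one (G.src g)}) _ _ (by simpa using e.symm),
    Finset.sum_singleton]
  · have s1 := ha.divSec e hg
    have s2 := (regularOn_unitFun hv).sec (mem_arrowsOver_of_src_eq e.symm hg)
    have h1 := G.eventually_divSec_eq e
    rw [← e] at s1 s2 h1
    refine starOf_congr hC s1 s2 ?_ ?_
    · filter_upwards [h1, G.eventually_sec_one (G.src g), G.eventually_src_sec g] with x hx hx' hx''
      have := G.mul_one (G.sec g x)
      rw [hx''] at this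
      rw [hx, hx', G.inv_one, this]
    · filter_upwards [G.eventually_sec_one (G.src g)] with x hx
      rw [hx, unitFun_one]
  · intro h e' h0
    by_contra hne
    refine h0 (convTerm_eq_zero_right hC ha e' hg ?_)
    have h1 : h ≠ G.one (G.src h) := by
      intro h2
      rw [e'] at h2
      exact hne (by simp [← h2])
    exact (G.eventually_ne_one h1).mono fun k hk => G.unitFun_of_ne v hk

theorem starConv_unitFun_left_eq_zero (hC : ∀ k, IsBidiffOp E (C k)) (ha : G.RegularOn U a)
    (hv : ∀ x, Quotient.mk G.orbitSetoid x ∈ U → SmoothNear E v x) (hg : g ∈ G.arrowsOver U)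
    (h0 : ∀ᶠ x in 𝓝 (G.tgt g), v x = 0) : G.starConv C (G.unitFun v) a g = 0 := by
  have ht : Tendsto (fun x => G.tgt (G.sec g x)) (𝓝 (G.src g)) (𝓝 (G.tgt g)) :=
    (G.continuous_tgt.tendsto g).comp (G.tendsto_sec g)
  have e : (fun _ => 0) =ᶠ[𝓝 (G.src g)] fun x => PowerSeries.C (v (G.tgt (G.sec g x))) :=
    (ht.eventually h0).mono fun x hx => by simp only [hx, map_zero]
  rw [starConv_unitFun_left hC ha hv hg,
    ← starOf_congr hC (SmoothGerm.const 0) (ha.sec hg) e .rfl, starOf_zero_left hC (ha.sec hg)]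

theorem starConv_unitFun_right_eq_zero (hC : ∀ k, IsBidiffOp E (C k)) (ha : G.RegularOn U a)
    (hv : ∀ x, Quotient.mk G.orbitSetoid x ∈ U → SmoothNear E v x) (hg : g ∈ G.arrowsOver U)
    (h0 : ∀ᶠ x in 𝓝 (G.src g), v x = 0) : G.starConv C a (G.unitFun v) g = 0 := by
  have e : (fun _ => 0) =ᶠ[𝓝 (G.src g)] fun x => PowerSeries.C (v x) :=
    h0.mono fun x hx => by simp only [hx, map_zero]
  rw [starConv_unitFun_right hC ha hv hg,
    ← starOf_congr hC (ha.sec hg) (SmoothGerm.const 0) .rfl e, starOf_zero_right hC (ha.sec hg)]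

variable [FiniteDimensional ℝ E] [T2Space G₀]

/-- The two alternatives cover all arrows when `v` is `1` near the targets of a closed set carrying
the support of `a`: on the set the unit law applies, off it both sides vanish by locality. -/
theorem starConv_unitFun_left_eq_self (hC : IsLocalStar E C) (ha : G.RegularOn U a)
    (hv : ∀ x, Quotient.mk G.orbitSetoid x ∈ U → SmoothNear E v x) (hg : g ∈ G.arrowsOver U)
    (h1 : (∀ᶠ x in 𝓝 (G.tgt g), v x = 1) ∨ ∀ᶠ k in 𝓝 g, a k = 0) :
    G.starConv C (G.unitFun v) a g = a g := by
  have ht : Tendsto (fun x => G.tgt (G.sec g x)) (𝓝 (G.src g)) (𝓝 (G.tgt g)) :=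
    (G.continuous_tgt.tendsto g).comp (G.tendsto_sec g)
  have hs : SmoothGerm E (fun x => PowerSeries.C (v (G.tgt (G.sec g x)))) (G.src g) := by
    refine SmoothGerm.comp (f := fun y => PowerSeries.C (v y)) (φ := fun x => G.tgt (G.sec g x)) ?_
      ((G.eventually_contMDiffAt_sec g).mono fun y hy => (G.etale_tgt.contMDiff _).comp y hy)
    refine SmoothGerm.powerSeries_C (hv _ ?_)
    rw [G.sec_src, ← G.proj_eq_tgt]
    exact hg
  rw [starConv_unitFun_left hC.bidiff ha hv hg]
  rcases h1 with h1 | h0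
  · have e : (fun _ => 1) =ᶠ[𝓝 (G.src g)] fun x => PowerSeries.C (v (G.tgt (G.sec g x))) :=
      (ht.eventually h1).mono fun x hx => by simp only [hx, map_one]
    rw [← starOf_congr hC.bidiff (SmoothGerm.const 1) (ha.sec hg) e .rfl,
      hC.one_star_germ (ha.sec hg), G.sec_src]
  · have e := (eventuallyEq_sec (G := G) (b' := fun _ => 0) h0)
    rw [starOf_congr hC.bidiff hs (ha.sec hg) .rfl e, starOf_zero_right hC.bidiff hs,
      h0.self_of_nhds]

theorem starConv_unitFun_right_eq_self (hC : IsLocalStar E C) (ha : G.RegularOn U a)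
    (hv : ∀ x, Quotient.mk G.orbitSetoid x ∈ U → SmoothNear E v x) (hg : g ∈ G.arrowsOver U)
    (h1 : (∀ᶠ x in 𝓝 (G.src g), v x = 1) ∨ ∀ᶠ k in 𝓝 g, a k = 0) :
    G.starConv C a (G.unitFun v) g = a g := by
  have hs : SmoothGerm E (fun x => PowerSeries.C (v x)) (G.src g) :=
    SmoothGerm.powerSeries_C (hv _ hg)
  rw [starConv_unitFun_right hC.bidiff ha hv hg]
  rcases h1 with h1 | h0
  · have e : (fun _ => 1) =ᶠ[𝓝 (G.src g)] fun x => PowerSeries.C (v x) :=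
      h1.mono fun x hx => by simp only [hx, map_one]
    rw [← starOf_congr hC.bidiff (ha.sec hg) (SmoothGerm.const 1) .rfl e,
      hC.star_one_germ (ha.sec hg), G.sec_src]
  · have e := (eventuallyEq_sec (G := G) (b' := fun _ => 0) h0)
    rw [starOf_congr hC.bidiff (ha.sec hg) hs e .rfl, starOf_zero_left hC.bidiff hs,
      h0.self_of_nhds]

end Product

end ProperEtaleLieGroupoid

end

noncomputable section

/-! ### Cutoff functions -/

section Cutoff

theorem exists_exhaustion {X : Type*} [TopologicalSpace X] [LocallyCompactSpace X]
    [SecondCountableTopology X] {V : Set X} (hV : IsOpen V) :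
    ∃ K : ℕ → Set X, (∀ n, IsCompact (K n)) ∧ (∀ n, K n ⊆ V) ∧
      (∀ n, K n ⊆ interior (K (n + 1))) ∧ ∀ x ∈ V, ∃ n, x ∈ K n := by
  have : LocallyCompactSpace V := hV.locallyCompactSpace
  let K : CompactExhaustion V := default
  refine ⟨fun n => (↑) '' K n, fun n => (K.isCompact n).image continuous_subtype_val, fun n => ?_,
    fun n => ?_, fun x hx => ?_⟩
  · rintro _ ⟨x, -, rfl⟩
    exact x.2
  · exact (image_mono (K.subset_interior_succ n)).trans (interior_maximal
      (image_mono interior_subset) (hV.isOpenMap_subtype_val _ isOpen_interior))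
  · obtain ⟨n, hn⟩ := K.exists_mem ⟨x, hx⟩
    exact ⟨n, _, hn, rfl⟩

theorem exists_subset_of_exhaustion {X : Type*} [TopologicalSpace X] {K : ℕ → Set X}
    (hK : ∀ n, K n ⊆ interior (K (n + 1))) {Q : Set X} (hQ : IsCompact Q)
    (h : ∀ x ∈ Q, ∃ n, x ∈ K n) : ∃ n, Q ⊆ interior (K n) := by
  have hmono : Monotone fun n => interior (K n) :=
    monotone_nat_of_le_succ fun n => interior_subset.trans (hK n)
  refine hQ.elim_directed_cover _ (fun n => isOpen_interior) (fun x hx => ?_) hmono.directed_le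
  obtain ⟨n, hn⟩ := h x hx
  exact mem_iUnion.2 ⟨n + 1, hK n hn⟩

variable {𝕜 : Type*} [RCLike 𝕜] {E : Type*} [NormedAddCommGroup E] [NormedSpace ℝ E]
  [FiniteDimensional ℝ E] {M : Type*} [TopologicalSpace M] [ChartedSpace E M]
  [IsManifold 𝓘(ℝ, E) ∞ M] [T2Space M] [SecondCountableTopology M]

variable (𝕜 E) in
theorem exists_cutoff {F V : Set M} (hF : IsClosed F) (hV : IsOpen V) (hFV : F ⊆ V) :
    ∃ f : M → 𝕜, ContMDiff 𝓘(ℝ, E) 𝓘(ℝ, 𝕜) ∞ f ∧ (∀ x ∈ F, ∀ᶠ y in 𝓝 x, f y = 1) ∧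
      tsupport f ⊆ V := by
  have : LocallyCompactSpace M := Manifold.locallyCompact_of_finiteDimensional 𝓘(ℝ, E)
  obtain ⟨f, hf0, hf1, -⟩ := exists_contMDiffMap_zero_one_nhds_of_isClosed 𝓘(ℝ, E) (n := ⊤)
    hV.isClosed_compl hF (disjoint_compl_left_iff_subset.2 hFV)
  refine ⟨fun x => ((f x : ℝ) : 𝕜),
    (RCLike.ofRealCLM (K := 𝕜)).contMDiff.comp f.contMDiff, fun x hx => ?_, fun x hx => ?_⟩
  · filter_upwards [eventually_nhdsSet_iff_forall.1 hf1 x hx] with y hy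
    rw [hy, RCLike.ofReal_one]
  · by_contra hxV
    refine notMem_tsupport_iff_eventuallyEq.2 ?_ hx
    filter_upwards [eventually_nhdsSet_iff_forall.1 hf0 x hxV] with y hy
    rw [hy, RCLike.ofReal_zero, Pi.zero_apply]

variable (𝕜 E) in
theorem exists_cutoff_of_isCompact {F V : Set M} (hF : IsCompact F) (hV : IsOpen V) (hFV : F ⊆ V) :
    ∃ f : M → 𝕜, ContMDiff 𝓘(ℝ, E) 𝓘(ℝ, 𝕜) ∞ f ∧ (∀ x ∈ F, ∀ᶠ y in 𝓝 x, f y = 1) ∧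
      IsCompact (tsupport f) ∧ tsupport f ⊆ V := by
  have : LocallyCompactSpace M := Manifold.locallyCompact_of_finiteDimensional 𝓘(ℝ, E)
  obtain ⟨V', hV', h1, h2, h3⟩ := exists_open_between_and_isCompact_closure hF hV hFV
  obtain ⟨f, hf, hf1, hf2⟩ := exists_cutoff 𝕜 E hF.isClosed hV' h1
  exact ⟨f, hf, hf1, h3.of_isClosed_subset (isClosed_tsupport f) (hf2.trans subset_closure),
    hf2.trans (subset_closure.trans h2)⟩

variable (𝕜 E) in
/-- Cutoff functions for an increasing sequence of closed sets. -/
theorem exists_cutoff_seq {K : ℕ → Set M} (hK : ∀ n, IsClosed (K n))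
    (hK' : ∀ n, K n ⊆ interior (K (n + 1))) :
    ∃ f : ℕ → M → 𝕜, (∀ n, ContMDiff 𝓘(ℝ, E) 𝓘(ℝ, 𝕜) ∞ (f n)) ∧ f 0 = 0 ∧
      (∀ m n, m < n → ∀ x ∈ K m, ∀ᶠ y in 𝓝 x, f n y = 1) ∧ ∀ n, tsupport (f n) ⊆ K n := by
  have hmono : Monotone K := monotone_nat_of_le_succ fun n => (hK' n).trans interior_subset
  choose f hf hf1 hf2 using fun n => exists_cutoff 𝕜 E (hK n) isOpen_interior (hK' n)
  -- The shift by one makes the function with index `n` supported in `K n` and equal to `1` on the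
  -- earlier sets; starting at `0` makes the differences telescope.
  refine ⟨fun n => Nat.casesOn n 0 f, fun n => ?_, rfl, fun m n hmn x hx => ?_, fun n => ?_⟩
  · cases n with
    | zero => exact contMDiff_const
    | succ n => exact hf n
  · cases n with
    | zero => exact absurd hmn (Nat.not_lt_zero m)
    | succ n => exact hf1 n x (hmono (Nat.lt_succ_iff.1 hmn) hx)
  · cases n with
    | zero => simp [tsupport]
    | succ n => exact (hf2 n).trans interior_subset

end Cutoff

/-- The pairing enumerates `ℕ × ℕ` by square shells, so the first `m ^ 2` indices are exactly the
pairs below `m`. -/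
theorem sum_range_sq_unpair {R : Type*} [CommSemiring R] (f h : ℕ → R) (m : ℕ) :
    ∑ i ∈ Finset.range (m ^ 2), f i.unpair.1 * h i.unpair.2 =
      (∑ n ∈ Finset.range m, f n) * ∑ j ∈ Finset.range m, h j := by
  rw [Finset.sum_mul_sum, ← Finset.sum_product']
  refine Finset.sum_nbij' (fun i => i.unpair) (fun p => Nat.pair p.1 p.2) (fun i hi => ?_)
    (fun p hp => ?_) (fun i _ => Nat.pair_unpair i) (fun p _ => Nat.unpair_pair p.1 p.2)
    (fun i _ => rfl)
  · have h1 := Nat.max_sq_add_min_le_pair i.unpair.1 i.unpair.2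
    rw [Nat.pair_unpair] at h1
    have h2 : max i.unpair.1 i.unpair.2 ^ 2 < m ^ 2 :=
      ((Nat.le_add_right _ _).trans h1).trans_lt (Finset.mem_range.1 hi)
    have h3 := max_lt_iff.1 (lt_of_pow_lt_pow_left₀ 2 (Nat.zero_le m) h2)
    exact Finset.mem_product.2 ⟨Finset.mem_range.2 h3.1, Finset.mem_range.2 h3.2⟩
  · rw [Finset.mem_product, Finset.mem_range, Finset.mem_range] at hp
    exact Finset.mem_range.2 ((Nat.pair_lt_max_add_one_sq p.1 p.2).trans_le
      (Nat.pow_le_pow_left (Nat.succ_le_of_lt (max_lt hp.1 hp.2)) 2))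

/-! ### Partitions of unity on the objects over an open set of orbits. -/

namespace ProperEtaleLieGroupoid

variable {E : Type*} [NormedAddCommGroup E] [NormedSpace ℝ E]
  {G₀ G₁ : Type*} [TopologicalSpace G₀] [ChartedSpace E G₀]
  [TopologicalSpace G₁] [ChartedSpace E G₁]
  (G : ProperEtaleLieGroupoid E G₀ G₁)

/-- A partition of unity on the objects over `U`, with cutoff functions for its members. -/
structure UnitPartition (𝕜 : Type*) [RCLike 𝕜] (U : Opens G.Orbit) where
  φ : ℕ → G₀ → 𝕜
  cut : ℕ → G₀ → 𝕜
  smooth : ∀ i, ContMDiff 𝓘(ℝ, E) 𝓘(ℝ, 𝕜) ∞ (φ i)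
  smooth_cut : ∀ i, ContMDiff 𝓘(ℝ, E) 𝓘(ℝ, 𝕜) ∞ (cut i)
  compact_cut : ∀ i, IsCompact (tsupport (cut i))
  cut_subset : ∀ i, ∀ x ∈ tsupport (cut i), Quotient.mk G.orbitSetoid x ∈ U
  cut_one : ∀ i, ∀ x ∈ tsupport (φ i), ∀ᶠ y in 𝓝 x, cut i y = 1
  sum_one : ∀ Q : Set G₀, IsCompact Q → (∀ x ∈ Q, Quotient.mk G.orbitSetoid x ∈ U) →
    ∃ N : ℕ, ∀ x ∈ Q, ∀ᶠ y in 𝓝 x,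
      (∀ i ≥ N, φ i y = 0) ∧ ∀ n ≥ N, ∑ i ∈ Finset.range n, φ i y = 1
  transverse : ∀ K ⊆ (U : Set G.Orbit), IsCompact K → ∃ K' ⊆ (U : Set G.Orbit), IsCompact K' ∧
    ∀ i, (∃ x ∈ tsupport (cut i), Quotient.mk G.orbitSetoid x ∈ K) →
      ∀ x ∈ tsupport (φ i), Quotient.mk G.orbitSetoid x ∈ K'

/-- A partition by compactly supported functions on the objects is not enough: its members may
spread over far apart orbits. The members are therefore products `α n * β j`, where `α` comes from a
compact exhaustion of the objects over `U` and `β` from its saturations. The factor `β j` confines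
the orbits on which the product and its cutoff live, which gives `transverse`. -/
theorem nonempty_unitPartition [FiniteDimensional ℝ E] [IsManifold 𝓘(ℝ, E) ∞ G₀] [T2Space G₀]
    [SecondCountableTopology G₀] (𝕜 : Type*) [RCLike 𝕜] (U : Opens G.Orbit) :
    Nonempty (G.UnitPartition 𝕜 U) := by
  have : LocallyCompactSpace G₀ := Manifold.locallyCompact_of_finiteDimensional 𝓘(ℝ, E)
  have := G.t2Space_orbit
  have hq := G.isOpenQuotientMap_mk
  obtain ⟨K, hK, hKU, hK', hKc⟩ := exists_exhaustion (U.isOpen.preimage hq.continuous)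
  have hKm : Monotone K := monotone_nat_of_le_succ fun n => (hK' n).trans interior_subset
  let mk := Quotient.mk G.orbitSetoid
  have hL : ∀ n, IsCompact (mk '' K n) := fun n => (hK n).image hq.continuous
  have hL' : ∀ n, mk '' K n ⊆ interior (mk '' K (n + 1)) := fun n =>
    (image_mono (hK' n)).trans (interior_maximal (image_mono interior_subset)
      (hq.isOpenMap _ isOpen_interior))
  have hLm : Monotone fun n => mk '' K n := fun m n h => image_mono (hKm h)
  obtain ⟨f, hf, hf0, hf1, hfs⟩ := exists_cutoff_seq 𝕜 E (fun n => (hK n).isClosed) hK'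
  obtain ⟨h, hh, hh0, hh1, hhs⟩ := exists_cutoff_seq 𝕜 E (K := fun n => mk ⁻¹' (mk '' K n))
    (fun n => (hL n).isClosed.preimage hq.continuous)
    (fun n => (preimage_mono (hL' n)).trans (preimage_interior_subset_interior_preimage hq.continuous))
  let α : ℕ → G₀ → 𝕜 := fun n => f (n + 1) - f n
  let β : ℕ → G₀ → 𝕜 := fun n => h (n + 1) - h n
  have hα : ∀ n, tsupport (α n) ⊆ K (n + 1) := fun n => (tsupport_sub _ _).trans
    (union_subset (hfs _) ((hfs n).trans (hKm n.le_succ)))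
  have hβ : ∀ n, tsupport (β n) ⊆ mk ⁻¹' (mk '' K (n + 1)) := fun n => (tsupport_sub _ _).trans
    (union_subset (hhs _) ((hhs n).trans (preimage_mono (hLm n.le_succ))))
  have hβ0 : ∀ m n, m < n → ∀ x ∈ mk ⁻¹' (mk '' K m), x ∉ tsupport (β n) := by
    intro m n hmn x hx
    rw [notMem_tsupport_iff_eventuallyEq]
    filter_upwards [hh1 m n hmn x hx, hh1 m (n + 1) (hmn.trans n.lt_succ_self) x hx] with y e1 e2
    simp [β, e1, e2]
  let φ : ℕ → G₀ → 𝕜 := fun i => α i.unpair.1 * β i.unpair.2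
  have hφα : ∀ i, tsupport (φ i) ⊆ tsupport (α i.unpair.1) := fun i => tsupport_mul_subset_left
  have hφβ : ∀ i, tsupport (φ i) ⊆ tsupport (β i.unpair.2) := fun i => tsupport_mul_subset_right
  have hφc : ∀ i, IsCompact (tsupport (φ i)) := fun i =>
    (hK _).of_isClosed_subset (isClosed_tsupport _) ((hφα i).trans (hα _))
  -- The cutoff of a member with second index `j` must avoid the orbits of `K m` for `m < j`; this
  -- is possible since `β j` vanishes near them.
  let V : ℕ → Set G₀ := fun j => mk ⁻¹' U \ ⋃ m ∈ Finset.range j, mk ⁻¹' (mk '' K m)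
  have hV : ∀ j, IsOpen (V j) := fun j => (U.isOpen.preimage hq.continuous).sdiff
    (isClosed_biUnion_finset fun m _ => (hL m).isClosed.preimage hq.continuous)
  have hφV : ∀ i, tsupport (φ i) ⊆ V i.unpair.2 := by
    intro i x hx
    refine ⟨hKU _ (hα _ (hφα i hx)), fun hx' => ?_⟩
    obtain ⟨m, hm, hxm⟩ := mem_iUnion₂.1 hx'
    exact hβ0 m _ (Finset.mem_range.1 hm) x hxm (hφβ i hx)
  choose c hc hc1 hcc hcV using fun i => exists_cutoff_of_isCompact 𝕜 E (hφc i) (hV i.unpair.2) (hφV i)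
  refine ⟨⟨φ, c, fun i => (contDiff_mul (𝕜 := ℝ) (𝔸 := 𝕜)).contMDiff.comp
    (((hf _).sub (hf _)).prodMk_space ((hh _).sub (hh _))), hc, hcc,
    fun i x hx => (hcV i hx).1, hc1, fun Q hQ hQU => ?_, fun P hPU hP => ?_⟩⟩
  · obtain ⟨m, hm⟩ := exists_subset_of_exhaustion hK' hQ fun x hx => hKc x (hQU x hx)
    refine ⟨(m + 1) ^ 2, fun x hx => ?_⟩
    filter_upwards [isOpen_interior.mem_nhds (hm hx)] with y hy
    have hyK : y ∈ K m := interior_subset hy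
    have hy1 : ∀ n, m < n → f n y = 1 := fun n hn => (hf1 m n hn y hyK).self_of_nhds
    have hy2 : ∀ n, m < n → h n y = 1 := fun n hn =>
      (hh1 m n hn y (mem_image_of_mem mk hyK)).self_of_nhds
    -- Beyond this index one of the two components exceeds `m`, and the corresponding difference of
    -- functions equal to `1` on `K m` is zero.
    have hz : ∀ i ≥ (m + 1) ^ 2, φ i y = 0 := by
      intro i hi
      have h1 := Nat.pair_lt_max_add_one_sq i.unpair.1 i.unpair.2
      rw [Nat.pair_unpair] at h1
      have h2 := lt_of_pow_lt_pow_left₀ 2 (Nat.zero_le _) (hi.trans_lt h1)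
      rcases lt_max_iff.1 (Nat.lt_of_succ_lt_succ h2) with h3 | h3
      · simp [φ, α, hy1 _ h3, hy1 _ (h3.trans (Nat.lt_succ_self _))]
      · simp [φ, β, hy2 _ h3, hy2 _ (h3.trans (Nat.lt_succ_self _))]
    refine ⟨hz, fun n hn => ?_⟩
    rw [← Finset.sum_subset (Finset.range_mono hn) fun i _ hi =>
      hz i (not_lt.1 fun h => hi (Finset.mem_range.2 h))]
    refine (sum_range_sq_unpair (fun n => α n y) (fun n => β n y) (m + 1)).trans ?_
    simp only [α, β, Pi.sub_apply]
    rw [Finset.sum_range_sub (fun n => f n y), Finset.sum_range_sub (fun n => h n y), hf0, hh0,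
      hy1 _ m.lt_succ_self, hy2 _ m.lt_succ_self]
    simp
  · obtain ⟨J, hJ⟩ := exists_subset_of_exhaustion hL' hP fun x hx => by
      obtain ⟨y, rfl⟩ := Quotient.exists_rep x
      obtain ⟨n, hn⟩ := hKc y (hPU hx)
      exact ⟨n, y, hn, rfl⟩
    refine ⟨mk '' K (J + 1), ?_, hL _, ?_⟩
    · rintro _ ⟨x, hx, rfl⟩
      exact hKU _ hx
    · rintro i ⟨x, hx, hxP⟩ y hy
      -- A cutoff that meets the orbits in `P` has second index at most `J`, so its member lies over
      -- the image of `K (J + 1)`.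
      refine hLm (Nat.succ_le_succ (not_lt.1 fun hlt => ?_)) (hβ _ (hφβ i hy))
      exact (hcV i hx).2 (mem_biUnion (Finset.mem_coe.2 (Finset.mem_range.2 hlt))
        (show mk x ∈ mk '' K J from interior_subset (hJ hxP)))

end ProperEtaleLieGroupoid

end

noncomputable section

/-! ### Families of supports -/

namespace ProperEtaleLieGroupoid

variable {E : Type*} [NormedAddCommGroup E] [NormedSpace ℝ E]
  {G₀ G₁ : Type*} [TopologicalSpace G₀] [ChartedSpace E G₀]
  [TopologicalSpace G₁] [ChartedSpace E G₁]
  (G : ProperEtaleLieGroupoid E G₀ G₁)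

/-- Sets of arrows over `U` that are compact over compact sets of orbits and, if `c` holds,
compact. -/
def Admissible (c : Prop) (U : Opens G.Orbit) (L : Set G₁) : Prop :=
  G.FibCompactSet U L ∧ (c → IsCompact L)

variable {G} {c : Prop} {U : Opens G.Orbit} {L L' : Set G₁}

theorem Admissible.union (hL : G.Admissible c U L) (hL' : G.Admissible c U L') :
    G.Admissible c U (L ∪ L') :=
  ⟨⟨union_subset hL.1.1 hL'.1.1, fun K hK hK' => by
    rw [union_inter_distrib_right]
    exact (hL.1.2 K hK hK').union (hL'.1.2 K hK hK')⟩, fun h => (hL.2 h).union (hL'.2 h)⟩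

theorem isClosed_arrowsOver {K : Set G.Orbit} (hK : IsCompact K) : IsClosed (G.arrowsOver K) :=
  have := G.t2Space_orbit
  hK.isClosed.preimage G.continuous_proj

theorem _root_.IsCompact.admissible {L : Set G₁} (hL : IsCompact L) (hLU : L ⊆ G.arrowsOver U) :
    G.Admissible c U L :=
  ⟨⟨hLU, fun _ _ hK => hL.inter_right (isClosed_arrowsOver hK)⟩, fun _ => hL⟩

variable (G) in
/-- The set of products of composable arrows. -/
def mulSet (L L' : Set G₁) : Set G₁ := {g | ∃ k ∈ L, ∃ h ∈ L', G.src k = G.tgt h ∧ G.mul k h = g}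

theorem isCompact_mulSet [T2Space G₀] (hL : IsCompact L) (hL' : IsCompact L') :
    IsCompact (G.mulSet L L') := by
  have h1 : IsCompact ((L ×ˢ L') ∩ {p : G₁ × G₁ | G.src p.1 = G.tgt p.2}) :=
    (hL.prod hL').inter_right (isClosed_eq (G.continuous_src.comp continuous_fst)
      (G.continuous_tgt.comp continuous_snd))
  convert h1.image_of_continuousOn (G.smooth_mul.continuousOn.mono inter_subset_right) using 1
  ext g
  constructor
  · rintro ⟨k, hk, h, hh, e, rfl⟩
    exact ⟨(k, h), ⟨⟨hk, hh⟩, e⟩, rfl⟩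
  · rintro ⟨⟨k, h⟩, ⟨⟨hk, hh⟩, e⟩, rfl⟩
    exact ⟨k, hk, h, hh, e, rfl⟩

theorem Admissible.mulSet [T2Space G₀] (hL : G.Admissible c U L) (hL' : G.Admissible c U L') :
    G.Admissible c U (G.mulSet L L') := by
  refine ⟨⟨?_, fun K hK hK' => ?_⟩, fun h => isCompact_mulSet (hL.2 h) (hL'.2 h)⟩
  · rintro _ ⟨k, hk, h, hh, e, rfl⟩
    rw [arrowsOver, mem_preimage, G.proj_mul e]
    exact hL'.1.1 hh
  · have hcpt := isCompact_mulSet (G := G) (hL.1.2 K hK hK') (hL'.1.2 K hK hK')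
    convert hcpt using 1
    ext g
    constructor
    · rintro ⟨⟨k, hk, h, hh, e, rfl⟩, hg⟩
      rw [arrowsOver, mem_preimage, G.proj_mul e] at hg
      refine ⟨k, ⟨hk, ?_⟩, h, ⟨hh, hg⟩, e, rfl⟩
      rw [arrowsOver, mem_preimage, G.proj_eq_of_src_eq_tgt e]
      exact hg
    · rintro ⟨k, hk, h, hh, e, rfl⟩
      refine ⟨⟨k, hk.1, h, hh.1, e, rfl⟩, ?_⟩
      rw [arrowsOver, mem_preimage, G.proj_mul e]
      exact hh.2

/-- A set of arrows which is locally over `U` contained in compact sets is contained in an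
admissible set. -/
theorem fibCompactSet_closure [T2Space G₁] {T : Set G₁}
    (hT : ∀ x ∈ U, ∃ V ∈ 𝓝 x, ∃ L, IsCompact L ∧ T ∩ G.arrowsOver V ⊆ L) :
    G.FibCompactSet U (closure T ∩ G.arrowsOver U) := by
  refine ⟨inter_subset_right, fun K hKU hK => ?_⟩
  choose! V hV L hL hVL using hT
  obtain ⟨t, ht, hcov⟩ := hK.elim_nhds_subcover (fun x => interior (V x))
    fun x hx => interior_mem_nhds.2 (hV x (hKU hx))
  have h1 : IsCompact (⋃ x ∈ t, L x) := t.isCompact_biUnion fun x hx => hL x (hKU (ht x hx))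
  have h2 : closure T ∩ G.arrowsOver U ∩ G.arrowsOver K = closure T ∩ G.arrowsOver K := by
    ext g
    exact ⟨fun h => ⟨h.1.1, h.2⟩, fun h => ⟨⟨h.1, hKU h.2⟩, h.2⟩⟩
  rw [h2]
  refine h1.of_isClosed_subset (isClosed_closure.inter (isClosed_arrowsOver hK)) ?_
  rintro g ⟨hgT, hgK⟩
  obtain ⟨x, hx, hgx⟩ := mem_iUnion₂.1 (hcov hgK)
  refine mem_biUnion (Finset.mem_coe.2 hx) ?_
  have ho : G.proj ⁻¹' interior (V x) ∈ 𝓝 g :=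
    (isOpen_interior.preimage G.continuous_proj).mem_nhds hgx
  have hg' : g ∈ closure (T ∩ G.arrowsOver (V x)) := by
    rw [mem_closure_iff_nhds] at hgT ⊢
    intro N hN
    obtain ⟨k, ⟨hkN, hk⟩, hkT⟩ := hgT _ (inter_mem hN ho)
    exact ⟨k, hkN, hkT, interior_subset (s := V x) hk⟩
  exact (hL x (hKU (ht x hx))).isClosed.closure_subset_iff.2 (hVL x (hKU (ht x hx))) hg'

theorem FibCompactSet.closure_inter_subset [FiniteDimensional ℝ E] [T2Space G₁]
    (hL : G.FibCompactSet U L) {T : Set G₁} (hT : T ⊆ L) : closure T ∩ G.arrowsOver U ⊆ L := by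
  rintro g ⟨hg, hgU⟩
  by_contra hn
  obtain ⟨k, hk, hkT⟩ := mem_closure_iff_nhds.1 hg _ (hL.eventually_notMem hgU hn)
  exact hk (hT hkT)

/-! ### Members of the partition and local units attached to a set of arrows. -/

namespace UnitPartition

variable {𝕜 : Type*} [RCLike 𝕜] (P : G.UnitPartition 𝕜 U)

/-- The members of the partition of unity which are not zero near the sources and targets of a set
of arrows. -/
def index (L : Set G₁) : Set ℕ := {i | ∃ x ∈ tsupport (P.φ i), x ∈ G.src '' L ∪ G.tgt '' L}

theorem tsupport_subset (i : ℕ) : tsupport (P.φ i) ⊆ tsupport (P.cut i) := fun x hx =>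
  subset_tsupport _ (by rw [mem_support, (P.cut_one i x hx).self_of_nhds]; exact one_ne_zero)

theorem finite_index {Q : Set G₀} (hQ : IsCompact Q)
    (hQU : ∀ x ∈ Q, Quotient.mk G.orbitSetoid x ∈ U) :
    {i | ∃ x ∈ tsupport (P.φ i), x ∈ Q}.Finite := by
  obtain ⟨N, hN⟩ := P.sum_one Q hQ hQU
  refine (Set.finite_lt_nat N).subset ?_
  rintro i ⟨x, hx, hxQ⟩
  by_contra hi
  exact notMem_tsupport_iff_eventuallyEq.2 ((hN x hxQ).mono fun y hy => hy.1 i (not_lt.1 hi)) hx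

theorem mk_mem_of_mem_image {K : Set G.Orbit} {x : G₀}
    (hx : x ∈ G.src '' (L ∩ G.arrowsOver K) ∪ G.tgt '' (L ∩ G.arrowsOver K)) :
    Quotient.mk G.orbitSetoid x ∈ K := by
  rcases hx with ⟨g, hg, rfl⟩ | ⟨g, hg, rfl⟩
  · exact hg.2
  · rw [← G.proj_eq_tgt]
    exact hg.2

/-- If the cutoff of a member meets `K`, the member itself lies over a fixed compact set `K'` of
orbits by `transverse`. Being relevant to `L`, it meets the sources or targets of the compact set
`L` over `K'`, so there are finitely many. -/
theorem finite_index_cut (hL : G.FibCompactSet U L) {K : Set G.Orbit} (hKU : K ⊆ U)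
    (hK : IsCompact K) :
    {i | i ∈ P.index L ∧ ∃ x ∈ tsupport (P.cut i), Quotient.mk G.orbitSetoid x ∈ K}.Finite := by
  obtain ⟨K', hKU', hK', h⟩ := P.transverse K hKU hK
  have hQ : IsCompact (G.src '' (L ∩ G.arrowsOver K') ∪ G.tgt '' (L ∩ G.arrowsOver K')) :=
    ((hL.2 K' hKU' hK').image G.continuous_src).union ((hL.2 K' hKU' hK').image G.continuous_tgt)
  refine (P.finite_index hQ fun x hx => hKU' (mk_mem_of_mem_image hx)).subset ?_
  rintro i ⟨⟨x, hx, hxL⟩, hi⟩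
  refine ⟨x, hx, ?_⟩
  have hxK := h i hi x hx
  rcases hxL with ⟨g, hg, rfl⟩ | ⟨g, hg, rfl⟩
  · exact Or.inl ⟨g, ⟨hg, hxK⟩, rfl⟩
  · refine Or.inr ⟨g, ⟨hg, ?_⟩, rfl⟩
    rw [arrowsOver, mem_preimage, G.proj_eq_tgt]
    exact hxK

/-- The units in the supports of the cutoff functions that belong to a set of arrows. -/
def unitSet (L : Set G₁) : Set G₁ := ⋃ i ∈ P.index L, G.one '' tsupport (P.cut i)

theorem admissible_unitSet (hL : G.Admissible c U L) : G.Admissible c U (P.unitSet L) := by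
  have hc : ∀ i, IsCompact (G.one '' tsupport (P.cut i)) := fun i =>
    (P.compact_cut i).image G.smooth_one.continuous
  refine ⟨⟨?_, fun K hKU hK => ?_⟩, fun h => ?_⟩
  · refine iUnion₂_subset fun i _ => ?_
    rintro _ ⟨x, hx, rfl⟩
    rw [arrowsOver, mem_preimage, G.proj_one]
    exact P.cut_subset i x hx
  · have hfin := P.finite_index_cut hL.1 hKU hK
    have h1 := (hfin.isCompact_biUnion fun i _ => hc i).inter_right (isClosed_arrowsOver hK)
    convert h1 using 1
    ext g
    constructor
    · rintro ⟨hg, hgK⟩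
      obtain ⟨i, hi, x, hx, rfl⟩ := mem_iUnion₂.1 hg
      refine ⟨mem_biUnion (show i ∈ {i | _} from ⟨hi, x, hx, ?_⟩) ⟨x, hx, rfl⟩, hgK⟩
      rw [← G.proj_one]
      exact hgK
    · rintro ⟨hg, hgK⟩
      obtain ⟨i, hi, hx⟩ := mem_iUnion₂.1 hg
      exact ⟨mem_biUnion hi.1 hx, hgK⟩
  · refine Set.Finite.isCompact_biUnion ?_ fun i _ => hc i
    refine P.finite_index (((hL.2 h).image G.continuous_src).union
      ((hL.2 h).image G.continuous_tgt)) ?_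
    rintro _ (⟨g, hg, rfl⟩ | ⟨g, hg, rfl⟩)
    · exact hL.1.1 hg
    · rw [← G.proj_eq_tgt]
      exact hL.1.1 hg

theorem support_unitFun_cut {i : ℕ} (hi : i ∈ P.index L) :
    support (G.unitFun (P.cut i)) ⊆ P.unitSet L :=
  (G.support_unitFun _).trans fun _ hg =>
    mem_biUnion hi (image_mono (subset_tsupport _) hg)

theorem eventually_unitFun_cut [FiniteDimensional ℝ E] (hL : G.FibCompactSet U L) {g : G₁}
    (hg : g ∈ G.arrowsOver U) :
    ∃ N, ∀ᶠ k in 𝓝 g, ∀ i ∈ P.index L, N ≤ i → G.unitFun (P.cut i) k = 0 := by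
  have := G.locallyCompactSpace_orbit
  obtain ⟨K, hK, hKU, hKc⟩ := local_compact_nhds (U.isOpen.mem_nhds hg)
  obtain ⟨N, hN⟩ := (P.finite_index_cut hL hKU hKc).bddAbove
  refine ⟨N + 1, ?_⟩
  filter_upwards [G.continuous_proj.continuousAt hK] with k hk i hi hNi
  by_contra h0
  obtain ⟨x, hx, rfl⟩ := G.support_unitFun _ h0
  have hk' : Quotient.mk G.orbitSetoid x ∈ K := by
    rw [← G.proj_one]
    exact hk
  have := hN (show i ∈ {i | _} from ⟨hi, x, subset_tsupport _ hx, hk'⟩)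
  omega

/-- A function which is one near the sources and targets of a set of arrows. -/
def localUnit (L : Set G₁) : G₀ → 𝕜 :=
  fun x => ∑ᶠ i, (P.index L).indicator (fun i => P.φ i x) i

theorem localUnit_eventuallyEq {x : G₀} (hx : Quotient.mk G.orbitSetoid x ∈ U) :
    ∃ N, ∀ᶠ y in 𝓝 x,
      P.localUnit L y = ∑ i ∈ Finset.range N, (P.index L).indicator (fun i => P.φ i y) i ∧
      ∑ i ∈ Finset.range N, P.φ i y = 1 := by
  obtain ⟨N, hN⟩ := P.sum_one {x} isCompact_singleton (by simpa using hx)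
  refine ⟨N, (hN x rfl).mono fun y hy => ⟨finsum_eq_sum_of_support_subset _ fun i hi => ?_,
    hy.2 N le_rfl⟩⟩
  by_contra hn
  refine hi (indicator_apply_eq_zero.2 fun _ => hy.1 i ?_)
  simpa using hn

theorem smoothNear_localUnit {x : G₀} (hx : Quotient.mk G.orbitSetoid x ∈ U) :
    SmoothNear E (P.localUnit L) x := by
  obtain ⟨N, hN⟩ := P.localUnit_eventuallyEq (L := L) hx
  have h1 : ContMDiff 𝓘(ℝ, E) 𝓘(ℝ, 𝕜) ∞
      (fun y => ∑ i ∈ Finset.range N, (P.index L).indicator (fun i => P.φ i y) i) := by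
    refine contMDiff_finsetSum fun i _ => ?_
    by_cases hi : i ∈ P.index L
    · simp only [indicator_of_mem hi]
      exact P.smooth i
    · simp only [indicator_of_notMem hi]
      exact contMDiff_const
  exact (h1.smoothNear x).congr (hN.mono fun y hy => hy.1.symm)

/-- Locally the sum is finite, and the members omitted from `index L` vanish near `x`, so it agrees
with the full partition sum. -/
theorem localUnit_eventually_one {x : G₀} (hx : Quotient.mk G.orbitSetoid x ∈ U)
    (hxL : x ∈ G.src '' L ∪ G.tgt '' L) : ∀ᶠ y in 𝓝 x, P.localUnit L y = 1 := by
  obtain ⟨N, hN⟩ := P.localUnit_eventuallyEq (L := L) hx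
  have h1 : ∀ i, i ∉ P.index L → ∀ᶠ y in 𝓝 x, P.φ i y = 0 := fun i hi =>
    notMem_tsupport_iff_eventuallyEq.1 fun hx' => hi ⟨x, hx', hxL⟩
  have h2 : ∀ᶠ y in 𝓝 x, ∀ i ∈ Finset.range N, i ∉ P.index L → P.φ i y = 0 :=
    (Filter.eventually_all_finset _).2 fun i _ => Filter.eventually_imp_distrib_left.2 (h1 i)
  filter_upwards [hN, h2] with y hy hy'
  rw [hy.1, ← hy.2]
  refine Finset.sum_congr rfl fun i hi => ?_
  by_cases h : i ∈ P.index L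
  · rw [indicator_of_mem h]
  · rw [indicator_of_notMem h, hy' i hi h]

theorem support_unitFun_localUnit : support (G.unitFun (P.localUnit L)) ⊆ P.unitSet L := by
  refine (G.support_unitFun _).trans ?_
  rintro _ ⟨x, hx, rfl⟩
  by_contra hn
  refine hx (finsum_eq_zero_of_forall_eq_zero fun i => indicator_apply_eq_zero.2 fun hi => ?_)
  by_contra h0
  exact hn (mem_biUnion hi ⟨x, P.tsupport_subset i (subset_tsupport _ h0), rfl⟩)

end UnitPartition

end ProperEtaleLieGroupoid

end

noncomputable section

/-! ### Bornological algebras of sections -/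

theorem isLinearMap_of_add_smul {𝕜 : Type*} [RCLike 𝕜] {V W : Type*} [AddCommGroup V] [Module 𝕜 V]
    [AddCommGroup W] [Module 𝕜 W] {f : V → W} (h : ∀ a b (c : 𝕜), f (a + c • b) = f a + c • f b) :
    IsLinearMap 𝕜 f := by
  have h0 : f 0 = 0 := by simpa using h 0 0 1
  exact ⟨fun a b => by simpa using h a b 1, fun c b => by simpa [h0] using h 0 b c⟩

namespace ProperEtaleLieGroupoid

variable {E : Type*} [NormedAddCommGroup E] [NormedSpace ℝ E]
  {G₀ G₁ : Type*} [TopologicalSpace G₀] [ChartedSpace E G₀]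
  [TopologicalSpace G₁] [ChartedSpace E G₁]
  (G : ProperEtaleLieGroupoid E G₀ G₁)
  {𝕜 : Type*} [RCLike 𝕜] {A : Type*} [AddCommGroup A] [Module 𝕜 A]

/-- Formal power series of smooth functions on the arrows over `U`, extended by zero, with
admissible support and with coefficients of degrees in `Q`. -/
structure IsSection (c : Prop) (U : Opens G.Orbit) (Q : Set ℕ) (a : G₁ → PowerSeries 𝕜) : Prop where
  zero_off : ∀ g ∉ G.arrowsOver U, a g = 0
  regular : G.RegularOn U a
  exists_support : ∃ L, G.Admissible c U L ∧ support a ⊆ L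
  coeff : ∀ l ∉ Q, ∀ g, PowerSeries.coeff l (a g) = 0

/-- A linear embedding whose range is the space of sections. -/
structure IsSectionSpace (c : Prop) (U : Opens G.Orbit) (Q : Set ℕ)
    (ι : A →ₗ[𝕜] G₁ → PowerSeries 𝕜) : Prop where
  injective : Injective ι
  isSection : ∀ a, G.IsSection c U Q (ι a)
  exists_eq : ∀ a, G.IsSection c U Q a → ∃ b, ι b = a

/-- Star products for which the sections with degrees in `Q` are stable under convolution. -/
structure IsConvData [IsManifold 𝓘(ℝ, E) ∞ G₀] (C : ℕ → (G₀ → 𝕜) → (G₀ → 𝕜) → G₀ → 𝕜)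
    (Q : Set ℕ) : Prop where
  star : IsLocalStar E C
  invariant : G.InvariantOps C
  zero_mem : 0 ∈ Q
  vanish : ∀ k, ∀ i ∈ Q, ∀ j ∈ Q, k + (i + j) ∉ Q → ∀ f h x, C k f h x = 0

variable [IsManifold 𝓘(ℝ, E) ∞ G₁]

/-- Bounded sets of sections. -/
def SecBdd (c : Prop) (U : Opens G.Orbit) (ι : A →ₗ[𝕜] G₁ → PowerSeries 𝕜) (S : Set A) : Prop :=
  ∃ L, G.Admissible c U L ∧ (∀ a ∈ S, support (ι a) ⊆ L) ∧
    ∀ D : (G₁ → 𝕜) → G₁ → 𝕜, IsDiffOp E D → ∀ l : ℕ, ∀ K ⊆ G.arrowsOver U, IsCompact K →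
      ∃ r : ℝ, ∀ a ∈ S, ∀ g ∈ K, ‖D (coeffFun l (ι a)) g‖ ≤ r

/-- The values of the derivatives of the coefficients of a section. -/
def functionals (U : Opens G.Orbit) (ι : A →ₗ[𝕜] G₁ → PowerSeries 𝕜) : Set (A →ₗ[𝕜] 𝕜) :=
  {φ | ∃ (D : (G₁ → 𝕜) → G₁ → 𝕜) (l : ℕ) (g : G₁), IsDiffOp E D ∧ g ∈ G.arrowsOver U ∧
    ∀ a, φ a = D (coeffFun l (ι a)) g}

variable {G} {c : Prop} {U : Opens G.Orbit} {Q : Set ℕ} {ι : A →ₗ[𝕜] G₁ → PowerSeries 𝕜}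

theorem SecBdd.mono {S S' : Set A} (h : G.SecBdd c U ι S) (hS : S' ⊆ S) : G.SecBdd c U ι S' := by
  obtain ⟨L, hL, h1, h2⟩ := h
  refine ⟨L, hL, fun a ha => h1 a (hS ha), fun D hD l K hKU hK => ?_⟩
  obtain ⟨r, hr⟩ := h2 D hD l K hKU hK
  exact ⟨r, fun a ha => hr a (hS ha)⟩

theorem SecBdd.union {S S' : Set A} (h : G.SecBdd c U ι S) (h' : G.SecBdd c U ι S') :
    G.SecBdd c U ι (S ∪ S') := by
  obtain ⟨L, hL, h1, h2⟩ := h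
  obtain ⟨L', hL', h1', h2'⟩ := h'
  refine ⟨L ∪ L', hL.union hL', ?_, fun D hD l K hKU hK => ?_⟩
  · rintro a (ha | ha)
    · exact (h1 a ha).trans subset_union_left
    · exact (h1' a ha).trans subset_union_right
  · obtain ⟨r, hr⟩ := h2 D hD l K hKU hK
    obtain ⟨r', hr'⟩ := h2' D hD l K hKU hK
    refine ⟨max r r', ?_⟩
    rintro a (ha | ha) g hg
    · exact (hr a ha g hg).trans (le_max_left _ _)
    · exact (hr' a ha g hg).trans (le_max_right _ _)

omit [IsManifold 𝓘(ℝ, E) ∞ G₁] in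
theorem eventually_zero_of_support [FiniteDimensional ℝ E] [T2Space G₁] {L : Set G₁}
    (hL : G.FibCompactSet U L) {a : G₁ → PowerSeries 𝕜} (ha : support a ⊆ L) {g : G₁}
    (hg : g ∈ G.arrowsOver U) (hgL : g ∉ L) : ∀ᶠ k in 𝓝 g, a k = 0 :=
  (hL.eventually_notMem hg hgL).mono fun _ hk => notMem_support.1 fun hk' => hk (ha hk')

/-! ### Bipolars of bounded sets, and boundedness tested on sequences. -/

section Space

variable (h : G.IsSectionSpace c U Q ι)
include h

omit [IsManifold 𝓘(ℝ, E) ∞ G₁] in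
theorem IsSectionSpace.smoothNear (a : A) {g : G₁} (hg : g ∈ G.arrowsOver U) (l : ℕ) :
    SmoothNear E (coeffFun l (ι a)) g := ((h.isSection a).regular g hg).coeff l

theorem IsSectionSpace.exists_functional {D : (G₁ → 𝕜) → G₁ → 𝕜} (hD : IsDiffOp E D) (l : ℕ)
    {g : G₁} (hg : g ∈ G.arrowsOver U) :
    ∃ φ ∈ G.functionals U ι, ∀ a, φ a = D (coeffFun l (ι a)) g := by
  have hlin : IsLinearMap 𝕜 fun a => D (coeffFun l (ι a)) g := by
    refine isLinearMap_of_add_smul fun a b r => ?_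
    rw [smul_eq_mul, ← hD.add_smul r (h.smoothNear a hg l) (h.smoothNear b hg l), map_add, map_smul,
      coeffFun_add, coeffFun_smul]
    rfl
  exact ⟨hlin.mk' _, ⟨D, l, g, hD, hg, fun _ => rfl⟩, fun _ => rfl⟩

omit [IsManifold 𝓘(ℝ, E) ∞ G₁] in
theorem IsSectionSpace.eq_of_eqOn {a b : A} (hab : EqOn (ι a) (ι b) (G.arrowsOver U)) : a = b := by
  refine h.injective (funext fun g => ?_)
  by_cases hg : g ∈ G.arrowsOver U
  · exact hab hg
  · rw [(h.isSection a).zero_off g hg, (h.isSection b).zero_off g hg]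

/-- Both defining conditions are bounds on functionals of the family: a common support is the bound
`0` on the values off `L`. -/
theorem SecBdd.polar {S : Set A} (hS : G.SecBdd c U ι S) :
    G.SecBdd c U ι (polarHull (G.functionals U ι) S) := by
  obtain ⟨L, hL, h1, h2⟩ := hS
  refine ⟨L, hL, fun a ha g hg => ?_, fun D hD l K hKU hK => ?_⟩
  · by_contra hgL
    have hgU : g ∈ G.arrowsOver U := by
      by_contra hn
      exact hg ((h.isSection a).zero_off g hn)
    refine hg (PowerSeries.ext fun l => ?_)
    obtain ⟨φ, hφ, hφ'⟩ := h.exists_functional (isDiffOp_id (𝕜 := 𝕜) (E := E) (M := G₁)) l hgU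
    have := ha φ hφ 0 le_rfl fun b hb => by
      rw [hφ', coeffFun, notMem_support.1 fun hb' => hgL (h1 b hb hb'), map_zero, norm_zero]
    rw [hφ'] at this
    rw [map_zero]
    exact norm_le_zero_iff.1 this
  · obtain ⟨r, hr⟩ := h2 D hD l K hKU hK
    refine ⟨max r 0, fun a ha g hg => ?_⟩
    obtain ⟨φ, hφ, hφ'⟩ := h.exists_functional hD l (hKU hg)
    rw [← hφ']
    refine ha φ hφ _ (le_max_right _ _) fun b hb => ?_
    rw [hφ']
    exact (hr b hb g hg).trans (le_max_left _ _)

theorem SecBdd.smul {S : Set A} (hS : G.SecBdd c U ι S) (r : 𝕜) : G.SecBdd c U ι (r • S) := by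
  obtain ⟨L, hL, h1, h2⟩ := hS
  refine ⟨L, hL, ?_, fun D hD l K hKU hK => ?_⟩
  · rintro _ ⟨a, ha, rfl⟩
    simp only [map_smul]
    exact (support_const_smul_subset r (ι a)).trans (h1 a ha)
  · obtain ⟨R, hR⟩ := h2 D hD l K hKU hK
    refine ⟨‖r‖ * R, ?_⟩
    rintro _ ⟨a, ha, rfl⟩ g hg
    obtain ⟨φ, -, hφ⟩ := h.exists_functional hD l (hKU hg)
    rw [← hφ]
    simp only [map_smul, smul_eq_mul, norm_mul]
    rw [hφ]
    exact mul_le_mul_of_nonneg_left (hR a ha g hg) (norm_nonneg r)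

variable [FiniteDimensional ℝ E] [T2Space G₁]

theorem SecBdd.unif {S : Set A} (hS : G.SecBdd c U ι S) {x : ℕ → A} (hx : ∀ n, x n ∈ S) {g : G₁}
    (hg : g ∈ G.arrowsOver U) (l : ℕ) :
    UnifSmoothNear E (fun n => coeffFun l (ι (x n))) g := by
  have : LocallyCompactSpace G₁ := Manifold.locallyCompact_of_finiteDimensional 𝓘(ℝ, E)
  obtain ⟨L, hL, h1, h2⟩ := hS
  obtain ⟨N, hN, hNU, hNc⟩ := local_compact_nhds ((G.isOpen_arrowsOver U).mem_nhds hg)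
  refine unifSmoothNear_of_bounds hN (fun n k hk =>
    (h.smoothNear (x n) (hNU hk) l).contMDiffAt.contMDiffWithinAt) fun D hD => ?_
  obtain ⟨r, hr⟩ := h2 D hD l N hNU hNc
  exact ⟨r, fun n y hy => hr _ (hx n) y hy⟩

omit h [T2Space G₁] [FiniteDimensional ℝ E] in
-- If a derivative were unbounded on a compact set, sections violating the bounds `0, 1, 2, …` would
-- form a sequence that is nevertheless locally bounded there, hence bounded by compactness. With
-- `SecBdd.unif`, boundedness becomes a local property of sequences, stable under convolution and
-- gluing.
theorem secBdd_of_unif {S : Set A} {L : Set G₁} (hL : G.Admissible c U L)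
    (h1 : ∀ a ∈ S, support (ι a) ⊆ L) (h2 : ∀ x : ℕ → A, (∀ n, x n ∈ S) →
      ∀ g ∈ G.arrowsOver U, ∀ l, UnifSmoothNear E (fun n => coeffFun l (ι (x n))) g) :
    G.SecBdd c U ι S := by
  refine ⟨L, hL, h1, fun D hD l K hKU hK => ?_⟩
  by_contra! hn
  choose x hx k hk hxk using fun n : ℕ => hn n
  choose! r hr using fun g (hg : g ∈ K) => ((h2 x hx g (hKU hg) l).diffOp hD).bounded
  obtain ⟨t, ht, hcov⟩ := hK.elim_nhds_subcover (fun g => {y | ∀ n, ‖D (coeffFun l (ι (x n))) y‖ ≤ r g})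
    fun g hg => hr g hg
  obtain ⟨m, hm⟩ := (t.image r).bddAbove
  obtain ⟨n, hmn⟩ := exists_nat_gt m
  obtain ⟨g, hg, hgn⟩ := mem_iUnion₂.1 (hcov (hk n))
  have h3 : ‖D (coeffFun l (ι (x n))) (k n)‖ ≤ r g := hgn n
  have h4 : r g ≤ m := hm (Finset.mem_coe.2 (Finset.mem_image_of_mem r hg))
  linarith [hxk n]

omit [T2Space G₁] [FiniteDimensional ℝ E] in
theorem IsSectionSpace.secBdd_singleton (a : A) : G.SecBdd c U ι {a} := by
  obtain ⟨L, hL, hLa⟩ := (h.isSection a).exists_support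
  refine secBdd_of_unif hL (fun b hb => by rwa [mem_singleton_iff.1 hb]) fun x hx g hg l => ?_
  have : x = fun _ => a := funext hx
  subst this
  exact UnifSmoothNear.const (h.smoothNear a hg l)

/-- Bounded sequences are uniformly smooth, so the pointwise ultralimits of their coefficients form
a section with support in the same set, and every functional of the family converges to its value on
that section. -/
theorem isCompletant_polarHull_functionals {S : Set A} (hS : G.SecBdd c U ι S) :
    IsCompletant 𝕜 (polarHull (G.functionals U ι) S) := by
  refine isCompletant_polarHull ?_ ?_ ?_
  · rintro φ ⟨D, l, g, hD, hg, hφ⟩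
    obtain ⟨L, hL, h1, h2⟩ := hS
    obtain ⟨r, hr⟩ := h2 D hD l {g} (singleton_subset_iff.2 hg) isCompact_singleton
    exact ⟨r, fun b hb => by rw [hφ]; exact hr b hb g rfl⟩
  · intro a ha
    refine h.eq_of_eqOn fun g hg => PowerSeries.ext fun l => ?_
    obtain ⟨φ, hφ, hφ'⟩ := h.exists_functional (isDiffOp_id (𝕜 := 𝕜) (E := E) (M := G₁)) l hg
    have := ha φ hφ
    rw [hφ'] at this
    rw [map_zero ι, Pi.zero_apply, map_zero]
    exact this
  · rintro x ⟨r, -, hx⟩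
    have hb := (hS.polar h).smul h (r : 𝕜)
    have hu := fun g hg l => hb.unif h hx (g := g) hg l
    obtain ⟨L, hL, h1, -⟩ := hb
    choose! y hy using fun g hg l => (hu g hg l).exists_ultralimit
    let y' : G₁ → PowerSeries 𝕜 := (G.arrowsOver U).indicator fun g => PowerSeries.mk (y g)
    have hy' : ∀ g ∈ G.arrowsOver U, ∀ l, ∀ᶠ k in 𝓝 g,
        Tendsto (fun n => coeffFun l (ι (x n)) k) (hyperfilter ℕ : Filter ℕ)
          (𝓝 (coeffFun l y' k)) := by
      intro g hg l
      filter_upwards [(G.isOpen_arrowsOver U).mem_nhds hg] with k hk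
      simp only [coeffFun, y', indicator_of_mem hk, PowerSeries.coeff_mk]
      exact hy k hk l
    -- Vanishing of a coefficient at an arrow passes to the ultralimit; this yields both the support
    -- condition and the degree condition.
    have hz : ∀ g l, (∀ n, coeffFun l (ι (x n)) g = 0) → PowerSeries.coeff l (y' g) = 0 := by
      intro g l h0
      by_cases hg : g ∈ G.arrowsOver U
      · refine tendsto_nhds_unique (hy' g hg l).self_of_nhds ?_
        simp only [h0]
        exact tendsto_const_nhds
      · simp only [y', indicator_of_notMem hg, map_zero]
    obtain ⟨b, hb⟩ := h.exists_eq y' ⟨fun g hg => indicator_of_notMem hg _, fun g hg => by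
      filter_upwards [(G.isOpen_arrowsOver U).mem_nhds hg] with k hk l
      exact ((hu k hk l).ultralimit (hy' k hk l)).1, ⟨L, hL, fun g hg => by
        by_contra hgL
        refine hg (PowerSeries.ext fun l => ?_)
        rw [map_zero]
        refine hz g l fun n => ?_
        rw [coeffFun, notMem_support.1 fun hg' => hgL (h1 _ (hx n) hg'), map_zero]⟩,
      fun l hl g => hz g l fun n => (h.isSection (x n)).coeff l hl g⟩
    refine ⟨b, ?_⟩
    rintro φ ⟨D, l, g, hD, hg, hφ⟩
    simp only [hφ, hb]
    exact ((hu g hg l).ultralimit (hy' g hg l)).2 D hD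

omit h [T2Space G₁] [FiniteDimensional ℝ E] in
-- On a compact set only finitely many indices matter, so no uniformity in `i` is needed in `hb`.
-- This is why the members may carry arbitrary weights such as `2 ^ i`.
theorem secBdd_of_locallyFinite {S : Set A} {b : A → ℕ → A} {L : Set G₁} (hL : G.Admissible c U L)
    (hbL : ∀ a ∈ S, ∀ i, support (ι (b a i)) ⊆ L)
    (hb : ∀ i, G.SecBdd c U ι ((fun a => b a i) '' S))
    (hfin : ∀ g ∈ G.arrowsOver U, ∃ N, ∀ᶠ k in 𝓝 g, ∀ a ∈ S, ∀ i, N ≤ i → ι (b a i) k = 0) :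
    G.SecBdd c U ι (image2 b S univ) := by
  refine ⟨L, hL, ?_, fun D hD l K hKU hK => ?_⟩
  · rintro _ ⟨a, ha, i, -, rfl⟩
    exact hbL a ha i
  · choose! N hN using fun g (hg : g ∈ K) => hfin g (hKU hg)
    obtain ⟨t, ht, hcov⟩ := hK.elim_nhds_subcover
      (fun g => {k | ∀ᶠ k' in 𝓝 k, ∀ a ∈ S, ∀ i, N g ≤ i → ι (b a i) k' = 0})
      fun g hg => (hN g hg).eventually_nhds
    choose L' _ _ hr using hb
    choose r hr using fun i => hr i D hD l K hKU hK
    refine ⟨∑ i ∈ Finset.range (t.sup N), |r i|, ?_⟩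
    rintro _ ⟨a, ha, i, -, rfl⟩ k hk
    by_cases hi : i < t.sup N
    · exact ((hr i _ ⟨a, ha, rfl⟩ k hk).trans (le_abs_self _)).trans
        (Finset.single_le_sum (f := fun i => |r i|) (fun i _ => abs_nonneg _)
          (Finset.mem_range.2 hi))
    · obtain ⟨g, hg, hkg⟩ := mem_iUnion₂.1 (hcov hk)
      have h0 : coeffFun l (ι (b a i)) =ᶠ[𝓝 k] fun _ => 0 := by
        have hkg' : ∀ᶠ k' in 𝓝 k, ∀ a ∈ S, ∀ i, N g ≤ i → ι (b a i) k' = 0 := hkg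
        filter_upwards [hkg'] with k' hk'
        rw [coeffFun, hk' a ha i ((Finset.le_sup hg).trans (not_lt.1 hi)), map_zero]
      rw [hD.congr h0, hD.zero, norm_zero]
      exact Finset.sum_nonneg fun i _ => abs_nonneg _

end Space

end ProperEtaleLieGroupoid

end

noncomputable section

/-! ### The convolution algebra of sections -/

namespace ProperEtaleLieGroupoid

variable {E : Type*} [NormedAddCommGroup E] [NormedSpace ℝ E] [FiniteDimensional ℝ E]
  {G₀ G₁ : Type*} [TopologicalSpace G₀] [ChartedSpace E G₀] [IsManifold 𝓘(ℝ, E) ∞ G₀] [T2Space G₀]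
  [TopologicalSpace G₁] [ChartedSpace E G₁] [T2Space G₁]
  {G : ProperEtaleLieGroupoid E G₀ G₁}
  {𝕜 : Type*} [RCLike 𝕜] {A : Type*} [AddCommGroup A] [Module 𝕜 A]
  {c : Prop} {U : Opens G.Orbit} {Q : Set ℕ} {ι : A →ₗ[𝕜] G₁ → PowerSeries 𝕜}
  {C : ℕ → (G₀ → 𝕜) → (G₀ → 𝕜) → G₀ → 𝕜}

theorem IsSection.starConv (hd : G.IsConvData C Q) {a b : G₁ → PowerSeries 𝕜}
    (ha : G.IsSection c U Q a) (hb : G.IsSection c U Q b) :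
    G.IsSection c U Q ((G.arrowsOver U).indicator (G.starConv C a b)) := by
  obtain ⟨L, hL, haL⟩ := ha.exists_support
  obtain ⟨L', hL', hbL⟩ := hb.exists_support
  have hB := hd.star.bidiff
  refine ⟨fun g hg => indicator_of_notMem hg _, fun g hg => ?_, ⟨G.mulSet L L', hL.mulSet hL',
    fun g hg => ?_⟩, fun l hl g => ?_⟩
  · refine (regularOn_starConv hB hL'.1 ha.regular hb.regular hbL g hg).congr ?_
    filter_upwards [(G.isOpen_arrowsOver U).mem_nhds hg] with k hk
    rw [indicator_of_mem hk]
  · have hgU : g ∈ G.arrowsOver U := mem_of_indicator_ne_zero hg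
    rw [mem_support, indicator_of_mem hgU] at hg
    exact support_starConv hB ha.regular hb.regular hL.1 hL'.1 haL hbL hgU hg
  · by_cases hg : g ∈ G.arrowsOver U
    · obtain ⟨H, hH, hH'⟩ := exists_fibre hL'.1 (G.src g)
      rw [indicator_of_mem hg, starConv_eq_sum_of_support hB ha.regular hL'.1 hbL hg hH hH', map_sum]
      refine Finset.sum_eq_zero fun h hh => ?_
      have s1 := ha.regular.divSec (hH h hh).symm hg
      have s2 := hb.regular.sec (mem_arrowsOver_of_src_eq (hH h hh) hg)
      rw [hH h hh] at s1 s2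
      rw [convTerm, coeff_starOf]
      refine Finset.sum_eq_zero fun q hq => Finset.sum_eq_zero fun r hr => ?_
      -- If both coefficients have degree in `Q`, the operator vanishes by `vanish`; otherwise one
      -- argument is zero, and bilinearity of the operator on germs gives zero.
      by_cases h1 : r.1 ∈ Q
      · by_cases h2 : r.2 ∈ Q
        · refine hd.vanish q.1 r.1 h1 r.2 h2 ?_ _ _ _
          rw [Finset.HasAntidiagonal.mem_antidiagonal.1 hr, Finset.HasAntidiagonal.mem_antidiagonal.1 hq]
          exact hl
        · have e : coeffFun r.2 (fun x => b (G.sec h x)) = fun _ => (0 : 𝕜) + 0 * 0 :=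
            funext fun x => by simpa [coeffFun] using hb.coeff r.2 h2 (G.sec h x)
          have hz : SmoothNear E (fun _ : G₀ => (0 : 𝕜)) (G.src g) := contMDiff_const.smoothNear _
          rw [e, (hB q.1).add_smul_right 0 (s1.coeff r.1) hz hz]
          have h3 := (hB q.1).add_smul_right 1 (s1.coeff r.1) hz hz
          simpa using h3
      · have e : coeffFun r.1 (fun x => a (G.divSec g h x)) = fun _ => (0 : 𝕜) + 0 * 0 :=
          funext fun x => by simpa [coeffFun] using ha.coeff r.1 h1 (G.divSec g h x)
        have hz : SmoothNear E (fun _ : G₀ => (0 : 𝕜)) (G.src g) := contMDiff_const.smoothNear _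
        rw [e, (hB q.1).add_smul_left 0 hz hz (s2.coeff r.2)]
        have h3 := (hB q.1).add_smul_left 1 hz hz (s2.coeff r.2)
        simpa using h3
    · rw [indicator_of_notMem hg, map_zero]

section Algebra

variable (h : G.IsSectionSpace c U Q ι) (hd : G.IsConvData C Q)
include h hd

theorem IsSectionSpace.exists_mul (a b : A) :
    ∃ m : A, ι m = (G.arrowsOver U).indicator (G.starConv C (ι a) (ι b)) :=
  h.exists_eq _ ((h.isSection a).starConv hd (h.isSection b))

/-- The product of two sections. -/
def IsSectionSpace.mulElem (a b : A) : A := (h.exists_mul hd a b).choose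

theorem IsSectionSpace.mulElem_apply (a b : A) {g : G₁} (hg : g ∈ G.arrowsOver U) :
    ι (h.mulElem hd a b) g = G.starConv C (ι a) (ι b) g := by
  rw [mulElem, (h.exists_mul hd a b).choose_spec, indicator_of_mem hg]

/-- The product of sections as a bilinear map. -/
def IsSectionSpace.mul : A →ₗ[𝕜] A →ₗ[𝕜] A :=
  IsLinearMap.mk' (fun a => IsLinearMap.mk' (h.mulElem hd a)
    (isLinearMap_of_add_smul fun b b' r => h.eq_of_eqOn fun g hg => by
      obtain ⟨L, hL, hbL⟩ := (h.isSection b).exists_support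
      obtain ⟨L', hL', hbL'⟩ := (h.isSection b').exists_support
      rw [map_add ι (h.mulElem hd a b), map_smul, Pi.add_apply, Pi.smul_apply,
        h.mulElem_apply hd _ _ hg, h.mulElem_apply hd _ _ hg, h.mulElem_apply hd _ _ hg, map_add,
        map_smul]
      exact starConv_add_smul_right hd.star.bidiff (hL.union hL').1 r (h.isSection a).regular
        (h.isSection b).regular (h.isSection b').regular (hbL.trans subset_union_left)
        (hbL'.trans subset_union_right) hg))
    (isLinearMap_of_add_smul fun a a' r => LinearMap.ext fun b => h.eq_of_eqOn fun g hg => by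
      obtain ⟨L, hL, hbL⟩ := (h.isSection b).exists_support
      rw [LinearMap.add_apply, LinearMap.smul_apply, IsLinearMap.mk'_apply, IsLinearMap.mk'_apply,
        IsLinearMap.mk'_apply, map_add, map_smul, Pi.add_apply, Pi.smul_apply,
        h.mulElem_apply hd _ _ hg, h.mulElem_apply hd _ _ hg, h.mulElem_apply hd _ _ hg,
        map_add, map_smul]
      exact starConv_add_smul_left hd.star.bidiff hL.1 r (h.isSection a).regular
        (h.isSection a').regular (h.isSection b).regular hbL hg)

theorem IsSectionSpace.mul_apply (a b : A) {g : G₁} (hg : g ∈ G.arrowsOver U) :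
    ι (h.mul hd a b) g = G.starConv C (ι a) (ι b) g :=
  h.mulElem_apply hd a b hg

variable [IsManifold 𝓘(ℝ, E) ∞ G₁]

/-- Products of uniformly smooth sequences are uniformly smooth, with supports in the set of
products of the two supports. -/
theorem SecBdd.mul {S T : Set A} (hS : G.SecBdd c U ι S) (hT : G.SecBdd c U ι T) :
    G.SecBdd c U ι (image2 (fun a b => h.mul hd a b) S T) := by
  have hu := fun x hx g hg l => hS.unif h (x := x) hx (g := g) hg l
  have hu' := fun x hx g hg l => hT.unif h (x := x) hx (g := g) hg l
  obtain ⟨L, hL, h1, -⟩ := hS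
  obtain ⟨L', hL', h1', -⟩ := hT
  have hB := hd.star.bidiff
  refine secBdd_of_unif (hL.mulSet hL') ?_ ?_
  · rintro _ ⟨a, ha, b, hb, rfl⟩ g hg
    have hgU : g ∈ G.arrowsOver U := by
      by_contra hn
      exact hg ((h.isSection _).zero_off g hn)
    rw [mem_support, h.mul_apply hd a b hgU] at hg
    exact support_starConv hB (h.isSection a).regular (h.isSection b).regular hL.1 hL'.1
      (h1 a ha) (h1' b hb) hgU hg
  · intro x hx g hg l
    choose a ha b hb hab using hx
    refine (unifSmoothNear_starConv hB hL'.1 (fun n => (h.isSection (a n)).regular)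
      (fun n => (h.isSection (b n)).regular) (fun n => h1' _ (hb n)) (hu a ha) (hu' b hb) hg
      l).congr ?_
    filter_upwards [(G.isOpen_arrowsOver U).mem_nhds hg] with k hk n
    rw [← hab n, coeffFun, coeffFun, h.mul_apply hd _ _ hk]

omit hd [FiniteDimensional ℝ E] [IsManifold 𝓘(ℝ, E) ∞ G₀] [T2Space G₀] [T2Space G₁] in
/-- The bornology of the space of sections. -/
def IsSectionSpace.born : ConvexBornology 𝕜 A :=
  ConvexBornology.ofPolar (G.SecBdd c U ι) (G.functionals U ι)
    (fun _ hS _ hS' => hS.mono hS') (fun _ hS _ hS' => hS.union hS') h.secBdd_singleton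
    (fun r _ hS => hS.smul h r) (fun _ hS => hS.polar h)

omit hd [FiniteDimensional ℝ E] [IsManifold 𝓘(ℝ, E) ∞ G₀] [T2Space G₀] [T2Space G₁] in
theorem IsSectionSpace.bdd_born {S : Set A} : h.born.Bdd S ↔ G.SecBdd c U ι S :=
  ConvexBornology.bdd_ofPolar (Λ := G.functionals U ι) (h₄ := fun r _ hS => hS.smul h r)
    (h₅ := fun _ hS => hS.polar h)

/-- The bornological algebra of sections. -/
def IsSectionSpace.bornAlg : BornAlg 𝕜 A where
  born := h.born
  complete S hS := ⟨polarHull (G.functionals U ι) S, subset_polarHull _ _,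
    h.bdd_born.2 ((h.bdd_born.1 hS).polar h),
    isCompletant_polarHull_functionals h (h.bdd_born.1 hS)⟩
  mul := h.mul hd
  mul_assoc x y z := h.eq_of_eqOn fun g hg => by
    obtain ⟨L, hL, h1⟩ := (h.isSection y).exists_support
    obtain ⟨L', hL', h1'⟩ := (h.isSection z).exists_support
    obtain ⟨L'', hL'', h1''⟩ := (h.isSection (h.mul hd y z)).exists_support
    rw [h.mul_apply hd _ _ hg, h.mul_apply hd _ _ hg]
    exact starConv_assoc hd.star hd.invariant (h.isSection x).regular (h.isSection y).regular
      (h.isSection z).regular hL.1 hL'.1 hL''.1 h1 h1' (fun k hk => h.mul_apply hd x y hk)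
      (fun k hk => h.mul_apply hd y z hk) h1'' hg
  mul_bdd S T hS hT := h.bdd_born.2
    ((h.bdd_born.1 hS).mul h hd (h.bdd_born.1 hT))

theorem IsSectionSpace.bdd_bornAlg {S : Set A} :
    (h.bornAlg hd).born.Bdd S ↔ G.SecBdd c U ι S :=
  h.bdd_born

end Algebra

end ProperEtaleLieGroupoid

end

noncomputable section

/-! ### Algebras of sections are quasi-unital -/

namespace ProperEtaleLieGroupoid

variable {E : Type*} [NormedAddCommGroup E] [NormedSpace ℝ E] [FiniteDimensional ℝ E]
  {G₀ G₁ : Type*} [TopologicalSpace G₀] [ChartedSpace E G₀] [IsManifold 𝓘(ℝ, E) ∞ G₀] [T2Space G₀]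
  [TopologicalSpace G₁] [ChartedSpace E G₁] [T2Space G₁]
  {G : ProperEtaleLieGroupoid E G₀ G₁}
  {𝕜 : Type*} [RCLike 𝕜] {A : Type*} [AddCommGroup A] [Module 𝕜 A]
  {c : Prop} {U : Opens G.Orbit} {Q : Set ℕ} {ι : A →ₗ[𝕜] G₁ → PowerSeries 𝕜}
  {C : ℕ → (G₀ → 𝕜) → (G₀ → 𝕜) → G₀ → 𝕜}

omit [FiniteDimensional ℝ E] [IsManifold 𝓘(ℝ, E) ∞ G₀] [T2Space G₀] in
theorem IsSectionSpace.exists_unitFun (h : G.IsSectionSpace c U Q ι) (hQ : 0 ∈ Q) {v : G₀ → 𝕜}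
    (hv : ∀ x, Quotient.mk G.orbitSetoid x ∈ U → SmoothNear E v x) {L : Set G₁}
    (hL : G.Admissible c U L) (hvL : support (G.unitFun v) ⊆ L) : ∃ e, ι e = G.unitFun v :=
  h.exists_eq _ ⟨fun _ hg => notMem_support.1 fun hg' => hg (hL.1.1 (hvL hg')),
    regularOn_unitFun hv, ⟨L, hL, hvL⟩,
    fun _ hl g => G.coeff_unitFun v (ne_of_mem_of_not_mem hQ hl).symm g⟩

variable [IsManifold 𝓘(ℝ, E) ∞ G₁] [SecondCountableTopology G₀]

/-- A criterion for projectivity which applies to the algebra of sections and to its opposite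
algebra, with `p` the source and the target map, respectively. -/
theorem IsSectionSpace.isProjective (h : G.IsSectionSpace c U Q ι) (hQ : 0 ∈ Q) (B : BornAlg 𝕜 A)
    (hB : ∀ S, B.born.Bdd S ↔ G.SecBdd c U ι S) {p : G₁ → G₀} (hp : Continuous p)
    (hp1 : ∀ x, p (G.one x) = x) (hpst : ∀ g, p g = G.src g ∨ p g = G.tgt g)
    (h0 : ∀ (a e : A) (v : G₀ → 𝕜), ι e = G.unitFun v →
      (∀ x, Quotient.mk G.orbitSetoid x ∈ U → SmoothNear E v x) → ∀ g ∈ G.arrowsOver U,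
      (∀ᶠ x in 𝓝 (p g), v x = 0) → ι (B.mul a e) g = 0)
    (h1 : ∀ (a e : A) (v : G₀ → 𝕜), ι e = G.unitFun v →
      (∀ x, Quotient.mk G.orbitSetoid x ∈ U → SmoothNear E v x) → ∀ g ∈ G.arrowsOver U,
      ((∀ᶠ x in 𝓝 (p g), v x = 1) ∨ ∀ᶠ k in 𝓝 g, ι a k = 0) → ι (B.mul a e) g = ι a g) :
    BornModule.IsProjective.{w} B.self := by
  classical
  obtain ⟨P⟩ := G.nonempty_unitPartition 𝕜 U
  have hφ : ∀ i x, Quotient.mk G.orbitSetoid x ∈ U → SmoothNear E (P.φ i) x := fun i x _ =>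
    (P.smooth i).smoothNear x
  have hcut : ∀ i x, Quotient.mk G.orbitSetoid x ∈ U → SmoothNear E (P.cut i) x := fun i x _ =>
    (P.smooth_cut i).smoothNear x
  have hadm : ∀ i, G.Admissible c U (G.one '' tsupport (P.cut i)) := fun i => by
    refine ((P.compact_cut i).image G.smooth_one.continuous).admissible ?_
    rintro _ ⟨x, hx, rfl⟩
    rw [arrowsOver, mem_preimage, G.proj_one]
    exact P.cut_subset i x hx
  choose e he using fun i => h.exists_unitFun hQ (hφ i) (hadm i) ((G.support_unitFun _).trans
    (image_mono ((subset_tsupport _).trans (P.tsupport_subset i))))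
  choose e' he' using fun i => h.exists_unitFun hQ (hcut i) (hadm i) ((G.support_unitFun _).trans
    (image_mono (subset_tsupport _)))
  have hpU : ∀ g ∈ G.arrowsOver U, Quotient.mk G.orbitSetoid (p g) ∈ U := by
    intro g hg
    rcases hpst g with hp | hp
    · rw [hp]
      exact hg
    · rw [hp, ← G.proj_eq_tgt]
      exact hg
  refine B.isProjective_self_of_local_units e e' (fun i => ?_) fun S hS => ?_
  -- At each arrow either the cutoff is `1` near `p g`, or `φ i` vanishes there and hence `e i`
  -- vanishes near `g`.
  · refine h.eq_of_eqOn fun g hg => h1 _ _ _ (he' i) (hcut i) g hg ?_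
    by_cases hx : p g ∈ tsupport (P.φ i)
    · exact Or.inl (P.cut_one i _ hx)
    · right
      rw [he]
      exact unitFun_eventually_zero hp hp1 (notMem_tsupport_iff_eventuallyEq.1 hx)
  rw [hB] at hS
  obtain ⟨L, hL, hSL, -⟩ := id hS
  -- A partial sum of the `e i` is again a function on the units, so the product with it is also
  -- governed by `h1`.
  let s : ℕ → A := fun n => ∑ i ∈ Finset.range n, e i
  have hs : ∀ n, ι (s n) = G.unitFun fun x => ∑ i ∈ Finset.range n, P.φ i x := fun n => by
    rw [G.unitFun_sum, map_sum]
    exact Finset.sum_congr rfl fun i _ => he i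
  have hsφ : ∀ n x, Quotient.mk G.orbitSetoid x ∈ U →
      SmoothNear E (fun x => ∑ i ∈ Finset.range n, P.φ i x) x := fun n x _ =>
    (contMDiff_finsetSum fun i _ => P.smooth i).smoothNear x
  have hsum : ∀ a n, ∑ i ∈ Finset.range n, B.mul a (e i) = B.mul a (s n) := fun a n =>
    (map_sum (B.mul a) e _).symm
  have hout : ∀ a ∈ S, ∀ g ∈ G.arrowsOver U, g ∉ L → ∀ᶠ k in 𝓝 g, ι a k = 0 :=
    fun a ha g hg hgL => eventually_zero_of_support hL.1 (hSL a ha) hg hgL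
  have hmem : ∀ (a : A) g, ι a g ≠ 0 → g ∈ G.arrowsOver U := fun a g hg => by
    by_contra hn
    exact hg ((h.isSection a).zero_off g hn)
  have hfin : ∀ g ∈ G.arrowsOver U, ∃ N, ∀ᶠ k in 𝓝 g, k ∈ G.arrowsOver U ∧
      ∀ᶠ y in 𝓝 (p k), (∀ i ≥ N, P.φ i y = 0) ∧
        ∀ n ≥ N, ∑ i ∈ Finset.range n, P.φ i y = 1 := by
    intro g hg
    obtain ⟨N, hN⟩ := P.sum_one {p g} isCompact_singleton (by simpa using hpU g hg)
    exact ⟨N, Filter.Eventually.and ((G.isOpen_arrowsOver U).mem_nhds hg)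
      (hp.continuousAt.eventually (hN _ rfl).eventually_nhds)⟩
  refine ⟨P.index L, ?_, ?_, ?_, ?_⟩
  · rw [hB]
    -- Replacing the cutoffs outside `index L` by zero gives a family indexed by all of `ℕ`, locally
    -- finite by `eventually_unitFun_cut`; the parameter set `{0}` is a dummy.
    have hb : G.SecBdd c U ι (image2 (fun _ i => if i ∈ P.index L then e' i else 0) {(0 : A)}
        univ) := by
      refine secBdd_of_locallyFinite (P.admissible_unitSet hL) (fun a _ i => ?_) (fun i => ?_)
        fun g hg => ?_
      · split_ifs with hi
        · rw [he']
          exact P.support_unitFun_cut hi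
        · rw [map_zero, support_zero]
          exact empty_subset _
      · rw [image_singleton]
        exact h.secBdd_singleton _
      · obtain ⟨N, hN⟩ := P.eventually_unitFun_cut hL.1 hg
        refine ⟨N, hN.mono fun k hk a _ i hi => ?_⟩
        split_ifs with hiI
        · rw [he', hk i hiI hi]
        · rw [map_zero, Pi.zero_apply]
    refine hb.mono ?_
    rintro _ ⟨i, hi, rfl⟩
    exact ⟨0, rfl, i, trivial, if_pos hi⟩
  · intro a ha i hi
    refine h.eq_of_eqOn fun g hg => ?_
    rw [map_zero, Pi.zero_apply]
    by_cases hgL : g ∈ L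
    · refine h0 _ _ _ (he i) (hφ i) g hg (notMem_tsupport_iff_eventuallyEq.1 fun hx => hi
        ⟨p g, hx, ?_⟩)
      rcases hpst g with hp | hp
      · exact Or.inl ⟨g, hgL, hp.symm⟩
      · exact Or.inr ⟨g, hgL, hp.symm⟩
    · rw [h1 _ _ _ (he i) (hφ i) g hg (Or.inr (hout a ha g hg hgL)),
        (hout a ha g hg hgL).self_of_nhds]
  · rw [hB]
    refine secBdd_of_locallyFinite hL (fun a ha i g hg => ?_) (fun i => ?_) fun g hg => ?_
    · by_contra hgL
      have hgU := hmem _ g hg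
      refine hg ?_
      rw [map_smul, Pi.smul_apply, h1 _ _ _ (he i) (hφ i) g hgU (Or.inr (hout a ha g hgU hgL)),
        (hout a ha g hgU hgL).self_of_nhds, smul_zero]
    · have hb := (B.mul_bdd S {e i} ((hB S).2 hS) (B.born.bdd_singleton _)).smul ((2 : 𝕜) ^ i)
      refine ((hB _).1 hb).mono ?_
      rintro _ ⟨a, ha, rfl⟩
      exact ⟨_, ⟨a, ha, _, rfl, rfl⟩, rfl⟩
    -- Near `g` all members with large index vanish at `p`, so their products with any section do
    -- too, whatever the weight.
    · obtain ⟨N, hN⟩ := hfin g hg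
      refine ⟨N, hN.mono fun k hk a _ i hi => ?_⟩
      rw [map_smul, Pi.smul_apply, h0 _ _ _ (he i) (hφ i) k hk.1 (hk.2.mono fun y hy => hy.1 i hi),
        smul_zero]
  · rw [hB]
    simp only [hsum]
    refine secBdd_of_locallyFinite hL (fun a ha i g hg => ?_) (fun i => ?_) fun g hg => ?_
    · by_contra hgL
      have hgU := hmem _ g hg
      refine hg ?_
      rw [map_smul, Pi.smul_apply, map_sub, Pi.sub_apply,
        h1 _ _ _ (hs i) (hsφ i) g hgU (Or.inr (hout a ha g hgU hgL)), sub_self, smul_zero]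
    · have hb := ((B.mul_bdd S {s i} ((hB S).2 hS) (B.born.bdd_singleton _)).add
        (((hB S).2 hS).smul (-1))).smul ((2 : 𝕜) ^ i)
      refine ((hB _).1 hb).mono ?_
      rintro _ ⟨a, ha, rfl⟩
      refine ⟨_, ⟨_, ⟨a, ha, _, rfl, rfl⟩, _, ⟨a, ha, rfl⟩, rfl⟩, ?_⟩
      simp only [neg_smul, one_smul, sub_eq_add_neg]
    -- Near `g` the partial sums are eventually `1` at `p`, so the error term is exactly zero there.
    · obtain ⟨N, hN⟩ := hfin g hg
      refine ⟨N, hN.mono fun k hk a _ i hi => ?_⟩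
      rw [map_smul, Pi.smul_apply, map_sub, Pi.sub_apply, h1 _ _ _ (hs i) (hsφ i) k hk.1
        (Or.inl (hk.2.mono fun y hy => hy.2 i hi)), sub_self, smul_zero]

/-- The bipolar serves as the monotone hull. A bounded set has a common support `L`, and `localUnit
L`, being `1` near the sources and targets of `L`, gives one element that is a unit from both sides.
-/
theorem IsSectionSpace.quasiUnital (h : G.IsSectionSpace c U Q ι) (hd : G.IsConvData C Q) :
    BornAlg.QuasiUnital.{w} (h.bornAlg hd) := by
  have hB := hd.star.bidiff
  refine ⟨?_, ?_, ?_⟩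
  · obtain ⟨P⟩ := G.nonempty_unitPartition 𝕜 U
    refine (h.bornAlg hd).hasApproximateIdentity_of_local_units
      (fun S => polarHull (G.functionals U ι) S) (fun _ _ hS => polarHull_mono _ hS)
      (fun S => subset_polarHull _ S) (fun S hS => ?_) fun S hS => ?_
    · rw [h.bdd_bornAlg] at hS ⊢
      exact ⟨hS.polar h, isCompletant_polarHull_functionals h hS⟩
    · rw [h.bdd_bornAlg] at hS
      obtain ⟨L, hL, hSL, -⟩ := hS
      have hv : ∀ x, Quotient.mk G.orbitSetoid x ∈ U → SmoothNear E (P.localUnit L) x :=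
        fun x hx => P.smoothNear_localUnit hx
      obtain ⟨u, hu⟩ := h.exists_unitFun hd.zero_mem hv (P.admissible_unitSet hL)
        P.support_unitFun_localUnit
      refine ⟨u, fun a ha => ⟨h.eq_of_eqOn fun g hg => ?_, h.eq_of_eqOn fun g hg => ?_⟩⟩
      · refine (h.mul_apply hd u a hg).trans ?_
        rw [hu]
        refine starConv_unitFun_left_eq_self hd.star (h.isSection a).regular hv hg ?_
        by_cases hgL : g ∈ L
        · refine Or.inl (P.localUnit_eventually_one ?_ (Or.inr ⟨g, hgL, rfl⟩))
          rw [← G.proj_eq_tgt]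
          exact hg
        · exact Or.inr (eventually_zero_of_support hL.1 (hSL a ha) hg hgL)
      · refine (h.mul_apply hd a u hg).trans ?_
        rw [hu]
        refine starConv_unitFun_right_eq_self hd.star (h.isSection a).regular hv hg ?_
        by_cases hgL : g ∈ L
        · exact Or.inl (P.localUnit_eventually_one hg (Or.inl ⟨g, hgL, rfl⟩))
        · exact Or.inr (eventually_zero_of_support hL.1 (hSL a ha) hg hgL)
  · refine h.isProjective hd.zero_mem (h.bornAlg hd) (fun S => h.bdd_bornAlg hd) G.continuous_src
      G.src_one (fun g => Or.inl rfl) (fun a e v he hv g hg h0 => ?_) fun a e v he hv g hg h1 => ?_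
    · refine (h.mul_apply hd a e hg).trans ?_
      rw [he]
      exact starConv_unitFun_right_eq_zero hB (h.isSection a).regular hv hg h0
    · refine (h.mul_apply hd a e hg).trans ?_
      rw [he]
      exact starConv_unitFun_right_eq_self hd.star (h.isSection a).regular hv hg h1
  -- In the opposite algebra the unit function multiplies from the left, so it is read at the
  -- target.
  · refine h.isProjective hd.zero_mem (h.bornAlg hd).op (fun S => h.bdd_bornAlg hd) G.continuous_tgt
      G.tgt_one (fun g => Or.inr rfl) (fun a e v he hv g hg h0 => ?_) fun a e v he hv g hg h1 => ?_
    · refine (h.mul_apply hd e a hg).trans ?_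
      rw [he]
      exact starConv_unitFun_left_eq_zero hB (h.isSection a).regular hv hg h0
    · refine (h.mul_apply hd e a hg).trans ?_
      rw [he]
      exact starConv_unitFun_left_eq_self hd.star (h.isSection a).regular hv hg h1

end ProperEtaleLieGroupoid

end

noncomputable section

/-! ### The sheaf of algebras of sections -/

namespace ProperEtaleLieGroupoid

variable {E : Type*} [NormedAddCommGroup E] [NormedSpace ℝ E]
  {G₀ G₁ : Type*} [TopologicalSpace G₀] [ChartedSpace E G₀] [IsManifold 𝓘(ℝ, E) ∞ G₀]
  [TopologicalSpace G₁] [ChartedSpace E G₁]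
  {G : ProperEtaleLieGroupoid E G₀ G₁}
  {𝕜 : Type*} [RCLike 𝕜] {Q : Set ℕ} {C : ℕ → (G₀ → 𝕜) → (G₀ → 𝕜) → G₀ → 𝕜}

/-- Both factors of an arrow over `U` lie over `U`, and the arrows over `U` form an open set, so
only germs over `U` enter. -/
theorem starConv_congr (hC : ∀ k, IsBidiffOp E (C k)) {U : Opens G.Orbit}
    {a a' b b' : G₁ → PowerSeries 𝕜} (ha : G.RegularOn U a) (hb : G.RegularOn U b)
    (haa : EqOn a a' (G.arrowsOver U)) (hbb : EqOn b b' (G.arrowsOver U)) {g : G₁}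
    (hg : g ∈ G.arrowsOver U) : G.starConv C a b g = G.starConv C a' b' g := by
  refine finsum_congr ?_
  rintro ⟨⟨k, h⟩, hkh, rfl⟩
  have e : G.src (G.mul k h) = G.src h := G.src_mul k h hkh
  have hk : G.mul (G.mul k h) (G.inv h) = k := G.mul_inv_cancel_right hkh
  have hU := (G.isOpen_arrowsOver U).mem_nhds (mul_inv_mem_arrowsOver e hg)
  have hU' := (G.isOpen_arrowsOver U).mem_nhds (mem_arrowsOver_of_src_eq e.symm hg)
  have e1 := eventuallyEq_divSec e (haa.eventuallyEq_of_mem hU)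
  have e2 := eventuallyEq_sec (G := G) (hbb.eventuallyEq_of_mem hU')
  have s1 := ha.divSec e hg
  have s2 := hb.sec (mem_arrowsOver_of_src_eq e.symm hg)
  have := starOf_congr hC s1 s2 e1 e2
  simp only [divSec, hk] at this
  change starOf C (fun x => a (G.sec k (G.tgt (G.sec h x)))) (fun x => b (G.sec h x)) _ =
    starOf C (fun x => a' (G.sec k (G.tgt (G.sec h x)))) (fun x => b' (G.sec h x)) _
  rw [e]
  exact this

variable [FiniteDimensional ℝ E] [T2Space G₀] [T2Space G₁] [IsManifold 𝓘(ℝ, E) ∞ G₁]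
  {A : Opens G.Orbit → Type*} [∀ U, AddCommGroup (A U)] [∀ U, Module 𝕜 (A U)]
  {ι : ∀ U, A U →ₗ[𝕜] G₁ → PowerSeries 𝕜}

omit [IsManifold 𝓘(ℝ, E) ∞ G₀] [T2Space G₀] [IsManifold 𝓘(ℝ, E) ∞ G₁] in
-- Each orbit has a compact neighbourhood inside a member of the cover, over which `T` lies in a
-- compact set; the relative closure of `T` is then fibrewise compact.
theorem exists_admissible_of_cover {s : Set (Opens G.Orbit)} {T : Set G₁}
    (hT : T ⊆ G.arrowsOver (sSup s : Opens G.Orbit))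
    (h : ∀ U ∈ s, ∃ L, G.Admissible False U L ∧ T ∩ G.arrowsOver U ⊆ L) :
    ∃ L, G.Admissible False (sSup s) L ∧ T ⊆ L := by
  have := G.locallyCompactSpace_orbit
  refine ⟨closure T ∩ G.arrowsOver (sSup s : Opens G.Orbit), ⟨fibCompactSet_closure ?_, False.elim⟩,
    fun g hg => ⟨subset_closure hg, hT hg⟩⟩
  intro x hx
  obtain ⟨U, hU, hxU⟩ := Opens.mem_sSup.1 hx
  obtain ⟨L, hL, hTL⟩ := h U hU
  obtain ⟨K, hK, hKU, hKc⟩ := local_compact_nhds (U.isOpen.mem_nhds hxU)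
  exact ⟨K, hK, _, hL.1.2 K hKU hKc, fun g hg => ⟨hTL ⟨hg.1, hKU hg.2⟩, hg.2⟩⟩

theorem isBornAlgSheaf (h : ∀ U, G.IsSectionSpace False U Q (ι U)) (hd : G.IsConvData C Q)
    (res : ∀ U V : Opens G.Orbit, V ≤ U → A U →ₗ[𝕜] A V)
    (hres : ∀ U V hV a, ι V (res U V hV a) = (G.arrowsOver V).indicator (ι U a)) :
    IsBornAlgSheaf (fun U => (h U).bornAlg hd) res := by
  have hres' : ∀ U V hV a, EqOn (ι V (res U V hV a)) (ι U a) (G.arrowsOver V) :=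
    fun U V hV a g hg => by rw [hres, indicator_of_mem hg]
  have hmono : ∀ {U V : Opens G.Orbit}, V ≤ U → G.arrowsOver V ⊆ G.arrowsOver U :=
    fun hV => preimage_mono hV
  have hcov : ∀ {s : Set (Opens G.Orbit)} {g}, g ∈ G.arrowsOver (sSup s : Opens G.Orbit) →
      ∃ U : s, g ∈ G.arrowsOver (U : Opens G.Orbit) := fun hg => by
    obtain ⟨U, hU, hgU⟩ := Opens.mem_sSup.1 hg
    exact ⟨⟨U, hU⟩, hgU⟩
  refine ⟨fun U f => (h U).eq_of_eqOn (hres' U U le_rfl f), fun U V W hV hW f =>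
    (h W).eq_of_eqOn fun g hg => ?_, fun U V hV => ⟨fun S hS => ?_, fun a b =>
    (h V).eq_of_eqOn fun g hg => ?_⟩, fun s f hf => ?_, fun s S hS => ?_⟩
  · rw [hres' V W hW _ hg, hres' U V hV _ (hmono hW hg), hres' U W _ _ hg]
  · refine ((h V).bdd_bornAlg hd).2 ?_
    obtain ⟨L, hL, h1, h2⟩ := ((h U).bdd_bornAlg hd).1 hS
    refine ⟨L ∩ G.arrowsOver V, ⟨⟨inter_subset_right, fun K hK hKc => ?_⟩, False.elim⟩, ?_,
      fun D hD l K hKV hK => ?_⟩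
    · have hKV : G.arrowsOver K ⊆ G.arrowsOver V := preimage_mono hK
      rw [inter_assoc, inter_eq_self_of_subset_right hKV]
      exact hL.1.2 K (hK.trans hV) hKc
    · rintro _ ⟨a, ha, rfl⟩
      rw [hres, support_indicator, inter_comm]
      exact inter_subset_inter_left _ (h1 a ha)
    · obtain ⟨r, hr⟩ := h2 D hD l K (hKV.trans (hmono hV)) hK
      refine ⟨r, ?_⟩
      rintro _ ⟨a, ha, rfl⟩ g hg
      have e : coeffFun l (ι V (res U V hV a)) =ᶠ[𝓝 g] coeffFun l (ι U a) := by
        filter_upwards [(G.isOpen_arrowsOver V).mem_nhds (hKV hg)] with k hk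
        rw [coeffFun, coeffFun, hres' U V hV a hk]
      rw [hD.congr e]
      exact hr a ha g hg
  · rw [hres' U V hV _ hg]
    refine ((h U).mul_apply hd a b (hmono hV hg)).trans
      (Eq.trans ?_ ((h V).mul_apply hd _ _ hg).symm)
    exact starConv_congr hd.star.bidiff (fun k hk => ((h U).isSection a).regular k (hmono hV hk))
      (fun k hk => ((h U).isSection b).regular k (hmono hV hk)) (hres' U V hV a).symm
      (hres' U V hV b).symm hg
  · classical
    -- The member of the cover is chosen separately at each arrow; compatibility on intersections
    -- makes the value independent of the choice.
    let F : G₁ → PowerSeries 𝕜 := fun g =>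
      if hg : ∃ U : s, g ∈ G.arrowsOver (U : Opens G.Orbit) then
        ι hg.choose (f hg.choose) g else 0
    have hF : ∀ U : s, EqOn F (ι U (f U)) (G.arrowsOver (U : Opens G.Orbit)) := by
      intro U g hg
      have hex : ∃ U : s, g ∈ G.arrowsOver (U : Opens G.Orbit) := ⟨U, hg⟩
      have hg' : g ∈ G.arrowsOver (hex.choose ⊓ U : Opens G.Orbit) := ⟨hex.choose_spec, hg⟩
      simp only [F, dif_pos hex]
      rw [← hres' _ _ inf_le_left _ hg', hf hex.choose U, hres' _ _ inf_le_right _ hg']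
    have hFs : ∀ g ∉ G.arrowsOver (sSup s : Opens G.Orbit), F g = 0 := fun g hg =>
      dif_neg fun ⟨U, hU⟩ => hg (hmono (le_sSup U.2) hU)
    obtain ⟨L, hL, hFL⟩ := exists_admissible_of_cover (s := s) (T := support F)
      (fun g hg => by_contra fun hn => hg (hFs g hn)) fun U hU => by
        obtain ⟨L, hL, hUL⟩ := ((h U).isSection (f ⟨U, hU⟩)).exists_support
        refine ⟨L, hL, fun g hg => hUL ?_⟩
        rw [mem_support, ← hF ⟨U, hU⟩ hg.2]
        exact hg.1
    have hsec : G.IsSection False (sSup s) Q F := by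
      refine ⟨hFs, fun g hg => ?_, ⟨L, hL, hFL⟩, fun l hl g => ?_⟩
      · obtain ⟨U, hU⟩ := hcov hg
        exact (((h U).isSection (f U)).regular g hU).congr
          ((hF U).eventuallyEq_of_mem ((G.isOpen_arrowsOver _).mem_nhds hU)).symm
      · by_cases hg : g ∈ G.arrowsOver (sSup s : Opens G.Orbit)
        · obtain ⟨U, hU⟩ := hcov hg
          rw [hF U hU]
          exact ((h U).isSection (f U)).coeff l hl g
        · rw [hFs g hg, map_zero]
    obtain ⟨F', hF'⟩ := (h (sSup s)).exists_eq F hsec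
    refine ⟨F', fun U => (h U).eq_of_eqOn fun g hg => ?_, fun F'' hF'' =>
      (h _).eq_of_eqOn fun g hg => ?_⟩
    · rw [hres' _ _ _ _ hg, hF', hF U hg]
    · obtain ⟨U, hU⟩ := hcov hg
      rw [← hres' _ _ (le_sSup U.2) F'' hU, hF'' U, hF', hF U hU]
  · refine ((h _).bdd_bornAlg hd).2 ?_
    have hS' := fun U : s => ((h U).bdd_bornAlg hd).1 (hS U)
    obtain ⟨L, hL, hSL⟩ := exists_admissible_of_cover (s := s)
      (T := ⋃ a ∈ S, support (ι (sSup s) a)) (fun g hg => by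
        obtain ⟨a, -, hga⟩ := mem_iUnion₂.1 hg
        exact by_contra fun hn => hga (((h _).isSection a).zero_off g hn)) fun U hU => by
        obtain ⟨L, hL, hUL, -⟩ := hS' ⟨U, hU⟩
        refine ⟨L, hL, fun g hg => ?_⟩
        obtain ⟨a, ha, hga⟩ := mem_iUnion₂.1 hg.1
        refine hUL _ ⟨a, ha, rfl⟩ ?_
        rw [mem_support, hres' _ _ _ _ hg.2]
        exact hga
    -- Uniform smoothness at an arrow is local, so it is tested in a member of the cover, where the
    -- restricted sequence is bounded.
    refine secBdd_of_unif hL (fun a ha g hg => hSL (mem_biUnion ha hg)) fun x hx g hg l => ?_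
    obtain ⟨U, hU⟩ := hcov hg
    refine ((hS' U).unif (h U) (fun n => mem_image_of_mem _ (hx n)) hU l).congr ?_
    filter_upwards [(G.isOpen_arrowsOver _).mem_nhds hU] with k hk n
    rw [coeffFun, coeffFun, hres' _ _ _ _ hk]

end ProperEtaleLieGroupoid

end

noncomputable section

/-! ### Supports and bounded sets -/

namespace ProperEtaleLieGroupoid

variable {E : Type*} [NormedAddCommGroup E] [NormedSpace ℝ E]
  {G₀ G₁ : Type*} [TopologicalSpace G₀] [ChartedSpace E G₀]
  [TopologicalSpace G₁] [ChartedSpace E G₁]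
  {G : ProperEtaleLieGroupoid E G₀ G₁} {U : Opens G.Orbit} {c : Prop} {Q : Set ℕ}
  {𝕜 : Type*} [RCLike 𝕜]

theorem regularOn_iff {a : G₁ → PowerSeries 𝕜} : G.RegularOn U a ↔
    ∀ l, ContMDiffOn 𝓘(ℝ, E) 𝓘(ℝ, 𝕜) ∞ (coeffFun l a) (G.arrowsOver U) := by
  constructor
  · exact fun h l g hg => ((h g hg).coeff l).contMDiffAt.contMDiffWithinAt
  · intro h g hg
    filter_upwards [(G.isOpen_arrowsOver U).mem_nhds hg] with k hk l
    exact (h l).smoothNear ((G.isOpen_arrowsOver U).mem_nhds hk)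

section Supports

variable [T2Space G₁] {R : Type*} [Zero R] {S : Set (G₁ → R)}

theorem hasCompactSupport_iff {a : G₁ → R} :
    HasCompactSupport a ↔ ∃ L, G.Admissible True ⊤ L ∧ support a ⊆ L := by
  constructor
  · exact fun h => ⟨tsupport a, h.isCompact.admissible (subset_univ _), subset_tsupport a⟩
  · rintro ⟨L, hL, h⟩
    exact HasCompactSupport.intro (hL.2 trivial) fun x hx => notMem_support.1 fun hx' => hx (h hx')

variable [FiniteDimensional ℝ E]

/-- The compact sets obtained over compact neighbourhoods in `U` bound the union of all supports
locally over `U`; its relative closure is the single admissible set. The converse intersects that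
set with the arrows over `K`. -/
theorem exists_compact_iff (hS : ∀ a ∈ S, ∀ g ∉ G.arrowsOver U, a g = 0) :
    (∀ K ⊆ (U : Set G.Orbit), IsCompact K →
      ∃ L, IsCompact L ∧ ∀ a ∈ S, tsupport a ∩ G.arrowsOver K ⊆ L) ↔
    ∃ L, G.Admissible False U L ∧ ∀ a ∈ S, support a ⊆ L := by
  have := G.locallyCompactSpace_orbit
  constructor
  · intro h
    refine ⟨closure (⋃ a ∈ S, support a) ∩ G.arrowsOver U,
      ⟨fibCompactSet_closure fun x hx => ?_, False.elim⟩, fun a ha g hg =>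
      ⟨subset_closure (mem_biUnion ha hg), by_contra fun hn => hg (hS a ha g hn)⟩⟩
    obtain ⟨K, hK, hKU, hKc⟩ := local_compact_nhds (U.isOpen.mem_nhds hx)
    obtain ⟨L, hL, hSL⟩ := h K hKU hKc
    refine ⟨K, hK, L, hL, ?_⟩
    rintro g ⟨hg, hgK⟩
    obtain ⟨a, ha, hga⟩ := mem_iUnion₂.1 hg
    exact hSL a ha ⟨subset_tsupport a hga, hgK⟩
  · rintro ⟨L, hL, hSL⟩ K hKU hK
    refine ⟨L ∩ G.arrowsOver K, hL.1.2 K hKU hK, fun a ha g hg => ⟨?_, hg.2⟩⟩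
    exact hL.1.closure_inter_subset (hSL a ha) ⟨hg.1, hKU hg.2⟩

theorem fibCompact_iff {a : G₁ → R} (ha : ∀ g ∉ G.arrowsOver U, a g = 0) :
    G.FibCompact U a ↔ ∃ L, G.Admissible False U L ∧ support a ⊆ L := by
  have h := exists_compact_iff (S := {a}) (by simpa using ha)
  simp only [mem_singleton_iff, forall_eq] at h
  rw [← h]
  refine forall₃_congr fun K _ hK => ⟨fun h => ⟨_, h, Subset.rfl⟩, ?_⟩
  rintro ⟨L, hL, h⟩
  exact hL.of_isClosed_subset ((isClosed_tsupport a).inter (isClosed_arrowsOver hK)) h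

end Supports

section Bounded

variable [IsManifold 𝓘(ℝ, E) ∞ G₁] [T2Space G₁] {A : Type*} [AddCommGroup A] [Module 𝕜 A]
  {ι : A →ₗ[𝕜] G₁ → PowerSeries 𝕜} {S : Set A}

theorem secBdd_top_iff : G.SecBdd True ⊤ ι S ↔
    ∃ K, IsCompact K ∧ (∀ a ∈ S, tsupport (ι a) ⊆ K) ∧
      ∀ D : (G₁ → 𝕜) → G₁ → 𝕜, IsDiffOp E D → ∀ l : ℕ,
        ∃ r : ℝ, ∀ a ∈ S, ∀ g ∈ K, ‖D (coeffFun l (ι a)) g‖ ≤ r := by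
  constructor
  · rintro ⟨L, hL, h1, h2⟩
    exact ⟨L, hL.2 trivial, fun a ha => (hL.2 trivial).isClosed.closure_subset_iff.2 (h1 a ha),
      fun D hD l => h2 D hD l L (subset_univ _) (hL.2 trivial)⟩
  · rintro ⟨L, hL, h1, h2⟩
    refine ⟨L, hL.admissible (subset_univ _), fun a ha => (subset_tsupport _).trans (h1 a ha),
      fun D hD l K _ hK => ?_⟩
    obtain ⟨r, hr⟩ := h2 D hD l
    -- A bound on the common support is a bound everywhere, since the functions vanish near every
    -- other arrow; the maximum with `0` covers these arrows.
    refine ⟨max r 0, fun a ha g _ => ?_⟩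
    by_cases hg : g ∈ L
    · exact (hr a ha g hg).trans (le_max_left _ _)
    · have e : coeffFun l (ι a) =ᶠ[𝓝 g] fun _ => 0 := by
        filter_upwards [notMem_tsupport_iff_eventuallyEq.1 fun hg' => hg (h1 a ha hg')] with k hk
        rw [coeffFun, hk, Pi.zero_apply, map_zero]
      rw [hD.congr e, hD.zero, norm_zero]
      exact le_max_right _ _

theorem secBdd_iff [FiniteDimensional ℝ E] (h : G.IsSectionSpace False U Q ι) :
    G.SecBdd False U ι S ↔
    (∀ K ⊆ (U : Set G.Orbit), IsCompact K →
      ∃ L, IsCompact L ∧ ∀ a ∈ S, tsupport (ι a) ∩ G.arrowsOver K ⊆ L) ∧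
    ∀ D : (G₁ → 𝕜) → G₁ → 𝕜, IsDiffOp E D → ∀ l : ℕ, ∀ L ⊆ G.arrowsOver U, IsCompact L →
      ∃ r : ℝ, ∀ a ∈ S, ∀ g ∈ L, ‖D (coeffFun l (ι a)) g‖ ≤ r := by
  have h1 := exists_compact_iff (S := ι '' S) (U := U) (by
    rintro _ ⟨a, -, rfl⟩
    exact (h.isSection a).zero_off)
  simp only [forall_mem_image] at h1
  rw [h1]
  constructor
  · rintro ⟨L, hL, h2, h3⟩
    exact ⟨⟨L, hL, fun a => h2 a⟩, h3⟩
  · rintro ⟨⟨L, hL, h2⟩, h3⟩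
    exact ⟨L, hL, fun a ha => h2 ha, h3⟩

end Bounded

/-! ### The inclusion of the compactly supported sections -/

/-- Both algebras sit in the same space of functions and use the same convolution; compact sets over
`U` are in particular admissible for fibrewise compact supports. -/
theorem isBddAlgHom_of_comp [FiniteDimensional ℝ E] [T2Space G₀] [T2Space G₁]
    [IsManifold 𝓘(ℝ, E) ∞ G₀] [IsManifold 𝓘(ℝ, E) ∞ G₁]
    {A A' : Type*} [AddCommGroup A] [Module 𝕜 A] [AddCommGroup A'] [Module 𝕜 A']
    {ι : A →ₗ[𝕜] G₁ → PowerSeries 𝕜} {ι' : A' →ₗ[𝕜] G₁ → PowerSeries 𝕜}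
    {C : ℕ → (G₀ → 𝕜) → (G₀ → 𝕜) → G₀ → 𝕜} (h : G.IsSectionSpace True U Q ι)
    (h' : G.IsSectionSpace False U Q ι') (hd : G.IsConvData C Q) (j : A →ₗ[𝕜] A')
    (hj : ∀ a, ι' (j a) = ι a) : IsBddAlgHom (h.bornAlg hd) (h'.bornAlg hd) j := by
  refine ⟨fun S hS => ?_, fun a b => h'.eq_of_eqOn fun g hg => ?_⟩
  · obtain ⟨L, hL, h1, h2⟩ := (h.bdd_bornAlg hd).1 hS
    refine (h'.bdd_bornAlg hd).2 ⟨L, ⟨hL.1, False.elim⟩, ?_, fun D hD l K hKU hK => ?_⟩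
    · rintro _ ⟨a, ha, rfl⟩
      rw [hj]
      exact h1 a ha
    · obtain ⟨r, hr⟩ := h2 D hD l K hKU hK
      refine ⟨r, ?_⟩
      rintro _ ⟨a, ha, rfl⟩
      rw [hj]
      exact hr a ha
  · rw [hj]
    refine (h.mul_apply hd a b hg).trans (Eq.trans ?_ (h'.mul_apply hd (j a) (j b) hg).symm)
    rw [hj, hj]

/-! ### The deformed algebras -/

section Deformed

variable (G 𝕜)

theorem isSectionSpace_defConvAlg [T2Space G₁] :
    G.IsSectionSpace True ⊤ univ (G.defConvAlg 𝕜).subtype where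
  injective := Subtype.val_injective
  isSection a := ⟨fun _ hg => absurd trivial hg, regularOn_iff.2 fun l => (a.2.1 l).contMDiffOn,
    hasCompactSupport_iff.1 a.2.2, fun _ hl => absurd trivial hl⟩
  exists_eq a ha := ⟨⟨a, fun l => contMDiffOn_univ.1 (regularOn_iff.1 ha.regular l),
    hasCompactSupport_iff.2 ha.exists_support⟩, rfl⟩

variable [FiniteDimensional ℝ E] [T2Space G₁]

theorem isSectionSpace_defFcAlg (U : Opens G.Orbit) :
    G.IsSectionSpace False U univ (G.defFcAlg 𝕜 U).subtype where
  injective := Subtype.val_injective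
  isSection a := ⟨a.2.1, regularOn_iff.2 a.2.2.1, (fibCompact_iff a.2.1).1 a.2.2.2,
    fun _ hl => absurd trivial hl⟩
  exists_eq a ha := ⟨⟨a, ha.zero_off, regularOn_iff.1 ha.regular,
    (fibCompact_iff ha.zero_off).2 ha.exists_support⟩, rfl⟩

theorem defConvAlg_le : G.defConvAlg 𝕜 ≤ G.defFcAlg 𝕜 ⊤ := by
  intro a ha
  have h := (G.isSectionSpace_defConvAlg 𝕜).isSection ⟨a, ha⟩
  obtain ⟨b, rfl⟩ := (G.isSectionSpace_defFcAlg 𝕜 ⊤).exists_eq a ⟨h.zero_off, h.regular, by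
    obtain ⟨L, hL, haL⟩ := h.exists_support
    exact ⟨L, ⟨hL.1, False.elim⟩, haL⟩, h.coeff⟩
  exact b.2

variable {G 𝕜} in
omit [FiniteDimensional ℝ E] [T2Space G₁] in
theorem InvariantStarProduct.isConvData [IsManifold 𝓘(ℝ, E) ∞ G₀] {η : SymplecticForm E G₀}
    (P : G.InvariantStarProduct 𝕜 η) : G.IsConvData P.C univ where
  star := ⟨P.bidiff, P.one_star, P.star_one, P.assoc⟩
  invariant := P.invariant
  zero_mem := trivial
  vanish _ _ _ _ _ h := absurd trivial h

end Deformed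

/-! ### The undeformed algebras -/

section Undeformed

/-- The undeformed product as a star product. -/
def trivialStar {M : Type*} (k : ℕ) (f h : M → 𝕜) (x : M) : 𝕜 := if k = 0 then f x * h x else 0

theorem starOf_trivialStar {M : Type*} (f h : M → PowerSeries 𝕜) (x : M) :
    starOf trivialStar f h x = f x * h x := by
  ext n
  rw [starOf, PowerSeries.coeff_mk, PowerSeries.coeff_mul, Finset.sum_eq_single (0, n)]
  · simp only [trivialStar, if_true, coeffFun]
  · intro q hq hq'
    refine Finset.sum_eq_zero fun r _ => if_neg fun h0 => hq' ?_
    have := Finset.HasAntidiagonal.mem_antidiagonal.1 hq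
    exact Prod.ext h0 (by omega)
  · intro h
    exact absurd (Finset.HasAntidiagonal.mem_antidiagonal.2 (zero_add n)) h

theorem isBidiffOp_trivialStar {M : Type*} [TopologicalSpace M] [ChartedSpace E M]
    [IsManifold 𝓘(ℝ, E) ∞ M] (k : ℕ) :
    IsBidiffOp E (trivialStar k : (M → 𝕜) → (M → 𝕜) → M → 𝕜) := by
  intro x
  by_cases hk : k = 0
  · refine ⟨univ, univ_mem, 1, fun _ f => f, fun _ f => f, fun _ => isDiffOp_id, fun _ => isDiffOp_id,
      fun y _ f h _ _ => ?_⟩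
    simp [trivialStar, hk]
  · refine ⟨univ, univ_mem, 0, Fin.elim0, Fin.elim0, fun i => i.elim0, fun i => i.elim0,
      fun y _ f h _ _ => ?_⟩
    simp [trivialStar, hk]

variable (𝕜) in
/-- Functions as constant formal power series of functions. -/
def constSeries (M : Type*) : (M → 𝕜) →ₗ[𝕜] M → PowerSeries 𝕜 where
  toFun a g := PowerSeries.C (a g)
  map_add' a b := funext fun g => map_add PowerSeries.C (a g) (b g)
  map_smul' r a := funext fun g => by
    rw [Pi.smul_apply, smul_eq_mul, map_mul, RingHom.id_apply, Pi.smul_apply,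
      PowerSeries.smul_eq_C_mul]

variable {M : Type*}

theorem constSeries_injective : Injective (constSeries 𝕜 M) := fun _ _ h => funext fun g =>
  PowerSeries.C_injective (congrFun h g)

theorem support_constSeries (a : M → 𝕜) : support (constSeries 𝕜 M a) = support a := by
  ext g
  simp [constSeries]

theorem coeffFun_constSeries (a : M → 𝕜) : coeffFun 0 (constSeries 𝕜 M a) = a := by
  ext g
  simp [coeffFun, constSeries]

theorem coeffFun_constSeries_of_ne {l : ℕ} (hl : l ≠ 0) (a : M → 𝕜) :
    coeffFun l (constSeries 𝕜 M a) = fun _ => 0 := by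
  ext g
  simp [coeffFun, constSeries, PowerSeries.coeff_C, hl]

theorem constSeries_coeffFun {a : M → PowerSeries 𝕜}
    (ha : ∀ l ∉ ({0} : Set ℕ), ∀ g, PowerSeries.coeff l (a g) = 0) :
    constSeries 𝕜 M (coeffFun 0 a) = a := by
  ext g l
  by_cases hl : l = 0
  · subst hl
    exact congrFun (coeffFun_constSeries (coeffFun 0 a)) g
  · exact (congrFun (coeffFun_constSeries_of_ne hl _) g).trans (ha l hl g).symm

variable (G)

variable (𝕜) in
-- With `Q = {0}`, the condition `vanish` says that positive orders do not occur in the product, so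
-- series of degree `0` are closed under it. Invariance holds since only values at the target enter.
theorem isConvData_trivialStar [IsManifold 𝓘(ℝ, E) ∞ G₀] :
    G.IsConvData (trivialStar : ℕ → (G₀ → 𝕜) → (G₀ → 𝕜) → G₀ → 𝕜) {0} where
  star := ⟨isBidiffOp_trivialStar, fun x f _ => by rw [starOf_trivialStar, _root_.one_mul],
    fun x f _ => by rw [starOf_trivialStar, _root_.mul_one],
    fun x f h e _ _ _ => by simp only [starOf_trivialStar, _root_.mul_assoc]⟩
  invariant k g f h _ _ := by
    have e : ∀ f : G₀ → 𝕜, G.act f g (G.src g) = f (G.tgt g) := fun f =>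
      congrArg (fun k => f (G.tgt k)) (G.sec_src g)
    simp only [trivialStar, e]
  zero_mem := rfl
  vanish k i hi j hj hk f h x := by
    refine if_neg fun h0 => hk ?_
    rw [mem_singleton_iff] at hi hj ⊢
    omega

theorem regularOn_constSeries {a : G₁ → 𝕜} : G.RegularOn U (constSeries 𝕜 G₁ a) ↔
    ContMDiffOn 𝓘(ℝ, E) 𝓘(ℝ, 𝕜) ∞ a (G.arrowsOver U) := by
  rw [regularOn_iff]
  constructor
  · intro h
    have := h 0
    rwa [coeffFun_constSeries] at this
  · intro h l
    by_cases hl : l = 0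
    · rwa [hl, coeffFun_constSeries]
    · rw [coeffFun_constSeries_of_ne hl]
      exact contMDiffOn_const

/-- The trivial star product evaluates germs at their base points, where the local sections return
the two factors of the arrow. -/
theorem starConv_constSeries (a b : G₁ → 𝕜) (g : G₁) :
    G.starConv trivialStar (constSeries 𝕜 G₁ a) (constSeries 𝕜 G₁ b) g =
      constSeries 𝕜 G₁ (G.conv a b) g := by
  have h1 : constSeries 𝕜 G₁ (G.conv a b) g =
      ∑ᶠ p : G.Factor g, PowerSeries.C (a p.1.1 * b p.1.2) :=
    AddMonoidHom.map_finsum_of_injective (PowerSeries.C (R := 𝕜)).toAddMonoidHom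
      PowerSeries.C_injective _
  rw [h1]
  refine finsum_congr ?_
  rintro ⟨⟨k, h⟩, hkh, rfl⟩
  rw [starOf_trivialStar, map_mul, G.src_mul k h hkh]
  have e1 : G.sec h (G.src h) = h := G.sec_src h
  have e2 : G.sec k (G.tgt (G.sec h (G.src h))) = k := by
    rw [e1, ← hkh, G.sec_src]
  exact congrArg₂ (· * ·) (congrArg (constSeries 𝕜 G₁ a) e2) (congrArg (constSeries 𝕜 G₁ b) e1)

end Undeformed

end ProperEtaleLieGroupoid

end

/-! ### The undeformed algebras as spaces of sections of degree zero. -/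

noncomputable section

namespace ProperEtaleLieGroupoid

variable {E : Type*} [NormedAddCommGroup E] [NormedSpace ℝ E]
  {G₀ G₁ : Type*} [TopologicalSpace G₀] [ChartedSpace E G₀]
  [TopologicalSpace G₁] [ChartedSpace E G₁]
  (G : ProperEtaleLieGroupoid E G₀ G₁) (𝕜 : Type*) [RCLike 𝕜]

theorem isSectionSpace_convAlg [T2Space G₁] :
    G.IsSectionSpace True ⊤ {0} (constSeries 𝕜 G₁ ∘ₗ (G.convAlg 𝕜).subtype) where
  injective := constSeries_injective.comp Subtype.val_injective
  isSection a := ⟨fun _ hg => absurd trivial hg, (G.regularOn_constSeries).2 a.2.1.contMDiffOn, by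
    obtain ⟨L, hL, h⟩ := (hasCompactSupport_iff (G := G)).1 a.2.2
    exact ⟨L, hL, (support_constSeries a.1).trans_subset h⟩,
    fun _ hl g => congrFun (coeffFun_constSeries_of_ne hl a.1) g⟩
  exists_eq a ha := by
    obtain ⟨b, rfl⟩ : ∃ b, constSeries 𝕜 G₁ b = a := ⟨_, constSeries_coeffFun ha.coeff⟩
    refine ⟨⟨b, contMDiffOn_univ.1 ((G.regularOn_constSeries).1 ha.regular),
      (hasCompactSupport_iff (G := G)).2 ?_⟩, rfl⟩
    have := ha.exists_support
    rwa [support_constSeries] at this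

variable [FiniteDimensional ℝ E] [T2Space G₁]

theorem isSectionSpace_fcAlg (U : Opens G.Orbit) :
    G.IsSectionSpace False U {0} (constSeries 𝕜 G₁ ∘ₗ (G.fcAlg 𝕜 U).subtype) where
  injective := constSeries_injective.comp Subtype.val_injective
  isSection a := ⟨fun g hg => (congrArg PowerSeries.C (a.2.1 g hg)).trans (map_zero _),
    (G.regularOn_constSeries).2 a.2.2.1, by
    obtain ⟨L, hL, h⟩ := (fibCompact_iff a.2.1).1 a.2.2.2
    exact ⟨L, hL, (support_constSeries a.1).trans_subset h⟩,
    fun _ hl g => congrFun (coeffFun_constSeries_of_ne hl a.1) g⟩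
  exists_eq a ha := by
    obtain ⟨b, rfl⟩ : ∃ b, constSeries 𝕜 G₁ b = a := ⟨_, constSeries_coeffFun ha.coeff⟩
    have hb : ∀ g ∉ G.arrowsOver U, b g = 0 := fun g hg =>
      PowerSeries.C_injective ((ha.zero_off g hg).trans (map_zero _).symm)
    refine ⟨⟨b, hb, (G.regularOn_constSeries).1 ha.regular, (fibCompact_iff hb).2 ?_⟩, rfl⟩
    have := ha.exists_support
    rwa [support_constSeries] at this

theorem convAlg_le : G.convAlg 𝕜 ≤ G.fcAlg 𝕜 ⊤ := by
  intro a ha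
  have hz : ∀ g ∉ G.arrowsOver (⊤ : Opens G.Orbit), a g = 0 := fun _ hg => absurd trivial hg
  obtain ⟨L, hL, haL⟩ := (hasCompactSupport_iff (G := G)).1 ha.2
  exact ⟨hz, ha.1.contMDiffOn, (fibCompact_iff hz).2 ⟨L, ⟨hL.1, False.elim⟩, haL⟩⟩

variable {G 𝕜} in
omit [FiniteDimensional ℝ E] in
theorem secBdd_convAlg_iff [IsManifold 𝓘(ℝ, E) ∞ G₁] {S : Set (G.convAlg 𝕜)} :
    G.SecBdd True ⊤ (constSeries 𝕜 G₁ ∘ₗ (G.convAlg 𝕜).subtype) S ↔ G.ConvBdd S := by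
  rw [secBdd_top_iff]
  have hts : ∀ a : G₁ → 𝕜, tsupport (constSeries 𝕜 G₁ a) = tsupport a := fun a => by
    rw [tsupport, support_constSeries, tsupport]
  refine exists_congr fun K => and_congr_right fun _ => and_congr
    (forall₂_congr fun a _ => by rw [LinearMap.comp_apply, hts]; rfl)
    (forall₂_congr fun D hD => ⟨fun h => ?_, fun h l => ?_⟩)
  · obtain ⟨r, hr⟩ := h 0
    refine ⟨r, fun a ha g hg => ?_⟩
    have := hr a ha g hg
    rwa [LinearMap.comp_apply, coeffFun_constSeries] at this
  · obtain ⟨r, hr⟩ := h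
    by_cases hl : l = 0
    · refine ⟨r, fun a ha g hg => ?_⟩
      rw [hl, LinearMap.comp_apply, coeffFun_constSeries]
      exact hr a ha g hg
    · refine ⟨0, fun a _ g _ => ?_⟩
      rw [LinearMap.comp_apply, coeffFun_constSeries_of_ne hl, hD.zero, norm_zero]

variable {G 𝕜} in
theorem secBdd_fcAlg_iff [IsManifold 𝓘(ℝ, E) ∞ G₁] {U : Opens G.Orbit} {S : Set (G.fcAlg 𝕜 U)} :
    G.SecBdd False U (constSeries 𝕜 G₁ ∘ₗ (G.fcAlg 𝕜 U).subtype) S ↔ G.FcBdd U S := by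
  rw [secBdd_iff (G.isSectionSpace_fcAlg 𝕜 U)]
  have hts : ∀ a : G₁ → 𝕜, tsupport (constSeries 𝕜 G₁ a) = tsupport a := fun a => by
    rw [tsupport, support_constSeries, tsupport]
  refine and_congr (forall₃_congr fun K _ _ => exists_congr fun L => and_congr_right fun _ =>
    forall₂_congr fun a _ => by rw [LinearMap.comp_apply, hts]; rfl)
    (forall₂_congr fun D hD => ⟨fun h L hLU hL => ?_, fun h l L hLU hL => ?_⟩)
  · obtain ⟨r, hr⟩ := h 0 L hLU hL
    refine ⟨r, fun a ha g hg => ?_⟩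
    have := hr a ha g hg
    rwa [LinearMap.comp_apply, coeffFun_constSeries] at this
  · obtain ⟨r, hr⟩ := h L hLU hL
    by_cases hl : l = 0
    · refine ⟨r, fun a ha g hg => ?_⟩
      rw [hl, LinearMap.comp_apply, coeffFun_constSeries]
      exact hr a ha g hg
    · refine ⟨0, fun a _ g _ => ?_⟩
      rw [LinearMap.comp_apply, coeffFun_constSeries_of_ne hl, hD.zero, norm_zero]

end ProperEtaleLieGroupoid

end

/-- Each half applies the abstract results to one pair of section spaces; what remains is to
translate the product, the bounded sets and the restriction maps. In the undeformed half this is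
done through the injective constant-series embedding. -/
theorem theoremO {𝕜 : Type*} [RCLike 𝕜]
    {E : Type*} [NormedAddCommGroup E] [NormedSpace ℝ E] [FiniteDimensional ℝ E]
    {G₀ G₁ : Type*}
    [TopologicalSpace G₀] [ChartedSpace E G₀] [IsManifold 𝓘(ℝ, E) ∞ G₀]
    [T2Space G₀] [SecondCountableTopology G₀]
    [TopologicalSpace G₁] [ChartedSpace E G₁] [IsManifold 𝓘(ℝ, E) ∞ G₁]
    [T2Space G₁] [SecondCountableTopology G₁]
    (G : ProperEtaleLieGroupoid E G₀ G₁) :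
    (∃ (B : BornAlg 𝕜 (G.convAlg 𝕜)) (F : ∀ U : Opens G.Orbit, BornAlg 𝕜 (G.fcAlg 𝕜 U)),
      -- the convolution algebra
      ((∀ a b g, (B.mul a b).1 g = G.conv a.1 b.1 g) ∧
        (∀ S, B.born.Bdd S ↔ G.ConvBdd S) ∧ BornAlg.QuasiUnital.{w} B) ∧
      -- the sheaf of algebras of functions with fibrewise compact support
      (∀ U : Opens G.Orbit, (∀ a b, ∀ g ∈ G.arrowsOver U, ((F U).mul a b).1 g = G.conv a.1 b.1 g) ∧
        (∀ S, (F U).born.Bdd S ↔ G.FcBdd U S) ∧ BornAlg.QuasiUnital.{w} (F U)) ∧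
      IsBornAlgSheaf F (G.fcRes 𝕜) ∧
      -- the natural homomorphism
      ∃ j : G.convAlg 𝕜 →ₗ[𝕜] G.fcAlg 𝕜 ⊤,
        (∀ a, (j a).1 = a.1) ∧ IsBddAlgHom B (F ⊤) j) ∧
    ∀ (η : SymplecticForm E G₀) (_ : G.InvariantForm η) (P : G.InvariantStarProduct 𝕜 η),
      ∃ (B : BornAlg 𝕜 (G.defConvAlg 𝕜)) (F : ∀ U : Opens G.Orbit, BornAlg 𝕜 (G.defFcAlg 𝕜 U)),
        ((∀ a b g, (B.mul a b).1 g = G.defConv P a.1 b.1 g) ∧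
          (∀ S, B.born.Bdd S ↔ G.DefConvBdd S) ∧ BornAlg.QuasiUnital.{w} B) ∧
        (∀ U : Opens G.Orbit, (∀ a b, ∀ g ∈ G.arrowsOver U, ((F U).mul a b).1 g = G.defConv P a.1 b.1 g) ∧
          (∀ S, (F U).born.Bdd S ↔ G.DefFcBdd U S) ∧ BornAlg.QuasiUnital.{w} (F U)) ∧
        IsBornAlgSheaf F (G.defFcRes 𝕜) ∧
        ∃ j : G.defConvAlg 𝕜 →ₗ[𝕜] G.defFcAlg 𝕜 ⊤,
          (∀ a, (j a).1 = a.1) ∧ IsBddAlgHom B (F ⊤) j := by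
  refine ⟨?_, fun η _ P => ?_⟩
  · have hd := G.isConvData_trivialStar 𝕜
    have h := G.isSectionSpace_convAlg 𝕜
    have h' := G.isSectionSpace_fcAlg 𝕜
    refine ⟨h.bornAlg hd, fun U => (h' U).bornAlg hd, ⟨fun a b g => ?_, fun S =>
      (h.bdd_bornAlg hd).trans ProperEtaleLieGroupoid.secBdd_convAlg_iff, h.quasiUnital hd⟩, fun U => ⟨fun a b g hg => ?_,
      fun S => ((h' U).bdd_bornAlg hd).trans ProperEtaleLieGroupoid.secBdd_fcAlg_iff, (h' U).quasiUnital hd⟩,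
      ProperEtaleLieGroupoid.isBornAlgSheaf h' hd _ fun U V hV a => ?_, Submodule.inclusion (G.convAlg_le 𝕜),
      fun a => rfl, ProperEtaleLieGroupoid.isBddAlgHom_of_comp h (h' ⊤) hd _ fun a => rfl⟩
    · exact PowerSeries.C_injective ((h.mul_apply hd a b (g := g) trivial).trans
        (G.starConv_constSeries a.1 b.1 g))
    · exact PowerSeries.C_injective (((h' U).mul_apply hd a b hg).trans
        (G.starConv_constSeries a.1 b.1 g))
    · refine funext fun g => ?_
      by_cases hg : g ∈ G.arrowsOver V
      · rw [indicator_of_mem hg]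
        exact congrArg PowerSeries.C (indicator_of_mem hg a.1)
      · rw [indicator_of_notMem hg]
        exact (congrArg PowerSeries.C (indicator_of_notMem hg a.1)).trans (map_zero _)
  · have hd := P.isConvData
    have h := G.isSectionSpace_defConvAlg 𝕜
    have h' := G.isSectionSpace_defFcAlg 𝕜
    exact ⟨h.bornAlg hd, fun U => (h' U).bornAlg hd, ⟨fun a b g =>
      h.mul_apply hd a b (g := g) trivial, fun S =>
      (h.bdd_bornAlg hd).trans ProperEtaleLieGroupoid.secBdd_top_iff, h.quasiUnital hd⟩, fun U => ⟨fun a b g hg =>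
      (h' U).mul_apply hd a b hg, fun S => ((h' U).bdd_bornAlg hd).trans (ProperEtaleLieGroupoid.secBdd_iff (h' U)),
      (h' U).quasiUnital hd⟩, ProperEtaleLieGroupoid.isBornAlgSheaf h' hd _ fun U V hV a => rfl,
      Submodule.inclusion (G.defConvAlg_le 𝕜), fun a => rfl,
      ProperEtaleLieGroupoid.isBddAlgHom_of_comp h (h' ⊤) hd _ fun a => rfl⟩
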